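/- Let $d\in\{1,2,3\}$, let $V_\uparrow,V_\downarrow:\mathbb R^d\to[0,\infty)$ be locally integrable with $\lim_{|x|\to\infty}V_j(x)=+\infty$ ($j=\uparrow,\downarrow$), let $\delta,\Omega,\beta_{\uparrow\uparrow},\beta_{\uparrow\downarrow},\beta_{\downarrow\downarrow}\in\mathbb R$ and $B=\begin{pmatrix}\beta_{\uparrow\uparrow}&\beta_{\uparrow\downarrow}\\ \beta_{\uparrow\downarrow}&\beta_{\downarrow\downarrow}\end{pmatrix}$. For $\Phi=(\phi_\uparrow,\phi_\downarrow)$ put $$E(\Phi)=\int_{\mathbb R^d}\Big[\sum_{j=\uparrow,\downarrow}\big(\tfrac12|\nabla\phi_j|^2+V_j|\phi_j|^2\big)+\tfrac\delta2\big(|\phi_\uparrow|^2-|\phi_\downarrow|^2\big)+\tfrac12\beta_{\uparrow\uparrow}|\phi_\uparrow|^4+\tfrac12\beta_{\downarrow\downarrow}|\phi_\downarrow|^4+\beta_{\uparrow\downarrow}|\phi_\uparrow|^2|\phi_\downarrow|^2+\Omega\,\mathrm{Re}(\phi_\uparrow\overline{\phi_\downarrow})\Big]dx,$$ and let $S$ be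 the set of all $\Phi\in H^1(\mathbb R^d;\mathbb C)^2$ of finite energy (every term of the integrand is integrable) with $\int(|\phi_\uparrow|^2+|\phi_\downarrow|^2)\,dx=1$. A ground state is a $\Phi_g\in S$ with $E(\Phi_g)=\min_{\Phi\in S}E(\Phi)$. Let $$C_b=\inf_{0\ne f\in H^1(\mathbb R^2)}\frac{\|\nabla f\|_{L^2}^2\,\|f\|_{L^2}^2}{\|f\|_{L^4}^4},\qquad I(x)=(V_\uparrow(x)-V_\downarrow(x)+\delta)^2+(\beta_{\uparrow\uparrow}-\beta_{\uparrow\downarrow})^2+(\beta_{\uparrow\downarrow}-\beta_{\downarrow\downarrow})^2.$$ Suppose that at least one of the following holds: (i) $d=1$; (ii) $d=2$, $\beta_{\uparrow\uparrow}>-C_b$, $\beta_{\downarrow\downarrow}>-C_b$ and $\beta_{\uparrow\downarrow}>-C_b-\sqrt{C_b+\beta_{\uparrow\uparrow}}\sqrt{C_b+\beta_{\downarrow\downarrow}}$; (iii) $d=3$ and $B$ is positive semi-definite or has only nonnegative entries. Then: 1. There exists a ground state. 2. If $(\phi_\uparrow^g,\phi_\downarrow^g)$ is a ground state, then so is $(e^{i\theta_\uparrow}|\phi_\uparrow^g|,e^{i\theta_\downarrow}|\phi_\downarrow^g|)$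 for all $\theta_\uparrow,\theta_\downarrow\in[0,2\pi)$ such that $\theta_\uparrow-\theta_\downarrow=\pm\pi$ in case $\Omega>0$ and $\theta_\uparrow-\theta_\downarrow=0$ in case $\Omega<0$. 3. If $B$ is positive semi-definite, $\Omega\ne0$ and $I\not\equiv0$, then the ground state $(|\phi_\uparrow^g|,-\mathrm{sign}(\Omega)|\phi_\downarrow^g|)$ is unique: it is (up to null sets) the same for all ground states $(\phi_\uparrow^g,\phi_\downarrow^g)$. In contrast, suppose that one of the following holds: (i)$'$ $d=2$ and at least one of $\beta_{\uparrow\uparrow}<-C_b$; $\beta_{\downarrow\downarrow}<-C_b$; or $\beta_{\uparrow\uparrow},\beta_{\downarrow\downarrow}\ge-C_b$ and $\beta_{\uparrow\downarrow}<-C_b-\sqrt{C_b+\beta_{\uparrow\uparrow}}\sqrt{C_b+\beta_{\downarrow\downarrow}}$; (ii)$'$ $d=3$ and at least one of $\beta_{\uparrow\uparrow}<0$; $\beta_{\downarrow\downarrow}<0$; or $\beta_{\uparrow\downarrow}<0$ and $\beta_{\uparrow\downarrow}^2>\beta_{\uparrow\uparrow}\beta_{\downarrow\downarrow}$. Then there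 is no ground state, and $\inf_{\Phi\in S}E(\Phi)=-\infty$. -/

import Mathlib

open MeasureTheory Filter Topology
open scoped ContDiff

namespace SpinorBEC

/-- The space `ℝ^d` with its Euclidean norm. -/
abbrev Space (d : ℕ) : Type := EuclideanSpace ℝ (Fin d)

/-- `g` is a weak gradient of `f : ℝ^d → ℂ`: `∫ f ∂ᵢη = -∫ gᵢ η` for every test function
`η ∈ C_c^∞(ℝ^d)` and every coordinate `i`. -/
def IsWeakGrad {d : ℕ} (f : Space d → ℂ) (g : Space d → EuclideanSpace ℂ (Fin d)) : Prop :=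
  ∀ η : Space d → ℝ, ContDiff ℝ ∞ η → HasCompactSupport η → ∀ i : Fin d,
    ∫ x, fderiv ℝ η x (EuclideanSpace.single i (1 : ℝ)) • f x = - ∫ x, η x • g x i

/-- `f` has a square-integrable weak gradient. -/
def HasL2Grad {d : ℕ} (f : Space d → ℂ) : Prop :=
  ∃ g : Space d → EuclideanSpace ℂ (Fin d), MemLp g 2 volume ∧ IsWeakGrad f g

/-- Membership in `H¹(ℝ^d; ℂ)`. -/
def MemH1 {d : ℕ} (f : Space d → ℂ) : Prop :=
  MemLp f 2 volume ∧ HasL2Grad f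

open Classical in
/-- The weak gradient of `f` (determined up to a null set if `f ∈ H¹`; `0` if there is none). -/
noncomputable def weakGrad {d : ℕ} (f : Space d → ℂ) : Space d → EuclideanSpace ℂ (Fin d) :=
  if h : HasL2Grad f then h.choose else 0

/-- The best constant `C_b` of the Gagliardo-Nirenberg inequality in dimension two: the infimum of
`‖∇f‖₂² ‖f‖₂² / ‖f‖₄⁴` over `0 ≠ f ∈ H¹(ℝ²)`. -/
noncomputable def bestConst : ℝ :=
  sInf {r : ℝ | ∃ f : Space 2 → ℂ, MemH1 f ∧ ¬ (f =ᵐ[volume] 0) ∧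
    r = (∫ x, ‖weakGrad f x‖ ^ 2) * (∫ x, ‖f x‖ ^ 2) / ∫ x, ‖f x‖ ^ 4}

/-- The data of the two-component Gross-Pitaevskii energy on `ℝ^d`: trapping potentials,
detuning `δ`, Josephson coupling `Ω`, and interaction strengths (`u` is spin up, `d` spin down). -/
structure GPData (d : ℕ) where
  Vu : Space d → ℝ
  Vd : Space d → ℝ
  δ : ℝ
  Ω : ℝ
  βuu : ℝ
  βud : ℝ
  βdd : ℝ

namespace GPData

variable {d : ℕ}

/-- The (symmetric) interaction matrix. -/
def B (P : GPData d) : Matrix (Fin 2) (Fin 2) ℝ :=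
  !![P.βuu, P.βud; P.βud, P.βdd]

/-- The interaction matrix has nonnegative entries. -/
def BNonneg (P : GPData d) : Prop :=
  0 ≤ P.βuu ∧ 0 ≤ P.βud ∧ 0 ≤ P.βdd

/-- The function `I`. -/
def I (P : GPData d) (x : Space d) : ℝ :=
  (P.Vu x - P.Vd x + P.δ) ^ 2 + (P.βuu - P.βud) ^ 2 + (P.βud - P.βdd) ^ 2

/-- The energy density of `Φ = (u, v)`. -/
noncomputable def energyDensity (P : GPData d) (u v : Space d → ℂ) (x : Space d) : ℝ :=
  (1 / 2 * ‖weakGrad u x‖ ^ 2 + P.Vu x * ‖u x‖ ^ 2)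
    + (1 / 2 * ‖weakGrad v x‖ ^ 2 + P.Vd x * ‖v x‖ ^ 2)
    + P.δ / 2 * (‖u x‖ ^ 2 - ‖v x‖ ^ 2)
    + 1 / 2 * P.βuu * ‖u x‖ ^ 4 + 1 / 2 * P.βdd * ‖v x‖ ^ 4
    + P.βud * (‖u x‖ ^ 2 * ‖v x‖ ^ 2)
    + P.Ω * (u x * (starRingEnd ℂ) (v x)).re

/-- The energy of `Φ = (u, v)`. -/
noncomputable def energy (P : GPData d) (u v : Space d → ℂ) : ℝ :=
  ∫ x, P.energyDensity u v x

/-- The constraint set `S`: unit mass and finite energy, i.e. every term of the energy density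
is integrable. -/
structure Admissible (P : GPData d) (u v : Space d → ℂ) : Prop where
  memH1_u : MemH1 u
  memH1_v : MemH1 v
  memL4_u : MemLp u 4 volume
  memL4_v : MemLp v 4 volume
  integrable_Vu : Integrable (fun x => P.Vu x * ‖u x‖ ^ 2) volume
  integrable_Vd : Integrable (fun x => P.Vd x * ‖v x‖ ^ 2) volume
  mass : ∫ x, (‖u x‖ ^ 2 + ‖v x‖ ^ 2) = 1

/-- `(u, v)` minimizes the energy over `S`. -/
def IsGroundState (P : GPData d) (u v : Space d → ℂ) : Prop :=
  P.Admissible u v ∧ ∀ u' v' : Space d → ℂ, P.Admissible u' v' → P.energy u v ≤ P.energy u' v'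

/-- The conditions for existence. -/
def ExistenceCond (P : GPData d) : Prop :=
  d = 1 ∨
  (d = 2 ∧ -bestConst < P.βuu ∧ -bestConst < P.βdd ∧
    -bestConst - √(bestConst + P.βuu) * √(bestConst + P.βdd) < P.βud) ∨
  (d = 3 ∧ (P.B.PosSemidef ∨ P.BNonneg))

/-- The conditions for non-existence. -/
def NonexistenceCond (P : GPData d) : Prop :=
  (d = 2 ∧ (P.βuu < -bestConst ∨ P.βdd < -bestConst ∨
    P.βud < -bestConst - √(bestConst + P.βuu) * √(bestConst + P.βdd))) ∨
  (d = 3 ∧ (P.βuu < 0 ∨ P.βdd < 0 ∨ (P.βud < 0 ∧ P.βuu * P.βdd < P.βud ^ 2)))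

end GPData

end SpinorBEC

/-! Existence is the direct method. On pairs of unit mass the interaction is bounded below by minus
a fraction θ < 1 of the kinetic energy, up to a constant (`GPData.Stable`). Minimizing sequences
therefore have bounded kinetic and potential energy. Local Rellich compactness and the confinement
give strong L² convergence, Gagliardo-Nirenberg upgrades it to L⁴, and the kinetic and potential
energies can only drop in the limit (`exists_formTendsto_subseq`, `exists_groundState`). For d = 1
the fraction comes from Gagliardo-Nirenberg and Young; for d = 3 the interaction is nonnegative. For
d = 2 the sharp inequality is applied to ρ = √(|u|² + |v|²), whose kinetic energy is at most that of
(u, v) (`stable_two`).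

Phases: passing to moduli does not increase the kinetic energy, and the coupling term is at least
-|Ω| ∫ |u||v|, with equality for moduli with the right relative phase (`quadPart_norm_le`,
`energy_phase_eq`).

Uniqueness: for two nonnegative minimizers (a, b) and (a', b') the pair (√(a² + a'²), √(b² + b'²))
is compared with both. The quadratic part is subadditive under this operation and the interaction is
a convex function of the densities, so minimality forces equality in every estimate: a b' = a' b and
a ∇a' = a' ∇a almost everywhere (`GPData.IsReducedGroundState.proportional`). To deduce that a'/a is
constant without a maximum principle, (a, b) is compared with (√(a² + tη²), b). The result as t → 0
is a local L² bound on ∇a / a (`GPData.IsReducedGroundState.locallyIntegrable_log`), and with it the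
direction a / √(a² + a'²) has weak gradient zero (`ratio_ae_const`). The same argument with a' = 0
shows that a vanishes almost nowhere or almost everywhere, and the coupling Ω ≠ 0 excludes the
latter. The common mass fixes the ratio to be 1.

Nonexistence: both components are taken to be multiples of one concentrating profile l^{d/2} F(l x).
The kinetic energy scales like l², the interaction like l^d, and the potential energy is o(l^d). For
d = 3 a negative value of the quadratic form of B on the quadrant suffices; for d = 2 the two terms
balance and a nearly optimal F for `bestConst` makes their sum negative (`exists_energy_lt`). -/

namespace SpinorBEC

open scoped ENNReal NNReal Convolution ComplexConjugate

/-! ### Weak gradients: algebra, uniqueness, stability under limits -/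

section

variable {d : ℕ}

/-- The classical gradient of `F : ℝ^d → ℂ`. -/
noncomputable def cgrad (F : Space d → ℂ) (x : Space d) : EuclideanSpace ℂ (Fin d) :=
  WithLp.toLp 2 fun i => fderiv ℝ F x (EuclideanSpace.single i (1 : ℝ))

@[simp] lemma cgrad_apply (F : Space d → ℂ) (x : Space d) (i : Fin d) :
    cgrad F x i = fderiv ℝ F x (EuclideanSpace.single i (1 : ℝ)) := rfl

lemma cgrad_eq_zero_of_notMem {F : Space d → ℂ} {x : Space d} (hx : x ∉ tsupport F) :
    cgrad F x = 0 := by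
  ext i
  have : fderiv ℝ F x = 0 := by
    by_contra h
    exact hx (support_fderiv_subset ℝ h)
  simp [this]

lemma continuous_cgrad {F : Space d → ℂ} (hF : ContDiff ℝ 1 F) : Continuous (cgrad F) := by
  refine (PiLp.continuous_toLp 2 _).comp (continuous_pi fun i => ?_)
  exact (hF.continuous_fderiv one_ne_zero).clm_apply continuous_const

lemma hasCompactSupport_cgrad {F : Space d → ℂ} (hF : HasCompactSupport F) :
    HasCompactSupport (cgrad F) :=
  HasCompactSupport.intro hF fun _ hx => cgrad_eq_zero_of_notMem hx

lemma continuous_partial {η : Space d → ℝ} (hη : ContDiff ℝ ∞ η) (i : Fin d) :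
    Continuous fun x => fderiv ℝ η x (EuclideanSpace.single i (1 : ℝ)) :=
  (hη.continuous_fderiv (by simp)).clm_apply continuous_const

lemma hasCompactSupport_partial {η : Space d → ℝ} (hη : HasCompactSupport η) (i : Fin d) :
    HasCompactSupport fun x => fderiv ℝ η x (EuclideanSpace.single i (1 : ℝ)) :=
  hη.fderiv_apply (𝕜 := ℝ) _

lemma contDiff_partial {η : Space d → ℝ} (hη : ContDiff ℝ ∞ η) (i : Fin d) :
    ContDiff ℝ ∞ fun x => fderiv ℝ η x (EuclideanSpace.single i (1 : ℝ)) :=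
  (hη.fderiv_right (m := ∞) (by simp)).clm_apply contDiff_const

lemma memLp_apply {g : Space d → EuclideanSpace ℂ (Fin d)} {p : ℝ≥0∞} (hg : MemLp g p volume)
    (i : Fin d) : MemLp (fun x => g x i) p volume :=
  (EuclideanSpace.proj i : EuclideanSpace ℂ (Fin d) →L[ℂ] ℂ).comp_memLp' hg

lemma locallyIntegrable_apply {g : Space d → EuclideanSpace ℂ (Fin d)}
    (hg : LocallyIntegrable g volume) (i : Fin d) :
    LocallyIntegrable (fun x => g x i) volume := by
  intro x
  obtain ⟨s, hs, hi⟩ := hg x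
  exact ⟨s, hs, (EuclideanSpace.proj i : EuclideanSpace ℂ (Fin d) →L[ℂ] ℂ).integrable_comp hi⟩

lemma locInt {E : Type*} [NormedAddCommGroup E] {f : Space d → E}
    (hf : MemLp f 2 volume) : LocallyIntegrable f volume :=
  hf.locallyIntegrable (by norm_num)

lemma integrable_test_smul {E : Type*} [NormedAddCommGroup E] [NormedSpace ℝ E] {f : Space d → E}
    (hf : LocallyIntegrable f volume) {η : Space d → ℝ} (hη : Continuous η)
    (hc : HasCompactSupport η) : Integrable (fun x => η x • f x) volume :=
  hf.integrable_smul_left_of_hasCompactSupport hη hc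

lemma isWeakGrad_zero : IsWeakGrad (0 : Space d → ℂ) 0 := by
  intro η _ _ i
  simp

lemma IsWeakGrad.add {f₁ f₂ : Space d → ℂ} {g₁ g₂ : Space d → EuclideanSpace ℂ (Fin d)}
    (h₁ : IsWeakGrad f₁ g₁) (h₂ : IsWeakGrad f₂ g₂)
    (hf₁ : LocallyIntegrable f₁ volume) (hf₂ : LocallyIntegrable f₂ volume)
    (hg₁ : LocallyIntegrable g₁ volume) (hg₂ : LocallyIntegrable g₂ volume) :
    IsWeakGrad (fun x => f₁ x + f₂ x) (fun x => g₁ x + g₂ x) := by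
  intro η hη hc i
  have hη' := continuous_partial hη i
  have hc' := hasCompactSupport_partial hc i
  simp only [smul_add, PiLp.add_apply]
  rw [integral_add (integrable_test_smul hf₁ hη' hc') (integrable_test_smul hf₂ hη' hc'),
    integral_add (integrable_test_smul (locallyIntegrable_apply hg₁ i) hη.continuous hc)
      (integrable_test_smul (locallyIntegrable_apply hg₂ i) hη.continuous hc), h₁ η hη hc i,
    h₂ η hη hc i]
  ring

lemma IsWeakGrad.const_mul {f : Space d → ℂ} {g : Space d → EuclideanSpace ℂ (Fin d)}
    (h : IsWeakGrad f g) (c : ℂ) : IsWeakGrad (fun x => c * f x) (fun x => c • g x) := by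
  intro η hη hc i
  have h1 : ∀ x, fderiv ℝ η x (EuclideanSpace.single i (1 : ℝ)) • (c * f x)
      = c * (fderiv ℝ η x (EuclideanSpace.single i (1 : ℝ)) • f x) := fun x => by
    simp only [Complex.real_smul]; ring
  have h2 : ∀ x, η x • (c • g x) i = c * (η x • g x i) := fun x => by
    simp only [Complex.real_smul, PiLp.smul_apply, smul_eq_mul]; ring
  simp only [h1, h2, integral_const_mul, h η hη hc i]
  ring

lemma IsWeakGrad.congr {f f' : Space d → ℂ} {g g' : Space d → EuclideanSpace ℂ (Fin d)}
    (h : IsWeakGrad f g) (hf : f =ᵐ[volume] f') (hg : g =ᵐ[volume] g') : IsWeakGrad f' g' := by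
  intro η hη hc i
  have h1 : ∫ x, fderiv ℝ η x (EuclideanSpace.single i (1 : ℝ)) • f' x
      = ∫ x, fderiv ℝ η x (EuclideanSpace.single i (1 : ℝ)) • f x :=
    integral_congr_ae (hf.mono fun x hx => by simp only [hx])
  have h2 : ∫ x, η x • g' x i = ∫ x, η x • g x i :=
    integral_congr_ae (hg.mono fun x hx => by simp only [hx])
  rw [h1, h2, h η hη hc i]

/-- Weak gradients are unique up to null sets. -/
lemma IsWeakGrad.ae_unique {f : Space d → ℂ} {g g' : Space d → EuclideanSpace ℂ (Fin d)}
    (h : IsWeakGrad f g) (h' : IsWeakGrad f g')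
    (hg : LocallyIntegrable g volume) (hg' : LocallyIntegrable g' volume) : g =ᵐ[volume] g' := by
  have key : ∀ i : Fin d, ∀ᵐ x, g x i = g' x i := fun i =>
    ae_eq_of_integral_contDiff_smul_eq (locallyIntegrable_apply hg i)
      (locallyIntegrable_apply hg' i) fun η hη hc => by
        have := (h η hη hc i).symm.trans (h' η hη hc i)
        exact neg_injective this
  filter_upwards [ae_all_iff.2 key] with x hx
  ext i
  exact hx i

lemma HasL2Grad.weakGrad_spec {f : Space d → ℂ} (h : HasL2Grad f) :
    MemLp (weakGrad f) 2 volume ∧ IsWeakGrad f (weakGrad f) := by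
  unfold weakGrad
  rw [dif_pos h]
  exact h.choose_spec

lemma weakGrad_ae_eq {f : Space d → ℂ} {g : Space d → EuclideanSpace ℂ (Fin d)}
    (hg : MemLp g 2 volume) (h : IsWeakGrad f g) : weakGrad f =ᵐ[volume] g := by
  have hs := HasL2Grad.weakGrad_spec ⟨g, hg, h⟩
  exact hs.2.ae_unique h (locInt hs.1) (locInt hg)

lemma integral_norm_weakGrad_sq {f : Space d → ℂ} {g : Space d → EuclideanSpace ℂ (Fin d)}
    (hg : MemLp g 2 volume) (h : IsWeakGrad f g) :
    ∫ x, ‖weakGrad f x‖ ^ 2 = ∫ x, ‖g x‖ ^ 2 :=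
  integral_congr_ae ((weakGrad_ae_eq hg h).mono fun x hx => by simp only [hx])

/-- The classical gradient is a weak gradient. -/
lemma isWeakGrad_cgrad {F : Space d → ℂ} (hF : ContDiff ℝ 1 F) : IsWeakGrad F (cgrad F) := by
  intro η hη hc i
  have h1 : Integrable (fun x => fderiv ℝ η x (EuclideanSpace.single i (1 : ℝ)) • F x) volume :=
    integrable_test_smul hF.continuous.locallyIntegrable (continuous_partial hη i)
      (hasCompactSupport_partial hc i)
  have h2 : Integrable (fun x => η x • fderiv ℝ F x (EuclideanSpace.single i (1 : ℝ))) volume :=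
    integrable_test_smul ((hF.continuous_fderiv one_ne_zero).clm_apply
      continuous_const).locallyIntegrable hη.continuous hc
  have h3 : Integrable (fun x => η x • F x) volume :=
    integrable_test_smul hF.continuous.locallyIntegrable hη.continuous hc
  have := integral_smul_fderiv_eq_neg_fderiv_smul_of_integrable (𝕜 := ℝ) h1 h2 h3
    (fun x _ => (hη.differentiable (by simp)) x) (fun x _ => (hF.differentiable one_ne_zero) x)
  simp only [cgrad_apply, this, neg_neg]

/-- Product rule with a test function. -/
lemma IsWeakGrad.test_mul {f : Space d → ℂ} {g : Space d → EuclideanSpace ℂ (Fin d)}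
    (h : IsWeakGrad f g) (hf : LocallyIntegrable f volume) (hg : LocallyIntegrable g volume)
    {χ : Space d → ℝ} (hχ : ContDiff ℝ ∞ χ) :
    IsWeakGrad (fun x => χ x • f x) (fun x => χ x • g x + WithLp.toLp 2 fun i =>
      fderiv ℝ χ x (EuclideanSpace.single i (1 : ℝ)) • f x) := by
  intro η hη hc i
  have hprod : ContDiff ℝ ∞ fun x => η x * χ x := hη.mul hχ
  have hcprod : HasCompactSupport fun x => η x * χ x := hc.mul_right
  -- The weak identity for `f` is tested against the product `η * χ`, which moves the cutoff onto
  -- the test function.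
  have hmain := h _ hprod hcprod i
  have hfd : ∀ x, fderiv ℝ (fun x => η x * χ x) x (EuclideanSpace.single i (1 : ℝ))
      = η x * fderiv ℝ χ x (EuclideanSpace.single i (1 : ℝ))
        + χ x * fderiv ℝ η x (EuclideanSpace.single i (1 : ℝ)) := fun x => by
    rw [fderiv_fun_mul ((hη.differentiable (by simp)) x) ((hχ.differentiable (by simp)) x)]
    simp
  have i1 : Integrable (fun x => (η x * fderiv ℝ χ x (EuclideanSpace.single i (1 : ℝ))) • f x)
      volume :=
    integrable_test_smul hf (hη.continuous.mul (continuous_partial hχ i)) hc.mul_right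
  have i2 : Integrable (fun x => (χ x * fderiv ℝ η x (EuclideanSpace.single i (1 : ℝ))) • f x)
      volume :=
    integrable_test_smul hf (hχ.continuous.mul (continuous_partial hη i))
      (hasCompactSupport_partial hc i).mul_left
  have i3 : Integrable (fun x => (η x * χ x) • g x i) volume :=
    integrable_test_smul (locallyIntegrable_apply hg i) hprod.continuous hcprod
  simp only [hfd, add_smul] at hmain
  rw [integral_add i1 i2] at hmain
  have e1 : ∀ x, fderiv ℝ η x (EuclideanSpace.single i (1 : ℝ)) • (χ x • f x)
      = (χ x * fderiv ℝ η x (EuclideanSpace.single i (1 : ℝ))) • f x := fun x => by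
    rw [smul_smul, mul_comm]
  have e2 : ∀ x, η x • (χ x • g x + WithLp.toLp 2 fun i =>
      fderiv ℝ χ x (EuclideanSpace.single i (1 : ℝ)) • f x : EuclideanSpace ℂ (Fin d)) i
      = (η x * χ x) • g x i
        + (η x * fderiv ℝ χ x (EuclideanSpace.single i (1 : ℝ))) • f x := fun x => by
    simp only [PiLp.add_apply, PiLp.smul_apply, smul_add, smul_smul]
  simp only [e1, e2]
  rw [integral_add i3 i1]
  linear_combination hmain

/-- Weak gradients pass to limits in the sense of distributions. -/
lemma IsWeakGrad.of_tendsto {F : ℕ → Space d → ℂ} {G : ℕ → Space d → EuclideanSpace ℂ (Fin d)}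
    {f : Space d → ℂ} {g : Space d → EuclideanSpace ℂ (Fin d)}
    (h : ∀ n, IsWeakGrad (F n) (G n))
    (hF : ∀ η : Space d → ℝ, ContDiff ℝ ∞ η → HasCompactSupport η →
      Tendsto (fun n => ∫ x, η x • F n x) atTop (𝓝 (∫ x, η x • f x)))
    (hG : ∀ η : Space d → ℝ, ContDiff ℝ ∞ η → HasCompactSupport η → ∀ i,
      Tendsto (fun n => ∫ x, η x • G n x i) atTop (𝓝 (∫ x, η x • g x i))) :
    IsWeakGrad f g := by
  intro η hη hc i
  have h1 := hF _ (contDiff_partial hη i) (hasCompactSupport_partial hc i)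
  have h2 := (hG η hη hc i).neg
  refine tendsto_nhds_unique h1 (h2.congr fun n => ?_)
  rw [h n η hη hc i]

/-- `L²` convergence implies convergence of integrals against test functions. -/
lemma tendsto_integral_test_smul {E : Type*} [NormedAddCommGroup E] [NormedSpace ℝ E]
    {F : ℕ → Space d → E} {f : Space d → E}
    (hF : ∀ n, LocallyIntegrable (F n) volume) (hf : LocallyIntegrable f volume)
    (h : Tendsto (fun n => eLpNorm (F n - f) 2 volume) atTop (𝓝 0))
    {η : Space d → ℝ} (hη : Continuous η) (hc : HasCompactSupport η) :
    Tendsto (fun n => ∫ x, η x • F n x) atTop (𝓝 (∫ x, η x • f x)) := by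
  have hη2 : MemLp η 2 volume := hη.memLp_of_hasCompactSupport hc
  refine tendsto_integral_of_L1' _ (integrable_test_smul hf hη hc).1
    (.of_forall fun n => integrable_test_smul (hF n) hη hc) ?_
  have hb : ∀ n, eLpNorm ((fun x => η x • F n x) - fun x => η x • f x) 1 volume
      ≤ eLpNorm η 2 volume * eLpNorm (F n - f) 2 volume := fun n => by
    have : ((fun x => η x • F n x) - fun x => η x • f x) = η • (F n - f) := by
      ext x; simp [smul_sub]
    rw [this]
    exact eLpNorm_smul_le_mul_eLpNorm ((hF n).sub hf).aestronglyMeasurable hη2.1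
  refine tendsto_of_tendsto_of_tendsto_of_le_of_le tendsto_const_nhds ?_ (fun _ => zero_le) hb
  have := ENNReal.Tendsto.const_mul h (Or.inr hη2.eLpNorm_ne_top)
  simpa using this

end

/-! ### L² tools and mollification -/

section

variable {d : ℕ} {E : Type*} [NormedAddCommGroup E]

lemma eLpNorm_two_sq {α : Type*} [MeasurableSpace α] {μ : Measure α} (f : α → E) :
    eLpNorm f 2 μ ^ 2 = ∫⁻ x, ‖f x‖ₑ ^ 2 ∂μ := by
  have := eLpNorm_nnreal_pow_eq_lintegral (f := f) (μ := μ) (p := 2) two_ne_zero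
  simpa using this

lemma eLpNorm_two_le_iff {α : Type*} [MeasurableSpace α] {μ : Measure α} {f : α → E} {K : ℝ≥0∞} :
    eLpNorm f 2 μ ≤ K ↔ ∫⁻ x, ‖f x‖ₑ ^ 2 ∂μ ≤ K ^ 2 := by
  rw [← eLpNorm_two_sq]
  exact (ENNReal.pow_right_strictMono two_ne_zero).le_iff_le.symm

lemma tendsto_zero_of_sq {u : ℕ → ℝ≥0∞} (h : Tendsto (fun n => u n ^ 2) atTop (𝓝 0)) :
    Tendsto u atTop (𝓝 0) := by
  have h2 := h.ennrpow_const (1 / 2 : ℝ)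
  have : ∀ n, (u n ^ 2) ^ (1 / 2 : ℝ) = u n := fun n => by
    rw [← ENNReal.rpow_natCast, ← ENNReal.rpow_mul]; norm_num
  simp only [this] at h2
  simpa using h2

/-- Dominated convergence in `L²`. -/
lemma tendsto_eLpNorm_two_of_dominated {α : Type*} [MeasurableSpace α] {μ : Measure α}
    {F : ℕ → α → E} {f : α → E} {b : α → ℝ}
    (hF : ∀ n, AEStronglyMeasurable (F n) μ) (hf : AEStronglyMeasurable f μ)
    (hb : MemLp b 2 μ) (hFb : ∀ n, ∀ᵐ x ∂μ, ‖F n x‖ ≤ b x)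
    (hlim : ∀ᵐ x ∂μ, Tendsto (fun n => F n x) atTop (𝓝 (f x))) :
    Tendsto (fun n => eLpNorm (F n - f) 2 μ) atTop (𝓝 0) := by
  apply tendsto_zero_of_sq
  simp only [eLpNorm_two_sq]
  have h0 : (0 : ℝ≥0∞) = ∫⁻ _ : α, 0 ∂μ := by simp
  rw [h0]
  refine tendsto_lintegral_of_dominated_convergence' (fun x => ‖(2 : ℝ) * b x‖ₑ ^ 2)
    (fun n => (((hF n).sub hf).enorm.pow_const 2)) ?_ ?_ ?_
  · intro n
    filter_upwards [ae_all_iff.2 hFb, hlim] with x hx hl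
    have hfx : ‖f x‖ ≤ b x := le_of_tendsto hl.norm (.of_forall fun n => hx n)
    have hb0 : 0 ≤ b x := (norm_nonneg _).trans hfx
    gcongr
    rw [← ofReal_norm, ← ofReal_norm]
    apply ENNReal.ofReal_le_ofReal
    rw [Real.norm_of_nonneg (by positivity)]
    calc ‖(F n - f) x‖ ≤ ‖F n x‖ + ‖f x‖ := norm_sub_le _ _
      _ ≤ 2 * b x := by linarith [hx n]
  · have := (hb.const_mul (2 : ℝ)).eLpNorm_ne_top
    rw [← eLpNorm_two_sq (fun x => 2 * b x)]
    exact ENNReal.pow_ne_top this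
  · filter_upwards [hlim] with x hx
    have h1 : Tendsto (fun n => ‖F n x - f x‖ₑ ^ 2) atTop (𝓝 (‖f x - f x‖ₑ ^ 2)) :=
      ENNReal.Tendsto.pow (hx.sub_const (f x)).enorm
    simpa using h1

/-- Continuity of translations in `L²`. -/
lemma exists_eLpNorm_translate_sub_le {h : Space d → E} (hh : MemLp h 2 volume) {ε : ℝ≥0∞}
    (hε : 0 < ε) :
    ∃ δ > 0, ∀ t : Space d, ‖t‖ < δ → eLpNorm (fun x => h (x - t) - h x) 2 volume ≤ ε := by
  -- Continuity of the translation action on Lᵖ requires p ≠ ⊤.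
  have : Fact ((2 : ℝ≥0∞) ≠ ⊤) := ⟨by simp⟩
  let hL : Lp E 2 (volume : Measure (Space d)) := hh.toLp h
  have hcont : Continuous fun t : Space d => (DomAddAct.mk (-t) +ᵥ hL) := by
    exact (DomAddAct.continuous_mk.comp continuous_neg).fun_vadd continuous_const
  have h0 : Tendsto (fun t : Space d => edist (DomAddAct.mk (-t) +ᵥ hL) hL) (𝓝 0) (𝓝 0) := by
    have := (hcont.edist (continuous_const (y := hL))).tendsto 0
    simpa using this
  have hev := (ENNReal.tendsto_nhds_zero.1 h0) ε hε
  obtain ⟨δ, hδ, hball⟩ := Metric.eventually_nhds_iff.1 hev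
  refine ⟨δ, hδ, fun t ht => ?_⟩
  have := hball (y := t) (by simpa using ht)
  rw [DomAddAct.mk_vadd_toLp, Lp.edist_toLp_toLp] at this
  refine le_trans (le_of_eq (eLpNorm_congr_ae (.of_forall fun x => ?_))) this
  simp [neg_add_eq_sub]

variable [NormedSpace ℝ E]

/-- Cauchy-Schwarz against the constant 1, whose L² norm is 1 for a probability measure. -/
lemma lintegral_sq_le_of_prob {α : Type*} [MeasurableSpace α] {ν : Measure α}
    [IsProbabilityMeasure ν] {k : α → ℝ≥0∞} (hk : AEMeasurable k ν) :
    (∫⁻ t, k t ∂ν) ^ 2 ≤ ∫⁻ t, k t ^ 2 ∂ν := by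
  have h := ENNReal.lintegral_mul_le_Lp_mul_Lq ν Real.HolderConjugate.two_two hk
    (aemeasurable_const (b := (1 : ℝ≥0∞)))
  simp only [Pi.mul_apply, mul_one, lintegral_const, measure_univ,
    ENNReal.rpow_two, one_pow, ENNReal.one_rpow] at h
  calc (∫⁻ t, k t ∂ν) ^ 2 ≤ ((∫⁻ t, k t ^ 2 ∂ν) ^ (1 / 2 : ℝ)) ^ 2 := by gcongr
    _ = ∫⁻ t, k t ^ 2 ∂ν := by
      rw [← ENNReal.rpow_natCast, ← ENNReal.rpow_mul]; norm_num

/-- The error of mollification is controlled by the `L²` modulus of continuity. -/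
lemma eLpNorm_mollify_sub_le [CompleteSpace E] (φ : ContDiffBump (0 : Space d)) {h : Space d → E}
    (hh : MemLp h 2 volume) {K : ℝ≥0∞}
    (hK : ∀ t, ‖t‖ < φ.rOut → eLpNorm (fun x => h (x - t) - h x) 2 volume ≤ K) :
    eLpNorm (fun x => (φ.normed volume ⋆[ContinuousLinearMap.lsmul ℝ ℝ, volume] h) x - h x) 2
      volume ≤ K := by
  set ρ : Space d → ℝ := φ.normed volume with hρ
  have hρc : Continuous ρ := φ.continuous_normed
  have hρ0 : ∀ t, 0 ≤ ρ t := φ.nonneg_normed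
  have hρs : HasCompactSupport ρ := φ.hasCompactSupport_normed
  have hρm : Measurable fun t => ENNReal.ofReal (ρ t) := hρc.measurable.ennreal_ofReal
  have hρ1 : ∫⁻ t, ENNReal.ofReal (ρ t) = 1 := by
    rw [← ofReal_integral_eq_lintegral_ofReal φ.integrable_normed (.of_forall hρ0),
      φ.integral_normed, ENNReal.ofReal_one]
  -- The mollification error at a point is an average of translation differences against the
  -- probability measure `ν`. Jensen and Tonelli then reduce its L² norm to those of the individual
  -- differences.
  set ν : Measure (Space d) := volume.withDensity fun t => ENNReal.ofReal (ρ t) with hν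
  have : IsProbabilityMeasure ν := ⟨by rw [hν, withDensity_apply _ MeasurableSet.univ]; simpa⟩
  have hνac : ν ≪ volume := withDensity_absolutelyContinuous _ _
  have hmeas : AEStronglyMeasurable (fun p : Space d × Space d => h (p.1 - p.2) - h p.1)
      (volume.prod ν) := by
    refine AEStronglyMeasurable.sub ?_ hh.1.comp_fst
    refine hh.1.comp_quasiMeasurePreserving ?_
    refine ⟨measurable_sub, ?_⟩
    exact ((Measure.AbsolutelyContinuous.rfl.prod hνac).map measurable_sub).trans
      (quasiMeasurePreserving_sub_of_right_invariant volume volume).absolutelyContinuous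
  rw [eLpNorm_two_le_iff]
  have hpt : ∀ x, ‖(ρ ⋆[ContinuousLinearMap.lsmul ℝ ℝ, volume] h) x - h x‖ₑ
      ≤ ∫⁻ t, ‖h (x - t) - h x‖ₑ ∂ν := fun x => by
    have hex : ConvolutionExistsAt ρ h x (ContinuousLinearMap.lsmul ℝ ℝ) volume :=
      hρs.convolutionExists_left _ hρc (locInt hh) x
    have : (ρ ⋆[ContinuousLinearMap.lsmul ℝ ℝ, volume] h) x - h x
        = ∫ t, ρ t • (h (x - t) - h x) := by
      have e1 : h x = ∫ t, ρ t • h x := (φ.integral_normed_smul volume (h x)).symm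
      simp only [smul_sub]
      rw [integral_sub]
      · rw [← e1]; rfl
      · exact hex
      · exact φ.integrable_normed.smul_const _
    rw [this]
    refine (enorm_integral_le_lintegral_enorm _).trans (le_of_eq ?_)
    rw [hν, lintegral_withDensity_eq_lintegral_mul₀' hρm.aemeasurable]
    · refine lintegral_congr fun t => ?_
      simp only [enorm_smul, Pi.mul_apply]
      rw [Real.enorm_of_nonneg (hρ0 t)]
    · have : AEStronglyMeasurable (fun t => h (x - t)) volume :=
        hh.1.comp_quasiMeasurePreserving
          (quasiMeasurePreserving_sub_left_of_right_invariant volume x)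
      exact ((this.sub aestronglyMeasurable_const).enorm).mono_ac hνac
  calc ∫⁻ x, ‖(ρ ⋆[ContinuousLinearMap.lsmul ℝ ℝ, volume] h) x - h x‖ₑ ^ 2
      ≤ ∫⁻ x, (∫⁻ t, ‖h (x - t) - h x‖ₑ ^ 2 ∂ν) := by
        refine lintegral_mono fun x => ?_
        refine (pow_le_pow_left' (hpt x) 2).trans (lintegral_sq_le_of_prob ?_)
        have : AEStronglyMeasurable (fun t => h (x - t)) volume :=
          hh.1.comp_quasiMeasurePreserving
            (quasiMeasurePreserving_sub_left_of_right_invariant volume x)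
        exact ((this.sub aestronglyMeasurable_const).enorm).mono_ac hνac
    _ = ∫⁻ t, (∫⁻ x, ‖h (x - t) - h x‖ₑ ^ 2) ∂ν :=
        lintegral_lintegral_swap (hmeas.enorm.pow_const 2)
    _ ≤ ∫⁻ t, K ^ 2 ∂ν := by
        refine lintegral_mono_ae ?_
        rw [hν, ae_withDensity_iff hρm]
        refine .of_forall fun t ht => ?_
        have : t ∈ Function.support ρ := fun h0 => ht (by simp [h0])
        rw [hρ, φ.support_normed_eq, mem_ball_zero_iff] at this
        have := hK t this
        rwa [eLpNorm_two_le_iff] at this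
    _ = K ^ 2 := by simp

/-- The ratio of the outer to the inner radius is fixed, which almost everywhere convergence of
mollifications of locally integrable functions needs later. -/
noncomputable def mollifier (d n : ℕ) : ContDiffBump (0 : Space d) where
  rIn := 1 / (n + 1)
  rOut := 2 / (n + 1)
  rIn_pos := by positivity
  rIn_lt_rOut := by gcongr; norm_num

lemma tendsto_mollifier_rOut (d : ℕ) : Tendsto (fun n => (mollifier d n).rOut) atTop (𝓝 0) := by
  have := (tendsto_one_div_add_atTop_nhds_zero_nat (𝕜 := ℝ)).const_mul 2
  refine (this.congr fun n => ?_).trans_eq (by simp) |>.trans_eq rfl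
  change 2 * (1 / ((n : ℝ) + 1)) = 2 / (n + 1)
  ring

lemma tendsto_eLpNorm_mollify_sub [CompleteSpace E] {h : Space d → E} (hh : MemLp h 2 volume) :
    Tendsto (fun n => eLpNorm (fun x => ((mollifier d n).normed volume
      ⋆[ContinuousLinearMap.lsmul ℝ ℝ, volume] h) x - h x) 2 volume) atTop (𝓝 0) := by
  rw [ENNReal.tendsto_nhds_zero]
  intro ε hε
  obtain ⟨δ, hδ, hd⟩ := exists_eLpNorm_translate_sub_le hh hε
  filter_upwards [(tendsto_mollifier_rOut d).eventually (gt_mem_nhds hδ)] with n hn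
  exact eLpNorm_mollify_sub_le _ hh fun t ht => hd t (ht.trans hn)

/-- The gradient of a mollification is the mollified weak gradient. -/
lemma cgrad_mollify (φ : ContDiffBump (0 : Space d)) {f : Space d → ℂ}
    {g : Space d → EuclideanSpace ℂ (Fin d)} (hfg : IsWeakGrad f g)
    (hf : LocallyIntegrable f volume) (hg : LocallyIntegrable g volume) (x : Space d) :
    cgrad (φ.normed volume ⋆[ContinuousLinearMap.lsmul ℝ ℝ, volume] f) x
      = (φ.normed volume ⋆[ContinuousLinearMap.lsmul ℝ ℝ, volume] g) x := by
  set ρ : Space d → ℝ := φ.normed volume with hρ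
  have hρd : ContDiff ℝ ∞ ρ := φ.contDiff_normed
  have hρs : HasCompactSupport ρ := φ.hasCompactSupport_normed
  have hd1 : ContDiff ℝ 1 ρ := hρd.of_le (by simp)
  ext i
  have hfd := hρs.hasFDerivAt_convolution_right
    (ContinuousLinearMap.lsmul ℝ ℝ : ℝ →L[ℝ] ℂ →L[ℝ] ℂ).flip hf hd1 x
  rw [convolution_flip] at hfd
  rw [cgrad_apply, hfd.fderiv, convolution_precompR_apply _ hf (hρs.fderiv ℝ)
    (hd1.continuous_fderiv one_ne_zero), convolution_def, convolution_lsmul_swap]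
  -- The reflected kernel serves as test function; its derivative carries a minus sign that cancels
  -- the one in the definition of a weak gradient.
  let η : Space d → ℝ := fun y => ρ (x - y)
  have hη : ContDiff ℝ ∞ η := hρd.comp (contDiff_const.sub contDiff_id)
  have hηc : HasCompactSupport η :=
    hρs.comp_homeomorph (Homeomorph.subLeft x)
  have hηd : ∀ y, fderiv ℝ η y (EuclideanSpace.single i (1 : ℝ))
      = - fderiv ℝ ρ (x - y) (EuclideanSpace.single i (1 : ℝ)) := fun y => by
    have h1 : HasFDerivAt (fun y : Space d => x - y) (-ContinuousLinearMap.id ℝ (Space d)) y :=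
      (hasFDerivAt_id y).const_sub x
    have h2 := ((hd1.differentiable one_ne_zero) (x - y)).hasFDerivAt.comp y h1
    have : fderiv ℝ η y = _ := h2.fderiv
    rw [this]
    simp
  have hmain := hfg η hη hηc i
  simp only [hηd, neg_smul, integral_neg, neg_inj] at hmain
  have hint : Integrable (fun y => ρ (x - y) • g y) volume :=
    integrable_test_smul hg hη.continuous hηc
  have hproj : (∫ t, ρ (x - t) • g t) i = ∫ t, ρ (x - t) • g t i := by
    have := (EuclideanSpace.proj i : EuclideanSpace ℂ (Fin d) →L[ℂ] ℂ).integral_comp_comm hint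
    simpa using this.symm
  rw [hproj]
  simpa [ContinuousLinearMap.flip_apply] using hmain

end

/-! ### Density of test functions in H¹ -/

section

variable {d : ℕ}

lemma norm_toLp_le_sum (v : Fin d → ℂ) :
    ‖(WithLp.toLp 2 v : EuclideanSpace ℂ (Fin d))‖ ≤ ∑ i, ‖v i‖ := by
  rw [EuclideanSpace.norm_eq]
  apply Real.sqrt_le_iff.2 ⟨Finset.sum_nonneg fun i _ => norm_nonneg _, ?_⟩
  exact Finset.sum_sq_le_sq_sum_of_nonneg fun i _ => norm_nonneg (v i)

lemma aestronglyMeasurable_of_apply {g : Space d → EuclideanSpace ℂ (Fin d)}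
    (hg : ∀ i, AEStronglyMeasurable (fun x => g x i) volume) :
    AEStronglyMeasurable g volume := by
  have h1 : AEStronglyMeasurable (fun x => (fun i => g x i : Fin d → ℂ)) volume :=
    (aemeasurable_pi_lambda _ fun i => (hg i).aemeasurable).aestronglyMeasurable
  exact (PiLp.continuous_toLp 2 _).comp_aestronglyMeasurable h1

lemma memLp_of_apply {g : Space d → EuclideanSpace ℂ (Fin d)}
    (hg : ∀ i, MemLp (fun x => g x i) 2 volume) : MemLp g 2 volume := by
  have h2 : MemLp (fun x => ∑ i, ‖g x i‖) 2 volume := memLp_finsetSum _ fun i _ => (hg i).norm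
  refine h2.mono (aestronglyMeasurable_of_apply fun i => (hg i).1) (.of_forall fun x => ?_)
  rw [Real.norm_of_nonneg (Finset.sum_nonneg fun i _ => norm_nonneg _)]
  exact norm_toLp_le_sum fun i => g x i

/-- Cutoff functions exhausting `ℝ^d`. -/
noncomputable def cutoff (d n : ℕ) (x : Space d) : ℝ :=
  (⟨1, 2, one_pos, one_lt_two⟩ : ContDiffBump (0 : Space d)) ((n + 1 : ℝ)⁻¹ • x)

lemma contDiff_cutoff (n : ℕ) : ContDiff ℝ ∞ (cutoff d n) :=
  (ContDiffBump.contDiff _).comp (contDiff_const_smul _)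

lemma hasCompactSupport_cutoff (n : ℕ) : HasCompactSupport (cutoff d n) :=
  (ContDiffBump.hasCompactSupport _).comp_homeomorph
    (Homeomorph.smulOfNeZero ((n + 1 : ℝ)⁻¹) (by positivity))

lemma cutoff_nonneg (n : ℕ) (x : Space d) : 0 ≤ cutoff d n x := ContDiffBump.nonneg _

lemma cutoff_le_one (n : ℕ) (x : Space d) : cutoff d n x ≤ 1 := ContDiffBump.le_one _

lemma eventually_cutoff_eq_one (x : Space d) : ∀ᶠ n in atTop, cutoff d n x = 1 := by
  have h1 : Tendsto (fun n : ℕ => ((n : ℝ) + 1)⁻¹ • x) atTop (𝓝 0) := by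
    have := (tendsto_one_div_add_atTop_nhds_zero_nat (𝕜 := ℝ)).smul_const x
    simpa using this
  filter_upwards [h1.eventually (Metric.closedBall_mem_nhds (0 : Space d) one_pos)] with n hn
  exact ContDiffBump.one_of_mem_closedBall _ hn

/-- All cutoffs are rescalings of one bump, so stretching by n + 1 divides the gradient by n + 1.
The error term from the product rule therefore tends to zero. -/
lemma exists_norm_fderiv_cutoff_le (d : ℕ) :
    ∃ C : ℝ, 0 ≤ C ∧ ∀ n x, ‖fderiv ℝ (cutoff d n) x‖ ≤ ((n : ℝ) + 1)⁻¹ * C := by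
  set χ : ContDiffBump (0 : Space d) := ⟨1, 2, one_pos, one_lt_two⟩ with hχ
  have hcd : ContDiff ℝ 1 (χ : Space d → ℝ) := χ.contDiff
  obtain ⟨C, hC⟩ := (hcd.continuous_fderiv one_ne_zero).bounded_above_of_compact_support
    (χ.hasCompactSupport.fderiv ℝ)
  refine ⟨C, (norm_nonneg _).trans (hC 0), fun n x => ?_⟩
  have h1 : HasFDerivAt (fun y : Space d => ((n : ℝ) + 1)⁻¹ • y)
      (((n : ℝ) + 1)⁻¹ • ContinuousLinearMap.id ℝ (Space d)) x :=
    (hasFDerivAt_id x).fun_const_smul _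
  have h2 := ((hcd.differentiable one_ne_zero) (((n : ℝ) + 1)⁻¹ • x)).hasFDerivAt.comp x h1
  have h3 : fderiv ℝ (cutoff d n) x = _ := h2.fderiv
  rw [h3, ContinuousLinearMap.comp_smul, ContinuousLinearMap.comp_id, norm_smul,
    Real.norm_of_nonneg (by positivity)]
  gcongr
  exact hC _

lemma norm_gradient_smul_le (L : Space d →L[ℝ] ℝ) (z : ℂ) :
    ‖(WithLp.toLp 2 fun i => L (EuclideanSpace.single i (1 : ℝ)) • z : EuclideanSpace ℂ (Fin d))‖
      ≤ d * (‖L‖ * ‖z‖) := by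
  refine (norm_toLp_le_sum _).trans ?_
  have : ∀ i ∈ (Finset.univ : Finset (Fin d)),
      ‖L (EuclideanSpace.single i (1 : ℝ)) • z‖ ≤ ‖L‖ * ‖z‖ := fun i _ => by
    rw [norm_smul]
    gcongr
    simpa using L.le_opNorm (EuclideanSpace.single i (1 : ℝ))
  simpa using Finset.sum_le_card_nsmul _ _ _ this

lemma aestronglyMeasurable_gradient_smul {χ : Space d → ℝ} (hχ : ContDiff ℝ ∞ χ) {f : Space d → ℂ}
    (hf : AEStronglyMeasurable f volume) :
    AEStronglyMeasurable (fun x => (WithLp.toLp 2 fun i =>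
      fderiv ℝ χ x (EuclideanSpace.single i (1 : ℝ)) • f x : EuclideanSpace ℂ (Fin d))) volume :=
  aestronglyMeasurable_of_apply fun i =>
    (continuous_partial hχ i).aestronglyMeasurable.smul hf

/-- Approximation of `H¹` functions by compactly supported ones. -/
lemma exists_compactSupport_approx {f : Space d → ℂ} {g : Space d → EuclideanSpace ℂ (Fin d)}
    (hf : MemLp f 2 volume) (hg : MemLp g 2 volume) (hfg : IsWeakGrad f g) {ε : ℝ≥0∞}
    (hε : 0 < ε) :
    ∃ (h : Space d → ℂ) (k : Space d → EuclideanSpace ℂ (Fin d)), MemLp h 2 volume ∧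
      MemLp k 2 volume ∧ IsWeakGrad h k ∧ HasCompactSupport h ∧
      eLpNorm (h - f) 2 volume ≤ ε ∧ eLpNorm (k - g) 2 volume ≤ ε := by
  obtain ⟨C, hC0, hC⟩ := exists_norm_fderiv_cutoff_le d
  let h : ℕ → Space d → ℂ := fun n x => cutoff d n x • f x
  let q : ℕ → Space d → EuclideanSpace ℂ (Fin d) := fun n x =>
    WithLp.toLp 2 fun i => fderiv ℝ (cutoff d n) x (EuclideanSpace.single i (1 : ℝ)) • f x
  -- The product rule: `q n` is the part where the derivative falls on the cutoff.
  let k : ℕ → Space d → EuclideanSpace ℂ (Fin d) := fun n x => cutoff d n x • g x + q n x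
  have hhm : ∀ n, AEStronglyMeasurable (h n) volume := fun n =>
    (contDiff_cutoff n).continuous.aestronglyMeasurable.smul hf.1
  have hqm : ∀ n, AEStronglyMeasurable (q n) volume := fun n =>
    aestronglyMeasurable_gradient_smul (contDiff_cutoff n) hf.1
  have hkm : ∀ n, AEStronglyMeasurable (k n) volume := fun n =>
    ((contDiff_cutoff n).continuous.aestronglyMeasurable.smul hg.1).add (hqm n)
  have hhb : ∀ n x, ‖h n x‖ ≤ ‖f x‖ := fun n x => by
    simp only [h, norm_smul, Real.norm_of_nonneg (cutoff_nonneg n x)]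
    exact mul_le_of_le_one_left (norm_nonneg _) (cutoff_le_one n x)
  have hqb' : ∀ n x, ‖q n x‖ ≤ ((n : ℝ) + 1)⁻¹ * (d * (C * ‖f x‖)) := fun n x => by
    refine (norm_gradient_smul_le _ _).trans ?_
    calc (d : ℝ) * (‖fderiv ℝ (cutoff d n) x‖ * ‖f x‖)
        ≤ d * ((((n : ℝ) + 1)⁻¹ * C) * ‖f x‖) := by gcongr; exact hC n x
      _ = _ := by ring
  have hqb : ∀ n x, ‖q n x‖ ≤ d * (C * ‖f x‖) := fun n x => by
    refine (hqb' n x).trans (mul_le_of_le_one_left (by positivity) ?_)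
    exact inv_le_one_of_one_le₀ (by linarith [Nat.cast_nonneg (α := ℝ) n])
  have hkb : ∀ n x, ‖k n x‖ ≤ ‖g x‖ + d * (C * ‖f x‖) := fun n x => by
    refine (norm_add_le _ _).trans (add_le_add ?_ (hqb n x))
    rw [norm_smul, Real.norm_of_nonneg (cutoff_nonneg n x)]
    exact mul_le_of_le_one_left (norm_nonneg _) (cutoff_le_one n x)
  have hbk : MemLp (fun x => ‖g x‖ + d * (C * ‖f x‖)) 2 volume :=
    hg.norm.add ((hf.norm.const_mul C).const_mul (d : ℝ))
  have hhl : Tendsto (fun n => eLpNorm (h n - f) 2 volume) atTop (𝓝 0) := by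
    refine tendsto_eLpNorm_two_of_dominated hhm hf.1 hf.norm
      (fun n => .of_forall (hhb n)) (.of_forall fun x => ?_)
    refine tendsto_const_nhds.congr' ?_
    filter_upwards [eventually_cutoff_eq_one x] with n hn
    simp [h, hn]
  have hkl : Tendsto (fun n => eLpNorm (k n - g) 2 volume) atTop (𝓝 0) := by
    refine tendsto_eLpNorm_two_of_dominated hkm hg.1 hbk
      (fun n => .of_forall (hkb n)) (.of_forall fun x => ?_)
    have hq0 : Tendsto (fun n => q n x) atTop (𝓝 0) := by
      refine squeeze_zero_norm (fun n => hqb' n x) ?_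
      have := (tendsto_one_div_add_atTop_nhds_zero_nat (𝕜 := ℝ)).mul_const (d * (C * ‖f x‖))
      simpa using this
    have h1 : Tendsto (fun n => cutoff d n x • g x) atTop (𝓝 (g x)) := by
      refine tendsto_const_nhds.congr' ?_
      filter_upwards [eventually_cutoff_eq_one x] with n hn
      simp [hn]
    simpa [k] using h1.add hq0
  obtain ⟨n, hn1, hn2⟩ := ((ENNReal.tendsto_nhds_zero.1 hhl ε hε).and
    (ENNReal.tendsto_nhds_zero.1 hkl ε hε)).exists
  refine ⟨h n, k n, hf.mono (hhm n) (.of_forall (hhb n)), hbk.mono' (hkm n) (.of_forall (hkb n)),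
    hfg.test_mul (locInt hf) (locInt hg) (contDiff_cutoff n),
    (hasCompactSupport_cutoff n).smul_right, hn1, hn2⟩

/-- Approximation of `H¹` functions by test functions, with error bound. -/
lemma exists_smooth_approx {f : Space d → ℂ} {g : Space d → EuclideanSpace ℂ (Fin d)}
    (hf : MemLp f 2 volume) (hg : MemLp g 2 volume) (hfg : IsWeakGrad f g) {ε : ℝ≥0∞}
    (hε : 0 < ε) :
    ∃ F : Space d → ℂ, ContDiff ℝ ∞ F ∧ HasCompactSupport F ∧
      eLpNorm (F - f) 2 volume ≤ ε ∧ eLpNorm (cgrad F - g) 2 volume ≤ ε := by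
  have hε2 : 0 < ε / 2 := ENNReal.half_pos hε.ne'
  obtain ⟨h, k, hh, hk, hhk, hc, h1, h2⟩ := exists_compactSupport_approx hf hg hfg hε2
  obtain ⟨n, hn1, hn2⟩ := ((ENNReal.tendsto_nhds_zero.1 (tendsto_eLpNorm_mollify_sub hh) _ hε2).and
    (ENNReal.tendsto_nhds_zero.1 (tendsto_eLpNorm_mollify_sub hk) _ hε2)).exists
  set φ := mollifier d n
  set F : Space d → ℂ := φ.normed volume ⋆[ContinuousLinearMap.lsmul ℝ ℝ, volume] h with hF
  have hFs : ContDiff ℝ ∞ F := φ.hasCompactSupport_normed.contDiff_convolution_left _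
    φ.contDiff_normed (locInt hh)
  have hFc : HasCompactSupport F := φ.hasCompactSupport_normed.convolution _ hc
  have hFg : cgrad F = φ.normed volume ⋆[ContinuousLinearMap.lsmul ℝ ℝ, volume] k := by
    ext1 x
    exact cgrad_mollify φ hhk (locInt hh) (locInt hk) x
  refine ⟨F, hFs, hFc, ?_, ?_⟩
  · have : F - f = (fun x => F x - h x) + (h - f) := by ext x; simp
    rw [this, ← ENNReal.add_halves ε]
    refine (eLpNorm_add_le ?_ (hh.1.sub hf.1) (by norm_num)).trans (add_le_add hn1 h1)
    exact hFs.continuous.aestronglyMeasurable.sub hh.1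
  · have : cgrad F - g = (fun x => cgrad F x - k x) + (k - g) := by ext1 x; simp
    rw [this, ← ENNReal.add_halves ε]
    refine (eLpNorm_add_le ?_ (hk.1.sub hg.1) (by norm_num)).trans (add_le_add ?_ h2)
    · exact (continuous_cgrad (hFs.of_le (by simp))).aestronglyMeasurable.sub hk.1
    · rw [hFg]; exact hn2

/-- `F` is a sequence of test functions converging to `f` in `H¹` and almost everywhere. -/
structure Approximates (F : ℕ → Space d → ℂ) (f : Space d → ℂ)
    (g : Space d → EuclideanSpace ℂ (Fin d)) : Prop where
  contDiff : ∀ n, ContDiff ℝ ∞ (F n)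
  hasCompactSupport : ∀ n, HasCompactSupport (F n)
  tendsto_L2 : Tendsto (fun n => eLpNorm (F n - f) 2 volume) atTop (𝓝 0)
  tendsto_grad : Tendsto (fun n => eLpNorm (cgrad (F n) - g) 2 volume) atTop (𝓝 0)
  tendsto_ae : ∀ᵐ x, Tendsto (fun n => F n x) atTop (𝓝 (f x))

lemma Approximates.memLp {F : ℕ → Space d → ℂ} {f : Space d → ℂ}
    {g : Space d → EuclideanSpace ℂ (Fin d)} (h : Approximates F f g) (n : ℕ) (p : ℝ≥0∞) :
    MemLp (F n) p volume :=
  (h.contDiff n).continuous.memLp_of_hasCompactSupport (h.hasCompactSupport n)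

lemma Approximates.memLp_cgrad {F : ℕ → Space d → ℂ} {f : Space d → ℂ}
    {g : Space d → EuclideanSpace ℂ (Fin d)} (h : Approximates F f g) (n : ℕ) (p : ℝ≥0∞) :
    MemLp (cgrad (F n)) p volume :=
  (continuous_cgrad ((h.contDiff n).of_le (by simp))).memLp_of_hasCompactSupport
    (hasCompactSupport_cgrad (h.hasCompactSupport n))

/-- Density of test functions in `H¹`. -/
lemma exists_approximates {f : Space d → ℂ} {g : Space d → EuclideanSpace ℂ (Fin d)}
    (hf : MemLp f 2 volume) (hg : MemLp g 2 volume) (hfg : IsWeakGrad f g) :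
    ∃ F, Approximates F f g := by
  have hpos : ∀ n : ℕ, (0 : ℝ≥0∞) < ((n : ℝ≥0∞) + 1)⁻¹ := fun n => by
    simp [ENNReal.inv_pos, ENNReal.add_eq_top]
  choose F hFs hFc hF1 hF2 using fun n : ℕ => exists_smooth_approx hf hg hfg (hpos n)
  have hlim : Tendsto (fun n : ℕ => ((n : ℝ≥0∞) + 1)⁻¹) atTop (𝓝 0) := by
    have := (tendsto_add_atTop_iff_nat 1).2 ENNReal.tendsto_inv_nat_nhds_zero
    simpa using this
  have hl1 : Tendsto (fun n => eLpNorm (F n - f) 2 volume) atTop (𝓝 0) :=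
    tendsto_of_tendsto_of_tendsto_of_le_of_le tendsto_const_nhds hlim (fun _ => zero_le) hF1
  have hl2 : Tendsto (fun n => eLpNorm (cgrad (F n) - g) 2 volume) atTop (𝓝 0) :=
    tendsto_of_tendsto_of_tendsto_of_le_of_le tendsto_const_nhds hlim (fun _ => zero_le) hF2
  obtain ⟨ns, hns, hae⟩ := (tendstoInMeasure_of_tendsto_eLpNorm two_ne_zero
    (fun n => (hFs n).continuous.aestronglyMeasurable) hf.1 hl1).exists_seq_tendsto_ae
  exact ⟨fun n => F (ns n), fun n => hFs _, fun n => hFc _, hl1.comp hns.tendsto_atTop,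
    hl2.comp hns.tendsto_atTop, hae⟩

end

/-! ### Chain rule and the modulus of a pair -/

section

variable {d : ℕ}

/-- The gradient given by the chain rule for `x ↦ G (f₁ x, f₂ x)`. -/
noncomputable def chainGrad (G : ℂ × ℂ → ℂ) (f₁ f₂ : Space d → ℂ)
    (g₁ g₂ : Space d → EuclideanSpace ℂ (Fin d)) (x : Space d) : EuclideanSpace ℂ (Fin d) :=
  WithLp.toLp 2 fun i => fderiv ℝ G (f₁ x, f₂ x) (g₁ x i, g₂ x i)

lemma lipschitz_of_fderiv_bound {G : ℂ × ℂ → ℂ} (hG : ContDiff ℝ 1 G) {K : ℝ}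
    (hK : ∀ p, ‖fderiv ℝ G p‖ ≤ K) (p q : ℂ × ℂ) : ‖G p - G q‖ ≤ K * ‖p - q‖ :=
  Convex.norm_image_sub_le_of_norm_fderiv_le (𝕜 := ℝ)
    (fun x _ => (hG.differentiable one_ne_zero) x) (fun x _ => hK x) convex_univ
    (Set.mem_univ q) (Set.mem_univ p)

lemma norm_pair_le (z w : ℂ) : ‖(z, w)‖ ≤ ‖z‖ + ‖w‖ := by
  rw [Prod.norm_mk]
  exact max_le (by linarith [norm_nonneg w]) (by linarith [norm_nonneg z])

/-- Only local integrability is claimed, since G need not vanish at the origin and the composition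
need not be in L². -/
lemma locallyIntegrable_comp {G : ℂ × ℂ → ℂ} (hG : ContDiff ℝ 1 G) {K : ℝ}
    (hK : ∀ p, ‖fderiv ℝ G p‖ ≤ K) {f₁ f₂ : Space d → ℂ} (hf₁ : MemLp f₁ 2 volume)
    (hf₂ : MemLp f₂ 2 volume) : LocallyIntegrable (fun x => G (f₁ x, f₂ x)) volume := by
  have hK0 : 0 ≤ K := (norm_nonneg _).trans (hK 0)
  have h1 : LocallyIntegrable (fun x => ‖G 0‖ + K * (‖f₁ x‖ + ‖f₂ x‖)) volume :=
    (locallyIntegrable_const _).add (locInt ((hf₁.norm.add hf₂.norm).const_mul K))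
  refine h1.mono (hG.continuous.comp_aestronglyMeasurable (hf₁.1.prodMk hf₂.1))
    (.of_forall fun x => ?_)
  rw [Real.norm_of_nonneg (by positivity)]
  have := lipschitz_of_fderiv_bound hG hK (f₁ x, f₂ x) 0
  rw [sub_zero] at this
  calc ‖G (f₁ x, f₂ x)‖ ≤ ‖G 0‖ + ‖G (f₁ x, f₂ x) - G 0‖ := norm_le_norm_add_norm_sub' _ _
    _ ≤ _ := by gcongr; exact this.trans (by gcongr; exact norm_pair_le _ _)

lemma continuous_fderiv_uncurry {G : ℂ × ℂ → ℂ} (hG : ContDiff ℝ 1 G) :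
    Continuous fun p : (ℂ × ℂ) × ℂ × ℂ => fderiv ℝ G p.1 p.2 :=
  ((hG.continuous_fderiv one_ne_zero).comp continuous_fst).clm_apply continuous_snd

lemma aestronglyMeasurable_fderiv_comp {G : ℂ × ℂ → ℂ} (hG : ContDiff ℝ 1 G)
    {f₁ f₂ k₁ k₂ : Space d → ℂ} (hf₁ : AEStronglyMeasurable f₁ volume)
    (hf₂ : AEStronglyMeasurable f₂ volume) (hk₁ : AEStronglyMeasurable k₁ volume)
    (hk₂ : AEStronglyMeasurable k₂ volume) :
    AEStronglyMeasurable (fun x => fderiv ℝ G (f₁ x, f₂ x) (k₁ x, k₂ x)) volume :=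
  (continuous_fderiv_uncurry hG).comp_aestronglyMeasurable ((hf₁.prodMk hf₂).prodMk
    (hk₁.prodMk hk₂))

lemma norm_fderiv_pair_le {G : ℂ × ℂ → ℂ} {K : ℝ} (hK : ∀ p, ‖fderiv ℝ G p‖ ≤ K) (p : ℂ × ℂ)
    (z w : ℂ) : ‖fderiv ℝ G p (z, w)‖ ≤ K * (‖z‖ + ‖w‖) := by
  have hK0 : 0 ≤ K := (norm_nonneg _).trans (hK 0)
  refine ((fderiv ℝ G p).le_opNorm _).trans ?_
  gcongr
  · exact hK p
  · exact norm_pair_le z w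

lemma memLp_chainGrad {G : ℂ × ℂ → ℂ} (hG : ContDiff ℝ 1 G) {K : ℝ}
    (hK : ∀ p, ‖fderiv ℝ G p‖ ≤ K) {f₁ f₂ : Space d → ℂ}
    {g₁ g₂ : Space d → EuclideanSpace ℂ (Fin d)}
    (hf₁ : MemLp f₁ 2 volume) (hg₁ : MemLp g₁ 2 volume)
    (hf₂ : MemLp f₂ 2 volume) (hg₂ : MemLp g₂ 2 volume) :
    MemLp (chainGrad G f₁ f₂ g₁ g₂) 2 volume :=
  memLp_of_apply fun i =>
    (((memLp_apply hg₁ i).norm.add (memLp_apply hg₂ i).norm).const_mul K).mono'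
      (aestronglyMeasurable_fderiv_comp hG hf₁.1 hf₂.1 (memLp_apply hg₁ i).1 (memLp_apply hg₂ i).1)
      (.of_forall fun _ => norm_fderiv_pair_le hK _ _ _)

/-- Chain rule for `C¹` functions of two `H¹` functions. -/
lemma isWeakGrad_chain {G : ℂ × ℂ → ℂ} (hG : ContDiff ℝ 1 G) {K : ℝ}
    (hK : ∀ p, ‖fderiv ℝ G p‖ ≤ K) {f₁ f₂ : Space d → ℂ}
    {g₁ g₂ : Space d → EuclideanSpace ℂ (Fin d)}
    (hf₁ : MemLp f₁ 2 volume) (hg₁ : MemLp g₁ 2 volume) (h₁ : IsWeakGrad f₁ g₁)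
    (hf₂ : MemLp f₂ 2 volume) (hg₂ : MemLp g₂ 2 volume) (h₂ : IsWeakGrad f₂ g₂) :
    IsWeakGrad (fun x => G (f₁ x, f₂ x)) (chainGrad G f₁ f₂ g₁ g₂) := by
  have hK0 : 0 ≤ K := (norm_nonneg _).trans (hK 0)
  obtain ⟨F₁, hF₁⟩ := exists_approximates hf₁ hg₁ h₁
  obtain ⟨F₂, hF₂⟩ := exists_approximates hf₂ hg₂ h₂
  have hd : ∀ n, ContDiff ℝ 1 fun x => (F₁ n x, F₂ n x) := fun n =>
    ((hF₁.contDiff n).of_le (by simp)).prodMk ((hF₂.contDiff n).of_le (by simp))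
  have hcg : ∀ n, cgrad (fun x => G (F₁ n x, F₂ n x))
      = chainGrad G (F₁ n) (F₂ n) (cgrad (F₁ n)) (cgrad (F₂ n)) := fun n => by
    ext x i
    have e1 : HasFDerivAt (F₁ n) (fderiv ℝ (F₁ n) x) x :=
      (((hF₁.contDiff n).differentiable (by simp)) x).hasFDerivAt
    have e2 : HasFDerivAt (F₂ n) (fderiv ℝ (F₂ n) x) x :=
      (((hF₂.contDiff n).differentiable (by simp)) x).hasFDerivAt
    have e3 := ((hG.differentiable one_ne_zero) (F₁ n x, F₂ n x)).hasFDerivAt.comp x (e1.prodMk e2)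
    have e4 : fderiv ℝ (fun x => G (F₁ n x, F₂ n x)) x = _ := e3.fderiv
    rw [cgrad_apply, e4]
    rfl
  refine IsWeakGrad.of_tendsto (fun n => isWeakGrad_cgrad (hG.comp (hd n))) ?_ ?_
  · intro η hη hc
    refine tendsto_integral_test_smul
      (fun n => locallyIntegrable_comp hG hK (hF₁.memLp n 2) (hF₂.memLp n 2))
      (locallyIntegrable_comp hG hK hf₁ hf₂) ?_ hη.continuous hc
    have hb : ∀ n, eLpNorm ((fun x => G (F₁ n x, F₂ n x)) - fun x => G (f₁ x, f₂ x)) 2 volume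
        ≤ ENNReal.ofReal K * (eLpNorm (F₁ n - f₁) 2 volume + eLpNorm (F₂ n - f₂) 2 volume) := by
      intro n
      have m1 := ((hF₁.memLp n 2).sub hf₁)
      have m2 := ((hF₂.memLp n 2).sub hf₂)
      calc _ ≤ eLpNorm (fun x => K * (‖(F₁ n - f₁) x‖ + ‖(F₂ n - f₂) x‖)) 2 volume := by
            refine eLpNorm_mono_real fun x => ?_
            refine (lipschitz_of_fderiv_bound hG hK _ _).trans ?_
            gcongr
            exact norm_pair_le _ _
        _ = ‖K‖ₑ * eLpNorm (fun x => ‖(F₁ n - f₁) x‖ + ‖(F₂ n - f₂) x‖) 2 volume :=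
            eLpNorm_const_smul K _ 2 volume
        _ ≤ _ := by
            rw [Real.enorm_of_nonneg hK0]
            gcongr
            refine (eLpNorm_add_le m1.1.norm m2.1.norm (by norm_num)).trans ?_
            rw [eLpNorm_norm, eLpNorm_norm]
    refine tendsto_of_tendsto_of_tendsto_of_le_of_le tendsto_const_nhds ?_ (fun _ => zero_le) hb
    have := ENNReal.Tendsto.const_mul (a := ENNReal.ofReal K) (hF₁.tendsto_L2.add hF₂.tendsto_L2)
      (Or.inr ENNReal.ofReal_ne_top)
    simpa using this
  · intro η hη hc i
    have mg₁ := memLp_apply hg₁ i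
    have mg₂ := memLp_apply hg₂ i
    simp only [Function.comp_def, hcg]
    refine tendsto_integral_test_smul
      (fun n => locallyIntegrable_apply (locInt (memLp_chainGrad hG hK (hF₁.memLp n 2)
        (hF₁.memLp_cgrad n 2) (hF₂.memLp n 2) (hF₂.memLp_cgrad n 2))) i)
      (locallyIntegrable_apply (locInt (memLp_chainGrad hG hK hf₁ hg₁ hf₂ hg₂)) i) ?_
      hη.continuous hc
    -- The difference of chain-rule gradients is split at `A n`, the derivative at the approximants
    -- applied to the limit gradients. One half is controlled by L² convergence of the gradients,
    -- the other by dominated convergence.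
    let A : ℕ → Space d → ℂ := fun n x => fderiv ℝ G (F₁ n x, F₂ n x) (g₁ x i, g₂ x i)
    let A' : Space d → ℂ := fun x => fderiv ℝ G (f₁ x, f₂ x) (g₁ x i, g₂ x i)
    have hAm : ∀ n, AEStronglyMeasurable (A n) volume := fun n =>
      aestronglyMeasurable_fderiv_comp hG (hF₁.memLp n 2).1 (hF₂.memLp n 2).1 mg₁.1 mg₂.1
    have hA'm : AEStronglyMeasurable A' volume :=
      aestronglyMeasurable_fderiv_comp hG hf₁.1 hf₂.1 mg₁.1 mg₂.1
    have hAl : Tendsto (fun n => eLpNorm (A n - A') 2 volume) atTop (𝓝 0) := by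
      refine tendsto_eLpNorm_two_of_dominated hAm hA'm ((mg₁.norm.add mg₂.norm).const_mul K)
        (fun n => .of_forall fun x => norm_fderiv_pair_le hK _ _ _) ?_
      filter_upwards [hF₁.tendsto_ae, hF₂.tendsto_ae] with x hx1 hx2
      exact ((continuous_fderiv_uncurry hG).tendsto ((f₁ x, f₂ x), (g₁ x i, g₂ x i))).comp
        ((hx1.prodMk_nhds hx2).prodMk_nhds tendsto_const_nhds)
    have hb : ∀ n, eLpNorm ((fun x => chainGrad G (F₁ n) (F₂ n) (cgrad (F₁ n)) (cgrad (F₂ n)) x i)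
          - fun x => chainGrad G f₁ f₂ g₁ g₂ x i) 2 volume
        ≤ ENNReal.ofReal K * (eLpNorm (cgrad (F₁ n) - g₁) 2 volume
          + eLpNorm (cgrad (F₂ n) - g₂) 2 volume) + eLpNorm (A n - A') 2 volume := by
      intro n
      have m1 := ((hF₁.memLp_cgrad n 2).sub hg₁)
      have m2 := ((hF₂.memLp_cgrad n 2).sub hg₂)
      have heq : ((fun x => chainGrad G (F₁ n) (F₂ n) (cgrad (F₁ n)) (cgrad (F₂ n)) x i)
          - fun x => chainGrad G f₁ f₂ g₁ g₂ x i)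
          = (fun x => fderiv ℝ G (F₁ n x, F₂ n x)
              (cgrad (F₁ n) x i - g₁ x i, cgrad (F₂ n) x i - g₂ x i)) + (A n - A') := by
        ext x
        have : (cgrad (F₁ n) x i - g₁ x i, cgrad (F₂ n) x i - g₂ x i)
          = (cgrad (F₁ n) x i, cgrad (F₂ n) x i) - (g₁ x i, g₂ x i) := rfl
        simp only [Pi.add_apply, Pi.sub_apply, this, map_sub, A, A', chainGrad]
        ring
      rw [heq]
      refine (eLpNorm_add_le ?_ ((hAm n).sub hA'm) (by norm_num)).trans ?_
      · exact aestronglyMeasurable_fderiv_comp hG (hF₁.memLp n 2).1 (hF₂.memLp n 2).1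
          (memLp_apply m1 i).1 (memLp_apply m2 i).1
      gcongr
      calc _ ≤ eLpNorm (fun x => K * (‖(cgrad (F₁ n) - g₁) x‖ + ‖(cgrad (F₂ n) - g₂) x‖)) 2
              volume := by
            refine eLpNorm_mono_real fun x => ?_
            refine (norm_fderiv_pair_le hK _ _ _).trans ?_
            gcongr
            · exact PiLp.norm_apply_le ((cgrad (F₁ n) - g₁) x) i
            · exact PiLp.norm_apply_le ((cgrad (F₂ n) - g₂) x) i
        _ = ‖K‖ₑ * eLpNorm (fun x => ‖(cgrad (F₁ n) - g₁) x‖ + ‖(cgrad (F₂ n) - g₂) x‖) 2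
              volume := eLpNorm_const_smul K _ 2 volume
        _ ≤ _ := by
            rw [Real.enorm_of_nonneg hK0]
            gcongr
            refine (eLpNorm_add_le m1.1.norm m2.1.norm (by norm_num)).trans ?_
            rw [eLpNorm_norm, eLpNorm_norm]
    refine tendsto_of_tendsto_of_tendsto_of_le_of_le tendsto_const_nhds ?_ (fun _ => zero_le) hb
    have := (ENNReal.Tendsto.const_mul (a := ENNReal.ofReal K)
      (hF₁.tendsto_grad.add hF₂.tendsto_grad) (Or.inr ENNReal.ofReal_ne_top)).add hAl
    simpa using this

/-- Regularized modulus of a pair. -/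
noncomputable def regAbs (ε : ℝ) (p : ℂ × ℂ) : ℝ := √(‖p.1‖ ^ 2 + ‖p.2‖ ^ 2 + ε ^ 2)

lemma regAbs_pos {ε : ℝ} (hε : 0 < ε) (p : ℂ × ℂ) : 0 < regAbs ε p :=
  Real.sqrt_pos.2 (by positivity)

lemma regAbs_sq (ε : ℝ) (p : ℂ × ℂ) : regAbs ε p ^ 2 = ‖p.1‖ ^ 2 + ‖p.2‖ ^ 2 + ε ^ 2 :=
  Real.sq_sqrt (by positivity)

/-- The derivative of the squared norm of a pair, divided by two. -/
noncomputable def innerPair (p : ℂ × ℂ) : ℂ × ℂ →L[ℝ] ℝ :=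
  (innerSL ℝ p.1).comp (ContinuousLinearMap.fst ℝ ℂ ℂ)
    + (innerSL ℝ p.2).comp (ContinuousLinearMap.snd ℝ ℂ ℂ)

lemma innerPair_apply (p q : ℂ × ℂ) :
    innerPair p q = inner ℝ p.1 q.1 + inner ℝ p.2 q.2 := by
  simp [innerPair]

lemma abs_innerPair_le (p q : ℂ × ℂ) :
    |innerPair p q| ≤ √(‖p.1‖ ^ 2 + ‖p.2‖ ^ 2) * √(‖q.1‖ ^ 2 + ‖q.2‖ ^ 2) := by
  rw [innerPair_apply, ← Real.sqrt_mul (by positivity)]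
  apply Real.le_sqrt_of_sq_le
  rw [sq_abs]
  have h1 := abs_real_inner_le_norm p.1 q.1
  have h2 := abs_real_inner_le_norm p.2 q.2
  have h3 : |inner ℝ p.1 q.1 + inner ℝ p.2 q.2| ≤ ‖p.1‖ * ‖q.1‖ + ‖p.2‖ * ‖q.2‖ :=
    (abs_add_le _ _).trans (add_le_add h1 h2)
  calc (inner ℝ p.1 q.1 + inner ℝ p.2 q.2) ^ 2 ≤ (‖p.1‖ * ‖q.1‖ + ‖p.2‖ * ‖q.2‖) ^ 2 :=
        sq_le_sq' (by linarith [(abs_le.1 h3).1]) (abs_le.1 h3).2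
    _ ≤ _ := by nlinarith [sq_nonneg (‖p.1‖ * ‖q.2‖ - ‖p.2‖ * ‖q.1‖)]

lemma sqrt_sq_add_sq_le (a b : ℝ) (ha : 0 ≤ a) (hb : 0 ≤ b) : √(a ^ 2 + b ^ 2) ≤ a + b :=
  Real.sqrt_le_iff.2 ⟨by positivity, by nlinarith [mul_nonneg ha hb]⟩

lemma hasFDerivAt_regAbs {ε : ℝ} (hε : 0 < ε) (p : ℂ × ℂ) :
    HasFDerivAt (regAbs ε) ((regAbs ε p)⁻¹ • innerPair p) p := by
  have h1 : HasFDerivAt (fun p : ℂ × ℂ => ‖p.1‖ ^ 2 + ‖p.2‖ ^ 2 + ε ^ 2)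
      ((2 : ℝ) • innerPair p) p := by
    have a1 := (hasFDerivAt_fst (𝕜 := ℝ) (p := p)).norm_sq
    have a2 := (hasFDerivAt_snd (𝕜 := ℝ) (p := p)).norm_sq
    refine ((a1.add a2).add_const (ε ^ 2)).congr_fderiv ?_
    ext q <;> simp [innerPair, two_smul]
  have h2 := h1.sqrt (by positivity)
  refine h2.congr_fderiv ?_
  ext q <;> simp [regAbs] <;> ring

lemma contDiff_regAbs {ε : ℝ} (hε : 0 < ε) : ContDiff ℝ ∞ (regAbs ε) := by
  refine ContDiff.sqrt ?_ fun p => by positivity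
  exact ((contDiff_fst.norm_sq ℝ).add (contDiff_snd.norm_sq ℝ)).add contDiff_const

/-- The bound does not depend on ε, so it serves as the dominating function when the regularization
is removed. -/
lemma abs_innerPair_div_regAbs_le {ε : ℝ} (hε : 0 < ε) (p : ℂ × ℂ) (z w : ℂ) :
    |innerPair p (z, w) / regAbs ε p| ≤ ‖z‖ + ‖w‖ := by
  rw [abs_div, abs_of_pos (regAbs_pos hε p), div_le_iff₀ (regAbs_pos hε p)]
  refine (abs_innerPair_le p (z, w)).trans ?_
  rw [mul_comm]
  gcongr
  · exact sqrt_sq_add_sq_le _ _ (norm_nonneg _) (norm_nonneg _)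
  · rw [regAbs]
    exact Real.sqrt_le_sqrt (by nlinarith [sq_nonneg ε])

/-- The modulus of a pair of functions. -/
noncomputable def pairAbs (u v : Space d → ℂ) (x : Space d) : ℂ :=
  ((√(‖u x‖ ^ 2 + ‖v x‖ ^ 2) : ℝ) : ℂ)

/-- The gradient of the modulus of a pair of functions. -/
noncomputable def pairAbsGrad (u v : Space d → ℂ) (g₁ g₂ : Space d → EuclideanSpace ℂ (Fin d))
    (x : Space d) : EuclideanSpace ℂ (Fin d) :=
  WithLp.toLp 2 fun i =>
    ((innerPair (u x, v x) (g₁ x i, g₂ x i) / √(‖u x‖ ^ 2 + ‖v x‖ ^ 2) : ℝ) : ℂ)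

/-- Because test functions have compact support, a locally integrable dominating function is enough.
-/
lemma tendsto_integral_test_of_dominated {E : Type*} [NormedAddCommGroup E] [NormedSpace ℝ E]
    {F : ℕ → Space d → E} {f : Space d → E} {b : Space d → ℝ}
    (hF : ∀ n, AEStronglyMeasurable (F n) volume) (hb : LocallyIntegrable b volume)
    (hFb : ∀ n, ∀ᵐ x, ‖F n x‖ ≤ b x) (hlim : ∀ᵐ x, Tendsto (fun n => F n x) atTop (𝓝 (f x)))
    {η : Space d → ℝ} (hη : Continuous η) (hc : HasCompactSupport η) :
    Tendsto (fun n => ∫ x, η x • F n x) atTop (𝓝 (∫ x, η x • f x)) := by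
  refine tendsto_integral_of_dominated_convergence (fun x => |η x| • b x)
    (fun n => hη.aestronglyMeasurable.smul (hF n))
    (integrable_test_smul hb hη.abs hc.norm) (fun n => ?_) ?_
  · filter_upwards [hFb n] with x hx
    rw [norm_smul, Real.norm_eq_abs, smul_eq_mul]
    gcongr
  · filter_upwards [hlim] with x hx
    exact hx.const_smul _

lemma hasFDerivAt_ofReal_comp {N : ℂ × ℂ → ℝ} {L : ℂ × ℂ →L[ℝ] ℝ} {p : ℂ × ℂ}
    (h : HasFDerivAt N L p) :
    HasFDerivAt (fun p => ((N p : ℝ) : ℂ)) (Complex.ofRealCLM.comp L) p :=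
  Complex.ofRealCLM.hasFDerivAt.comp p h

/-- Pairs carry the sup norm, which accounts for the factor 2. -/
lemma norm_fderiv_le_of_pair {G : ℂ × ℂ → ℂ} {K : ℝ} (hK : 0 ≤ K) {p : ℂ × ℂ}
    (h : ∀ z w, ‖fderiv ℝ G p (z, w)‖ ≤ K * (‖z‖ + ‖w‖)) : ‖fderiv ℝ G p‖ ≤ K * 2 := by
  refine ContinuousLinearMap.opNorm_le_bound _ (by positivity) fun q => ?_
  refine (h q.1 q.2).trans ?_
  rw [mul_assoc]
  gcongr
  linarith [norm_fst_le q, norm_snd_le q]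

lemma tendsto_regAbs (p : ℂ × ℂ) :
    Tendsto (fun n : ℕ => regAbs (1 / ((n : ℝ) + 1)) p) atTop (𝓝 (√(‖p.1‖ ^ 2 + ‖p.2‖ ^ 2))) := by
  have h := ((tendsto_one_div_add_atTop_nhds_zero_nat (𝕜 := ℝ)).pow 2).const_add
    (‖p.1‖ ^ 2 + ‖p.2‖ ^ 2)
  have h2 := (Real.continuous_sqrt.tendsto _).comp h
  simpa [regAbs, Function.comp_def] using h2

lemma regAbs_le {ε : ℝ} (hε : 0 ≤ ε) (p : ℂ × ℂ) : regAbs ε p ≤ ‖p.1‖ + ‖p.2‖ + ε := by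
  refine Real.sqrt_le_iff.2 ⟨by positivity, ?_⟩
  nlinarith [norm_nonneg p.1, norm_nonneg p.2, mul_nonneg (norm_nonneg p.1) (norm_nonneg p.2),
    mul_nonneg (norm_nonneg p.1) hε, mul_nonneg (norm_nonneg p.2) hε]

lemma innerPair_eq_zero_of_sqrt {p : ℂ × ℂ} (h : √(‖p.1‖ ^ 2 + ‖p.2‖ ^ 2) = 0) :
    innerPair p = 0 := by
  rw [Real.sqrt_eq_zero (by positivity)] at h
  have h1 : p.1 = 0 := by
    rw [← norm_eq_zero]; nlinarith [sq_nonneg ‖p.1‖, sq_nonneg ‖p.2‖]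
  have h2 : p.2 = 0 := by
    rw [← norm_eq_zero]; nlinarith [sq_nonneg ‖p.1‖, sq_nonneg ‖p.2‖]
  ext <;> simp [innerPair, h1, h2]

/-- At the origin the numerator vanishes identically and the limit is 0 by the convention for
division by zero. Hence the gradient of the modulus is 0 wherever the modulus is. -/
lemma tendsto_innerPair_div_regAbs (p q : ℂ × ℂ) :
    Tendsto (fun n : ℕ => innerPair p q / regAbs (1 / ((n : ℝ) + 1)) p) atTop
      (𝓝 (innerPair p q / √(‖p.1‖ ^ 2 + ‖p.2‖ ^ 2))) := by
  by_cases h0 : √(‖p.1‖ ^ 2 + ‖p.2‖ ^ 2) = 0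
  · simp [innerPair_eq_zero_of_sqrt h0]
  · exact tendsto_const_nhds.div (tendsto_regAbs p) h0

lemma contDiff_ofReal_regAbs {ε : ℝ} (hε : 0 < ε) :
    ContDiff ℝ 1 fun p => ((regAbs ε p : ℝ) : ℂ) :=
  Complex.ofRealCLM.contDiff.comp ((contDiff_regAbs hε).of_le (by simp))

lemma fderiv_ofReal_regAbs {ε : ℝ} (hε : 0 < ε) (p q : ℂ × ℂ) :
    fderiv ℝ (fun p => ((regAbs ε p : ℝ) : ℂ)) p q = ((innerPair p q / regAbs ε p : ℝ) : ℂ) := by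
  rw [(hasFDerivAt_ofReal_comp (hasFDerivAt_regAbs hε p)).fderiv]
  simp only [ContinuousLinearMap.comp_apply, smul_apply, smul_eq_mul,
    Complex.ofRealCLM_apply, div_eq_inv_mul]

/-- The modulus of a pair of `H¹` functions is weakly differentiable. -/
lemma isWeakGrad_pairAbs {u v : Space d → ℂ} {g₁ g₂ : Space d → EuclideanSpace ℂ (Fin d)}
    (hu : MemLp u 2 volume) (hg₁ : MemLp g₁ 2 volume) (h₁ : IsWeakGrad u g₁)
    (hv : MemLp v 2 volume) (hg₂ : MemLp g₂ 2 volume) (h₂ : IsWeakGrad v g₂) :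
    IsWeakGrad (pairAbs u v) (pairAbsGrad u v g₁ g₂) := by
  have hε : ∀ n : ℕ, (0 : ℝ) < 1 / ((n : ℝ) + 1) := fun n => by positivity
  have hK : ∀ n : ℕ, ∀ p : ℂ × ℂ,
      ‖fderiv ℝ (fun p => ((regAbs (1 / ((n : ℝ) + 1)) p : ℝ) : ℂ)) p‖ ≤ 1 * 2 := fun n p => by
    refine norm_fderiv_le_of_pair zero_le_one fun z w => ?_
    rw [fderiv_ofReal_regAbs (hε n), Complex.norm_real, one_mul]
    exact abs_innerPair_div_regAbs_le (hε n) p z w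
  refine IsWeakGrad.of_tendsto (fun n => isWeakGrad_chain (contDiff_ofReal_regAbs (hε n)) (hK n)
    hu hg₁ h₁ hv hg₂ h₂) ?_ ?_
  · intro η hη hc
    refine tendsto_integral_test_of_dominated (b := fun x => ‖u x‖ + ‖v x‖ + 1)
      (fun n => (contDiff_ofReal_regAbs (hε n)).continuous.comp_aestronglyMeasurable
        (hu.1.prodMk hv.1)) ((locInt (hu.norm.add hv.norm)).add (locallyIntegrable_const _))
      (fun n => .of_forall fun x => ?_) (.of_forall fun x => ?_) hη.continuous hc
    · rw [Complex.norm_real, Real.norm_of_nonneg (regAbs_pos (hε n) _).le]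
      refine (regAbs_le (hε n).le _).trans ?_
      gcongr
      rw [div_le_one (by positivity)]
      linarith [Nat.cast_nonneg (α := ℝ) n]
    · exact (Complex.continuous_ofReal.tendsto _).comp (tendsto_regAbs (u x, v x))
  · intro η hη hc i
    refine tendsto_integral_test_of_dominated (b := fun x => ‖g₁ x i‖ + ‖g₂ x i‖)
      (fun n => aestronglyMeasurable_fderiv_comp (contDiff_ofReal_regAbs (hε n)) hu.1 hv.1
        (memLp_apply hg₁ i).1 (memLp_apply hg₂ i).1)
      (locInt ((memLp_apply hg₁ i).norm.add (memLp_apply hg₂ i).norm))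
      (fun n => .of_forall fun x => ?_) (.of_forall fun x => ?_) hη.continuous hc
    · rw [fderiv_ofReal_regAbs (hε n), Complex.norm_real]
      exact abs_innerPair_div_regAbs_le (hε n) _ _ _
    · simp only [fderiv_ofReal_regAbs (hε _)]
      exact (Complex.continuous_ofReal.tendsto _).comp
        (tendsto_innerPair_div_regAbs (u x, v x) (g₁ x i, g₂ x i))

lemma norm_sq_eq_sum (z : EuclideanSpace ℂ (Fin d)) : ‖z‖ ^ 2 = ∑ i, ‖z i‖ ^ 2 := by
  rw [EuclideanSpace.norm_eq, Real.sq_sqrt (Finset.sum_nonneg fun i _ => by positivity)]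

/-- Cauchy-Schwarz in each coordinate: passing to the modulus does not increase the kinetic energy
density. -/
lemma norm_pairAbsGrad_sq_le (u v : Space d → ℂ) (g₁ g₂ : Space d → EuclideanSpace ℂ (Fin d))
    (x : Space d) : ‖pairAbsGrad u v g₁ g₂ x‖ ^ 2 ≤ ‖g₁ x‖ ^ 2 + ‖g₂ x‖ ^ 2 := by
  simp only [norm_sq_eq_sum, ← Finset.sum_add_distrib]
  refine Finset.sum_le_sum fun i _ => ?_
  simp only [pairAbsGrad, Complex.norm_real, Real.norm_eq_abs, sq_abs]
  set s := √(‖u x‖ ^ 2 + ‖v x‖ ^ 2) with hs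
  have h := abs_innerPair_le (u x, v x) (g₁ x i, g₂ x i)
  have h2 : (innerPair (u x, v x) (g₁ x i, g₂ x i)) ^ 2
      ≤ s ^ 2 * (‖g₁ x i‖ ^ 2 + ‖g₂ x i‖ ^ 2) := by
    rw [← sq_abs]
    calc _ ≤ (s * √(‖g₁ x i‖ ^ 2 + ‖g₂ x i‖ ^ 2)) ^ 2 := by gcongr
      _ = _ := by rw [mul_pow, Real.sq_sqrt (x := ‖g₁ x i‖ ^ 2 + ‖g₂ x i‖ ^ 2) (by positivity)]
  rcases eq_or_ne s 0 with h0 | h0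
  · rw [h0, div_zero, zero_pow two_ne_zero]; positivity
  · rw [div_pow, div_le_iff₀ (by positivity)]
    linarith

lemma memLp_pairAbs {u v : Space d → ℂ} {p : ℝ≥0∞} (hu : MemLp u p volume)
    (hv : MemLp v p volume) : MemLp (pairAbs u v) p volume := by
  refine (hu.norm.add hv.norm).mono' ?_ (.of_forall fun x => ?_)
  · exact Complex.continuous_ofReal.comp_aestronglyMeasurable
      (Real.continuous_sqrt.comp_aestronglyMeasurable
        ((hu.1.norm.pow 2).add (hv.1.norm.pow 2)))
  · rw [pairAbs, Complex.norm_real, Real.norm_of_nonneg (Real.sqrt_nonneg _)]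
    exact sqrt_sq_add_sq_le _ _ (norm_nonneg _) (norm_nonneg _)

lemma memLp_pairAbsGrad {u v : Space d → ℂ} {g₁ g₂ : Space d → EuclideanSpace ℂ (Fin d)}
    (hu : MemLp u 2 volume) (hg₁ : MemLp g₁ 2 volume)
    (hv : MemLp v 2 volume) (hg₂ : MemLp g₂ 2 volume) :
    MemLp (pairAbsGrad u v g₁ g₂) 2 volume := by
  refine (hg₁.norm.add hg₂.norm).mono' ?_ (.of_forall fun x => ?_)
  · refine aestronglyMeasurable_of_apply fun i => ?_
    refine Complex.continuous_ofReal.comp_aestronglyMeasurable ?_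
    refine AEMeasurable.aestronglyMeasurable (AEMeasurable.div ?_ ?_)
    · simp only [innerPair_apply]
      exact ((hu.1.inner (memLp_apply hg₁ i).1).add (hv.1.inner (memLp_apply hg₂ i).1)).aemeasurable
    · exact (Real.continuous_sqrt.comp_aestronglyMeasurable
        ((hu.1.norm.pow 2).add (hv.1.norm.pow 2))).aemeasurable
  · refine (Real.le_sqrt_of_sq_le (norm_pairAbsGrad_sq_le u v g₁ g₂ x)).trans ?_
    exact sqrt_sq_add_sq_le _ _ (norm_nonneg _) (norm_nonneg _)

lemma norm_pairAbs_sq (u v : Space d → ℂ) (x : Space d) :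
    ‖pairAbs u v x‖ ^ 2 = ‖u x‖ ^ 2 + ‖v x‖ ^ 2 := by
  rw [pairAbs, Complex.norm_real, Real.norm_eq_abs, sq_abs, Real.sq_sqrt (by positivity)]

end

/-! ### Gagliardo-Nirenberg inequalities -/

section

variable {d : ℕ} {E : Type*} [NormedAddCommGroup E]

lemma integrable_norm_sq {f : Space d → E} (hf : MemLp f 2 volume) :
    Integrable (fun x => ‖f x‖ ^ 2) volume :=
  hf.integrable_norm_pow (p := 2) two_ne_zero

lemma integrable_norm_four {f : Space d → E} (hf : MemLp f 4 volume) :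
    Integrable (fun x => ‖f x‖ ^ 4) volume :=
  hf.integrable_norm_pow (p := 4) four_ne_zero

lemma ofReal_norm_pow (z : E) (n : ℕ) : ENNReal.ofReal (‖z‖ ^ n) = ‖z‖ₑ ^ n := by
  rw [ENNReal.ofReal_pow (norm_nonneg _), ofReal_norm]

lemma ofReal_integral_norm_pow {f : Space d → E} {n : ℕ}
    (hf : Integrable (fun x => ‖f x‖ ^ n) volume) :
    ENNReal.ofReal (∫ x, ‖f x‖ ^ n) = ∫⁻ x, ‖f x‖ₑ ^ n := by
  rw [ofReal_integral_eq_lintegral_ofReal hf (.of_forall fun x => by positivity)]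
  simp only [ofReal_norm_pow]

lemma eLpNorm_two_eq_ofReal_sqrt {f : Space d → E} (hf : MemLp f 2 volume) :
    eLpNorm f 2 volume = ENNReal.ofReal √(∫ x, ‖f x‖ ^ 2) := by
  have h := ofReal_integral_norm_pow (integrable_norm_sq hf)
  rw [← eLpNorm_two_sq] at h
  have h0 : 0 ≤ ∫ x, ‖f x‖ ^ 2 := integral_nonneg fun x => by positivity
  have h2 : ENNReal.ofReal √(∫ x, ‖f x‖ ^ 2) ^ 2 = eLpNorm f 2 volume ^ 2 := by
    rw [← ENNReal.ofReal_pow (Real.sqrt_nonneg _), Real.sq_sqrt h0, h]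
  exact ((ENNReal.pow_right_strictMono two_ne_zero).injective h2).symm

lemma eLpNorm_four_pow (f : Space d → E) : eLpNorm f 4 volume ^ 4 = ∫⁻ x, ‖f x‖ₑ ^ 4 := by
  have := eLpNorm_nnreal_pow_eq_lintegral (f := f) (μ := (volume : Measure (Space d))) (p := 4)
    four_ne_zero
  simpa using this

/-- The operator norm is at most the Hilbert-Schmidt norm. For complex-valued functions the two may
differ. -/
lemma norm_fderiv_le_norm_cgrad (F : Space d → ℂ) (x : Space d) :
    ‖fderiv ℝ F x‖ ≤ ‖cgrad F x‖ := by
  refine ContinuousLinearMap.opNorm_le_bound _ (norm_nonneg _) fun v => ?_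
  have hv : v = ∑ i, v i • EuclideanSpace.single i (1 : ℝ) := by
    ext j
    simp [Finset.sum_apply, Pi.single_apply]
  calc ‖fderiv ℝ F x v‖ = ‖∑ i, v i • cgrad F x i‖ := by
        conv_lhs => rw [hv, map_sum]
        simp only [map_smul, cgrad_apply]
    _ ≤ ∑ i, ‖v i‖ * ‖cgrad F x i‖ :=
        (norm_sum_le _ _).trans (le_of_eq (by simp only [norm_smul]))
    _ ≤ √(∑ i, ‖v i‖ ^ 2) * √(∑ i, ‖cgrad F x i‖ ^ 2) := Real.sum_mul_le_sqrt_mul_sqrt _ _ _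
    _ = ‖cgrad F x‖ * ‖v‖ := by rw [EuclideanSpace.norm_eq, EuclideanSpace.norm_eq, mul_comm]

lemma lintegral_mul_le_eLpNorm_two {F' : Type*} [NormedAddCommGroup F'] {α : Type*}
    [MeasurableSpace α] {μ : Measure α} {f : α → E} {g : α → F'}
    (hf : AEStronglyMeasurable f μ) (hg : AEStronglyMeasurable g μ) :
    ∫⁻ x, ‖f x‖ₑ * ‖g x‖ₑ ∂μ ≤ eLpNorm f 2 μ * eLpNorm g 2 μ := by
  have h := ENNReal.lintegral_mul_le_Lp_mul_Lq μ Real.HolderConjugate.two_two hf.enorm hg.enorm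
  rw [eLpNorm_eq_lintegral_rpow_enorm_toReal two_ne_zero (by simp),
    eLpNorm_eq_lintegral_rpow_enorm_toReal two_ne_zero (by simp)]
  simpa using h

/-- From ∇(F²) = 2F ∇F and Cauchy-Schwarz. This lets the L¹ Sobolev inequalities be applied to F² in
dimensions one and two. -/
lemma lintegral_enorm_fderiv_sq_le {F : Space d → ℂ} (hF : ContDiff ℝ 1 F) :
    ∫⁻ x, ‖fderiv ℝ (fun x => F x ^ 2) x‖ₑ
      ≤ 2 * (eLpNorm F 2 volume * eLpNorm (cgrad F) 2 volume) := by
  calc ∫⁻ x, ‖fderiv ℝ (fun x => F x ^ 2) x‖ₑ ≤ ∫⁻ x, 2 * (‖F x‖ₑ * ‖cgrad F x‖ₑ) := by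
        refine lintegral_mono fun x => ?_
        have hd := (((hF.differentiable one_ne_zero) x).hasFDerivAt.pow 2).fderiv
        have he : fderiv ℝ (fun x => F x ^ 2) x = (2 * F x) • fderiv ℝ F x := by
          rw [hd]; simp
        have hn : ‖fderiv ℝ (fun x => F x ^ 2) x‖ ≤ 2 * (‖F x‖ * ‖cgrad F x‖) := by
          rw [he, norm_smul, norm_mul, mul_assoc]
          simp only [Complex.norm_ofNat]
          gcongr
          exact norm_fderiv_le_norm_cgrad F x
        calc ‖fderiv ℝ (fun x => F x ^ 2) x‖ₑ = ENNReal.ofReal _ := (ofReal_norm _).symm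
          _ ≤ ENNReal.ofReal (2 * (‖F x‖ * ‖cgrad F x‖)) := ENNReal.ofReal_le_ofReal hn
          _ = _ := by
            rw [ENNReal.ofReal_mul zero_le_two, ENNReal.ofReal_mul (norm_nonneg _), ofReal_norm,
              ofReal_norm]; simp
    _ = 2 * ∫⁻ x, ‖F x‖ₑ * ‖cgrad F x‖ₑ := lintegral_const_mul' _ _ (by simp)
    _ ≤ _ := by
        gcongr
        exact lintegral_mul_le_eLpNorm_two hF.continuous.aestronglyMeasurable
          (continuous_cgrad hF).aestronglyMeasurable

/-- The fundamental theorem of calculus for F² bounds |F|² pointwise by the L¹ norm of its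
derivative; one factor |F|² of |F|⁴ is estimated by this supremum. -/
lemma gagliardoNirenberg_test_one : ∃ C : ℝ≥0, ∀ F : Space 1 → ℂ, ContDiff ℝ 1 F →
    HasCompactSupport F → ∫⁻ x, ‖F x‖ₑ ^ 4
      ≤ C * (eLpNorm F 2 volume ^ 3 * eLpNorm (cgrad F) 2 volume ^ 1) := by
  refine ⟨2, fun F hF hc => ?_⟩
  -- The isometry from ℝ to `Space 1`, used to transport one-variable calculus.
  set γ : ℝ → Space 1 := fun t => EuclideanSpace.single 0 t with hγ
  have hγe : γ = (WithLp.toLp 2) ∘ (MeasurableEquiv.funUnique (Fin 1) ℝ).symm := by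
    ext t i
    fin_cases i
    simp [hγ, MeasurableEquiv.funUnique]
  have hγm : MeasurePreserving γ volume volume := by
    rw [hγe]
    exact (PiLp.volume_preserving_toLp (Fin 1)).comp (volume_preserving_funUnique (Fin 1) ℝ).symm
  have hγl : γ = ((ContinuousLinearMap.toSpanSingleton ℝ (EuclideanSpace.single 0 1 : Space 1))) := by
    ext t i
    fin_cases i
    simp [hγ]
  have hγs : ∀ x : Space 1, x = γ (x 0) := fun x => by
    ext i; fin_cases i; simp [hγ]
  have hγcs : ∀ {X : Type} [Zero X] {k : Space 1 → X}, HasCompactSupport k →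
      HasCompactSupport (k ∘ γ) := fun {X} _ {k} hk => by
    refine hk.comp_isClosedEmbedding (g := γ) (Isometry.isClosedEmbedding ?_)
    exact Isometry.of_dist_eq fun s t => by simp [hγ]
  have hsup : ∀ x, ‖F x‖ₑ ^ 2 ≤ 2 * (eLpNorm F 2 volume * eLpNorm (cgrad F) 2 volume) := by
    intro x
    have hw : ContDiff ℝ 1 ((fun x => F x ^ 2) ∘ γ) := by
      rw [hγl]
      exact (hF.pow 2).comp (ContinuousLinearMap.contDiff _)
    have hwc : HasCompactSupport ((fun x => F x ^ 2) ∘ γ) := by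
      refine hγcs ?_
      have := hc.comp_left (g := fun z : ℂ => z ^ 2) (by simp)
      exact this
    have h1 := hwc.enorm_le_lintegral_Ici_deriv hw (x 0)
    simp only [Function.comp_apply] at h1
    rw [← hγs, enorm_pow] at h1
    refine h1.trans ((setLIntegral_le_lintegral _ _).trans (le_trans ?_
      (lintegral_enorm_fderiv_sq_le hF)))
    have hcont : Continuous (fderiv ℝ fun x => F x ^ 2) := (hF.pow 2).continuous_fderiv one_ne_zero
    rw [← hγm.lintegral_comp hcont.enorm.measurable]
    refine lintegral_mono fun t => ?_
    have hder : HasDerivAt γ (EuclideanSpace.single 0 1 : Space 1) t := by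
      rw [hγl]
      simpa using (ContinuousLinearMap.toSpanSingleton ℝ
        (EuclideanSpace.single 0 1 : Space 1)).hasDerivAt (x := t)
    have h2 := (((hF.pow 2).differentiable one_ne_zero) (γ t)).hasFDerivAt.comp_hasDerivAt t hder
    have h3 : deriv ((fun x => F x ^ 2) ∘ γ) t = _ := h2.deriv
    rw [h3, ← ofReal_norm, ← ofReal_norm]
    apply ENNReal.ofReal_le_ofReal
    simpa using (fderiv ℝ (fun x => F x ^ 2) (γ t)).le_opNorm (EuclideanSpace.single 0 1)
  calc ∫⁻ x, ‖F x‖ₑ ^ 4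
      ≤ ∫⁻ x, 2 * (eLpNorm F 2 volume * eLpNorm (cgrad F) 2 volume) * ‖F x‖ₑ ^ 2 := by
        refine lintegral_mono fun x => ?_
        calc ‖F x‖ₑ ^ 4 = ‖F x‖ₑ ^ 2 * ‖F x‖ₑ ^ 2 := by ring
          _ ≤ _ := by gcongr; exact hsup x
    _ = 2 * (eLpNorm F 2 volume * eLpNorm (cgrad F) 2 volume) * eLpNorm F 2 volume ^ 2 := by
        rw [lintegral_const_mul _ (hF.continuous.enorm.measurable.pow_const 2), eLpNorm_two_sq]
    _ = _ := by push_cast; ring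

/-- In the plane the L² norm of a test function is bounded by the L¹ norm of its gradient; this is
applied to F². -/
lemma gagliardoNirenberg_test_two : ∃ C : ℝ≥0, ∀ F : Space 2 → ℂ, ContDiff ℝ 1 F →
    HasCompactSupport F → ∫⁻ x, ‖F x‖ₑ ^ 4
      ≤ C * (eLpNorm F 2 volume ^ 2 * eLpNorm (cgrad F) 2 volume ^ 2) := by
  set C₀ : ℝ≥0 := eLpNormLESNormFDerivOneConst (volume : Measure (Space 2)) (2 : ℝ≥0)
  refine ⟨C₀ ^ 2 * 4, fun F hF hc => ?_⟩
  have hconj : NNReal.HolderConjugate (Module.finrank ℝ (Space 2)) 2 := by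
    simp only [finrank_euclideanSpace, Fintype.card_fin]
    exact_mod_cast NNReal.HolderConjugate.two_two
  have hwc : HasCompactSupport (fun x => F x ^ 2) :=
    hc.comp_left (g := fun z : ℂ => z ^ 2) (by simp)
  have h1 := eLpNorm_le_eLpNorm_fderiv_one volume (hF.pow 2) hwc hconj
  rw [eLpNorm_one_eq_lintegral_enorm] at h1
  have h2 : eLpNorm (fun x => F x ^ 2) 2 volume
      ≤ C₀ * (2 * (eLpNorm F 2 volume * eLpNorm (cgrad F) 2 volume)) :=
    h1.trans (mul_le_mul' le_rfl (lintegral_enorm_fderiv_sq_le hF))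
  calc ∫⁻ x, ‖F x‖ₑ ^ 4 = eLpNorm (fun x => F x ^ 2) 2 volume ^ 2 := by
        rw [eLpNorm_two_sq]
        refine lintegral_congr fun x => ?_
        rw [enorm_pow]; ring
    _ ≤ (C₀ * (2 * (eLpNorm F 2 volume * eLpNorm (cgrad F) 2 volume))) ^ 2 := by gcongr
    _ = _ := by push_cast; ring

/-- Sobolev's inequality controls the L⁶ norm (1/6 = 1/2 - 1/3), and |F|⁴ = |F| |F|³ is split by
Cauchy-Schwarz. -/
lemma gagliardoNirenberg_test_three : ∃ C : ℝ≥0, ∀ F : Space 3 → ℂ, ContDiff ℝ 1 F →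
    HasCompactSupport F → ∫⁻ x, ‖F x‖ₑ ^ 4
      ≤ C * (eLpNorm F 2 volume ^ 1 * eLpNorm (cgrad F) 2 volume ^ 3) := by
  set C₀ : ℝ≥0 := SNormLESNormFDerivOfEqConst ℂ (volume : Measure (Space 3)) 2
  refine ⟨C₀ ^ 3, fun F hF hc => ?_⟩
  have h1 : eLpNorm F 6 volume ≤ C₀ * eLpNorm (fderiv ℝ F) 2 volume := by
    have := eLpNorm_le_eLpNorm_fderiv_of_eq volume hF hc (p := 2) (p' := 6) (by norm_num)
      (by simp) (by simp; norm_num)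
    simpa using this
  have h2 : eLpNorm F 6 volume ≤ C₀ * eLpNorm (cgrad F) 2 volume :=
    h1.trans (by gcongr; exact eLpNorm_mono fun x => norm_fderiv_le_norm_cgrad F x)
  have h6 : eLpNorm (fun x => F x ^ 3) 2 volume = eLpNorm F 6 volume ^ 3 := by
    have e1 := eLpNorm_two_sq (μ := volume) (fun x => F x ^ 3)
    have e2 := eLpNorm_nnreal_pow_eq_lintegral (f := F) (μ := volume) (p := 6) (by norm_num)
    have e3 : eLpNorm F 6 volume ^ 6 = ∫⁻ x, ‖F x‖ₑ ^ 6 := by simpa using e2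
    apply (ENNReal.pow_right_strictMono two_ne_zero).injective
    simp only
    rw [e1, ← pow_mul, e3]
    refine lintegral_congr fun x => ?_
    rw [enorm_pow]; ring
  calc ∫⁻ x, ‖F x‖ₑ ^ 4 = ∫⁻ x, ‖F x‖ₑ * ‖F x ^ 3‖ₑ := by
        refine lintegral_congr fun x => ?_
        rw [enorm_pow]; ring
    _ ≤ eLpNorm F 2 volume * eLpNorm (fun x => F x ^ 3) 2 volume :=
        lintegral_mul_le_eLpNorm_two hF.continuous.aestronglyMeasurable
          (hF.continuous.pow 3).aestronglyMeasurable
    _ ≤ eLpNorm F 2 volume * (C₀ * eLpNorm (cgrad F) 2 volume) ^ 3 := by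
        rw [h6]; gcongr
    _ = _ := by push_cast; ring

/-- Gagliardo-Nirenberg inequality for test functions in dimensions one, two and three. -/
lemma gagliardoNirenberg_test (hd : d = 1 ∨ d = 2 ∨ d = 3) :
    ∃ C : ℝ≥0, ∀ F : Space d → ℂ, ContDiff ℝ 1 F → HasCompactSupport F →
      ∫⁻ x, ‖F x‖ₑ ^ 4 ≤ C * (eLpNorm F 2 volume ^ (4 - d) * eLpNorm (cgrad F) 2 volume ^ d) := by
  rcases hd with rfl | rfl | rfl
  · exact gagliardoNirenberg_test_one
  · exact gagliardoNirenberg_test_two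
  · exact gagliardoNirenberg_test_three

lemma tendsto_eLpNorm_add_const {u : ℕ → ℝ≥0∞} (hu : Tendsto u atTop (𝓝 0)) (a : ℝ≥0∞) (n : ℕ) :
    Tendsto (fun k => (a + u k) ^ n) atTop (𝓝 (a ^ n)) := by
  have : Tendsto (fun k => a + u k) atTop (𝓝 (a + 0)) := tendsto_const_nhds.add hu
  rw [add_zero] at this
  exact ENNReal.Tendsto.pow this

lemma eLpNorm_le_add_sub {f F : Space d → E} (hf : MemLp f 2 volume) (hF : MemLp F 2 volume) :
    eLpNorm F 2 volume ≤ eLpNorm f 2 volume + eLpNorm (F - f) 2 volume := by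
  have : F = f + (F - f) := by simp
  conv_lhs => rw [this]
  exact eLpNorm_add_le hf.1 (hF.sub hf).1 (by norm_num)

/-- Gagliardo-Nirenberg inequality in dimensions one, two and three. -/
lemma gagliardoNirenberg (hd : d = 1 ∨ d = 2 ∨ d = 3) :
    ∃ C : ℝ, 0 < C ∧ ∀ (f : Space d → ℂ) (g : Space d → EuclideanSpace ℂ (Fin d)),
      MemLp f 2 volume → MemLp g 2 volume → IsWeakGrad f g →
      MemLp f 4 volume ∧
      ∫ x, ‖f x‖ ^ 4 ≤ C * (√(∫ x, ‖f x‖ ^ 2) ^ (4 - d) * √(∫ x, ‖g x‖ ^ 2) ^ d) := by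
  obtain ⟨C, hC⟩ := gagliardoNirenberg_test hd
  -- Adding 1 makes the constant strictly positive.
  refine ⟨C + 1, by positivity, fun f g hf hg hfg => ?_⟩
  obtain ⟨F, hF⟩ := exists_approximates hf hg hfg
  have key : ∫⁻ x, ‖f x‖ₑ ^ 4
      ≤ C * (eLpNorm f 2 volume ^ (4 - d) * eLpNorm g 2 volume ^ d) := by
    -- Fatou along an almost everywhere convergent approximation, as L⁴ convergence is not yet
    -- available.
    have h1 : ∫⁻ x, ‖f x‖ₑ ^ 4 ≤ liminf (fun n => ∫⁻ x, ‖F n x‖ₑ ^ 4) atTop := by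
      calc ∫⁻ x, ‖f x‖ₑ ^ 4 = ∫⁻ x, liminf (fun n => ‖F n x‖ₑ ^ 4) atTop := by
            refine lintegral_congr_ae ?_
            filter_upwards [hF.tendsto_ae] with x hx
            exact (ENNReal.Tendsto.pow hx.enorm).liminf_eq.symm
        _ ≤ _ := lintegral_liminf_le fun n =>
            (hF.contDiff n).continuous.enorm.measurable.pow_const 4
    refine h1.trans ?_
    let R : ℕ → ℝ≥0∞ := fun n =>
      C * ((eLpNorm f 2 volume + eLpNorm (F n - f) 2 volume) ^ (4 - d)
        * (eLpNorm g 2 volume + eLpNorm (cgrad (F n) - g) 2 volume) ^ d)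
    have hR : Tendsto R atTop (𝓝 (C * (eLpNorm f 2 volume ^ (4 - d) * eLpNorm g 2 volume ^ d))) := by
      refine ENNReal.Tendsto.const_mul (ENNReal.Tendsto.mul
        (tendsto_eLpNorm_add_const hF.tendsto_L2 _ _) (Or.inr ?_)
        (tendsto_eLpNorm_add_const hF.tendsto_grad _ _) (Or.inr ?_)) (Or.inr (by simp))
      · exact ENNReal.pow_ne_top hg.eLpNorm_ne_top
      · exact ENNReal.pow_ne_top hf.eLpNorm_ne_top
    rw [← hR.liminf_eq]
    refine liminf_le_liminf (.of_forall fun n => ?_)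
    refine (hC (F n) ((hF.contDiff n).of_le (by simp)) (hF.hasCompactSupport n)).trans ?_
    simp only [R]
    gcongr
    · exact eLpNorm_le_add_sub hf (hF.memLp n 2)
    · exact eLpNorm_le_add_sub hg (hF.memLp_cgrad n 2)
  rw [eLpNorm_two_eq_ofReal_sqrt hf, eLpNorm_two_eq_ofReal_sqrt hg,
    ← ENNReal.ofReal_pow (Real.sqrt_nonneg _), ← ENNReal.ofReal_pow (Real.sqrt_nonneg _),
    ← ENNReal.ofReal_mul (by positivity), ← ENNReal.ofReal_coe_nnreal,
    ← ENNReal.ofReal_mul (by positivity)] at key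
  have hm4 : MemLp f 4 volume := by
    refine ⟨hf.1, lt_of_not_ge fun htop => ?_⟩
    rw [top_le_iff] at htop
    have h4 := eLpNorm_four_pow f
    rw [htop, ENNReal.top_pow four_ne_zero] at h4
    rw [← h4] at key
    exact ENNReal.ofReal_ne_top (top_le_iff.1 key)
  refine ⟨hm4, ?_⟩
  rw [← ofReal_integral_norm_pow (integrable_norm_four hm4),
    ENNReal.ofReal_le_ofReal_iff (by positivity)] at key
  refine key.trans ?_
  gcongr
  linarith

end

/-! ### Translation estimates and weak convergence in L² -/

section

variable {d : ℕ}

/-- The fundamental theorem of calculus along the segment from x to x - t. -/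
lemma enorm_translate_sub_le {F : Space d → ℂ} (hF : ContDiff ℝ 1 F) (t x : Space d) :
    ‖F (x - t) - F x‖ₑ ≤ ∫⁻ s in Set.Ioc (0 : ℝ) 1, ‖t‖ₑ * ‖cgrad F (x - s • t)‖ₑ := by
  have hder : ∀ s : ℝ, HasDerivAt (fun s : ℝ => F (x - s • t)) (fderiv ℝ F (x - s • t) (-t)) s := by
    intro s
    have h1 : HasDerivAt (fun s : ℝ => x - s • t) (-t) s := by
      simpa using ((hasDerivAt_id s).smul_const t).const_sub x
    exact ((hF.differentiable one_ne_zero) (x - s • t)).hasFDerivAt.comp_hasDerivAt s h1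
  have hcont : Continuous fun s : ℝ => fderiv ℝ F (x - s • t) (-t) :=
    ((hF.continuous_fderiv one_ne_zero).comp (by fun_prop)).clm_apply continuous_const
  have hftc := intervalIntegral.integral_eq_sub_of_hasDerivAt (a := 0) (b := 1)
    (fun s _ => hder s) (hcont.intervalIntegrable _ _)
  simp only [one_smul, zero_smul, sub_zero] at hftc
  rw [← hftc, intervalIntegral.integral_of_le zero_le_one]
  refine (enorm_integral_le_lintegral_enorm _).trans (lintegral_mono fun s => ?_)
  have hn : ‖fderiv ℝ F (x - s • t) (-t)‖ ≤ ‖t‖ * ‖cgrad F (x - s • t)‖ := by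
    refine ((fderiv ℝ F (x - s • t)).le_opNorm _).trans ?_
    rw [norm_neg, mul_comm]
    gcongr
    exact norm_fderiv_le_norm_cgrad F _
  rw [← ofReal_norm, ← ofReal_norm, ← ofReal_norm, ← ENNReal.ofReal_mul (norm_nonneg _)]
  exact ENNReal.ofReal_le_ofReal hn

lemma eLpNorm_translate {E : Type*} [NormedAddCommGroup E] {h : Space d → E}
    (hh : AEStronglyMeasurable h volume) (t : Space d) :
    eLpNorm (fun x => h (x - t)) 2 volume = eLpNorm h 2 volume :=
  eLpNorm_comp_measurePreserving hh (measurePreserving_sub_right volume t)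

/-- Jensen moves the square inside the average over the segment; after Tonelli, translation
invariance makes the inner integral independent of the position on it. -/
lemma eLpNorm_translate_sub_test_le {F : Space d → ℂ} (hF : ContDiff ℝ 1 F) (t : Space d) :
    eLpNorm (fun x => F (x - t) - F x) 2 volume ≤ ‖t‖ₑ * eLpNorm (cgrad F) 2 volume := by
  rw [eLpNorm_two_le_iff]
  have hprob : IsProbabilityMeasure ((volume : Measure ℝ).restrict (Set.Ioc 0 1)) := ⟨by simp⟩
  have hc := continuous_cgrad hF
  have hmeas : Measurable fun p : Space d × ℝ => ‖t‖ₑ * ‖cgrad F (p.1 - p.2 • t)‖ₑ :=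
    (hc.comp (by fun_prop : Continuous fun p : Space d × ℝ => p.1 - p.2 • t)).enorm.measurable.const_mul
      _
  calc ∫⁻ x, ‖F (x - t) - F x‖ₑ ^ 2
      ≤ ∫⁻ x, ∫⁻ s in Set.Ioc (0 : ℝ) 1, (‖t‖ₑ * ‖cgrad F (x - s • t)‖ₑ) ^ 2 := by
        refine lintegral_mono fun x => ?_
        refine (pow_le_pow_left' (enorm_translate_sub_le hF t x) 2).trans
          (lintegral_sq_le_of_prob ?_)
        exact (hmeas.comp measurable_prodMk_left).aemeasurable
    _ = ∫⁻ s in Set.Ioc (0 : ℝ) 1, ∫⁻ x, (‖t‖ₑ * ‖cgrad F (x - s • t)‖ₑ) ^ 2 :=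
        lintegral_lintegral_swap (hmeas.pow_const 2).aemeasurable
    _ = ∫⁻ s in Set.Ioc (0 : ℝ) 1, (‖t‖ₑ * eLpNorm (cgrad F) 2 volume) ^ 2 := by
        refine lintegral_congr fun s => ?_
        simp only [mul_pow]
        rw [lintegral_const_mul' _ _ (by simp), ← eLpNorm_two_sq (fun x => cgrad F (x - s • t)),
          eLpNorm_translate hc.aestronglyMeasurable]
    _ = _ := by simp

/-- `H¹` functions are Lipschitz under translations in `L²`. -/
lemma eLpNorm_translate_sub_le {f : Space d → ℂ} {g : Space d → EuclideanSpace ℂ (Fin d)}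
    (hf : MemLp f 2 volume) (hg : MemLp g 2 volume) (hfg : IsWeakGrad f g) (t : Space d) :
    eLpNorm (fun x => f (x - t) - f x) 2 volume ≤ ‖t‖ₑ * eLpNorm g 2 volume := by
  obtain ⟨F, hF⟩ := exists_approximates hf hg hfg
  have hb : ∀ n, eLpNorm (fun x => f (x - t) - f x) 2 volume
      ≤ eLpNorm (F n - f) 2 volume + ‖t‖ₑ * (eLpNorm g 2 volume + eLpNorm (cgrad (F n) - g) 2 volume)
        + eLpNorm (F n - f) 2 volume := by
    intro n
    have hm := (hF.memLp n 2).sub hf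
    have hmt : AEStronglyMeasurable (fun x => (F n - f) (x - t)) volume :=
      hm.1.comp_measurePreserving (measurePreserving_sub_right volume t)
    have hFc := (hF.contDiff n).continuous
    have heq : (fun x => f (x - t) - f x) = (-(fun x => (F n - f) (x - t)))
        + (fun x => F n (x - t) - F n x) + (F n - f) := by
      ext x; simp only [Pi.add_apply, Pi.neg_apply, Pi.sub_apply]; ring
    have hm2 : AEStronglyMeasurable (fun x => F n (x - t) - F n x) volume :=
      ((hFc.comp (continuous_id.sub continuous_const)).sub hFc).aestronglyMeasurable
    rw [heq]
    refine (eLpNorm_add_le (hmt.neg.add hm2) hm.1 (by norm_num)).trans ?_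
    gcongr
    refine (eLpNorm_add_le hmt.neg hm2 (by norm_num)).trans ?_
    rw [eLpNorm_neg, eLpNorm_translate hm.1]
    gcongr
    refine (eLpNorm_translate_sub_test_le ((hF.contDiff n).of_le (by simp)) t).trans ?_
    gcongr
    exact eLpNorm_le_add_sub hg (hF.memLp_cgrad n 2)
  have hlim : Tendsto (fun n => eLpNorm (F n - f) 2 volume
      + ‖t‖ₑ * (eLpNorm g 2 volume + eLpNorm (cgrad (F n) - g) 2 volume)
        + eLpNorm (F n - f) 2 volume) atTop (𝓝 (0 + ‖t‖ₑ * (eLpNorm g 2 volume + 0) + 0)) :=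
    (hF.tendsto_L2.add (ENNReal.Tendsto.const_mul (tendsto_const_nhds.add hF.tendsto_grad)
      (Or.inr (by simp)))).add hF.tendsto_L2
  have := ge_of_tendsto' hlim hb
  simpa using this

/-- A rate that depends on the function only through its gradient norm, hence uniform on sets
bounded in H¹. This uniformity is the source of compactness. -/
lemma eLpNorm_mollify_sub_le_grad (φ : ContDiffBump (0 : Space d)) {f : Space d → ℂ}
    {g : Space d → EuclideanSpace ℂ (Fin d)}
    (hf : MemLp f 2 volume) (hg : MemLp g 2 volume) (hfg : IsWeakGrad f g) :
    eLpNorm (fun x => (φ.normed volume ⋆[ContinuousLinearMap.lsmul ℝ ℝ, volume] f) x - f x) 2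
      volume ≤ ENNReal.ofReal φ.rOut * eLpNorm g 2 volume := by
  refine eLpNorm_mollify_sub_le φ hf fun t ht => (eLpNorm_translate_sub_le hf hg hfg t).trans ?_
  gcongr
  rw [← ofReal_norm]
  exact ENNReal.ofReal_le_ofReal ht.le

/-- Bounded sequences in a separable Hilbert space have weakly convergent subsequences. -/
lemma exists_weak_subseq {H : Type*} [NormedAddCommGroup H] [InnerProductSpace ℂ H]
    [CompleteSpace H] [TopologicalSpace.SeparableSpace H] {x : ℕ → H} {M : ℝ}
    (hx : ∀ n, ‖x n‖ ≤ M) :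
    ∃ (a : H) (φ : ℕ → ℕ), StrictMono φ ∧
      ∀ y, Tendsto (fun n => inner ℂ (x (φ n)) y) atTop (𝓝 (inner ℂ a y)) := by
  -- Via the Riesz isomorphism the vectors become functionals in a dual ball, which is weak-*
  -- sequentially compact by separability.
  let T : ℕ → WeakDual ℂ H := fun n =>
    StrongDual.toWeakDual (InnerProductSpace.toDual ℂ H (x n))
  have hT : ∀ n, T n ∈ (WeakDual.toStrongDual ⁻¹' Metric.closedBall (0 : StrongDual ℂ H) M) :=
    fun n => by
      simp only [Set.mem_preimage, mem_closedBall_zero_iff]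
      have : ‖InnerProductSpace.toDual ℂ H (x n)‖ ≤ M := by
        rw [LinearIsometryEquiv.norm_map]; exact hx n
      exact this
  obtain ⟨A, _, φ, hφ, hlim⟩ := WeakDual.isSeqCompact_closedBall ℂ H 0 M hT
  refine ⟨(InnerProductSpace.toDual ℂ H).symm (WeakDual.toStrongDual A), φ, hφ, fun y => ?_⟩
  rw [InnerProductSpace.toDual_symm_apply]
  have := ((WeakDual.eval_continuous y).tendsto A).comp hlim
  exact this

/-- Weak convergence in `L²`. -/
def WeakTendsto {E : Type*} [NormedAddCommGroup E] [InnerProductSpace ℂ E]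
    (F : ℕ → Space d → E) (f : Space d → E) : Prop :=
  ∀ k : Space d → E, MemLp k 2 volume →
    Tendsto (fun n => ∫ x, inner ℂ (F n x) (k x)) atTop (𝓝 (∫ x, inner ℂ (f x) (k x)))

variable {E : Type*} [NormedAddCommGroup E] [InnerProductSpace ℂ E]

lemma inner_toLp {f k : Space d → E} (hf : MemLp f 2 volume) (hk : MemLp k 2 volume) :
    inner ℂ (hf.toLp f) (hk.toLp k) = ∫ x, inner ℂ (f x) (k x) := by
  rw [L2.inner_def]
  refine integral_congr_ae ?_
  filter_upwards [hf.coeFn_toLp, hk.coeFn_toLp] with x h1 h2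
  rw [h1, h2]

lemma norm_toLp_eq {E : Type*} [NormedAddCommGroup E] {f : Space d → E} (hf : MemLp f 2 volume) :
    ‖hf.toLp f‖ = √(∫ x, ‖f x‖ ^ 2) := by
  rw [Lp.norm_toLp, eLpNorm_two_eq_ofReal_sqrt hf, ENNReal.toReal_ofReal (Real.sqrt_nonneg _)]

lemma exists_weakTendsto_subseq [CompleteSpace E] [SecondCountableTopology E]
    {F : ℕ → Space d → E}
    (hF : ∀ n, MemLp (F n) 2 volume) {M : ℝ} (hM : ∀ n, ∫ x, ‖F n x‖ ^ 2 ≤ M) :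
    ∃ (f : Space d → E) (φ : ℕ → ℕ), StrictMono φ ∧ MemLp f 2 volume ∧
      WeakTendsto (fun n => F (φ n)) f := by
  have : Fact ((2 : ℝ≥0∞) ≠ ⊤) := ⟨by simp⟩
  obtain ⟨a, φ, hφ, h⟩ := exists_weak_subseq (x := fun n => (hF n).toLp (F n)) (M := √M)
    fun n => by rw [norm_toLp_eq]; exact Real.sqrt_le_sqrt (hM n)
  refine ⟨a, φ, hφ, Lp.memLp a, fun k hk => ?_⟩
  have h1 := h (hk.toLp k)
  simp only [inner_toLp] at h1
  have h2 : inner ℂ a (hk.toLp k) = ∫ x, inner ℂ (a x) (k x) := by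
    rw [← inner_toLp (Lp.memLp a) hk, Lp.toLp_coeFn]
  rwa [h2] at h1

/-- Weak lower semicontinuity of the norm. -/
lemma WeakTendsto.integral_norm_sq_le {F : ℕ → Space d → E} {f : Space d → E}
    (h : WeakTendsto F f) (hF : ∀ n, MemLp (F n) 2 volume) (hf : MemLp f 2 volume) {K : ℝ}
    (hK : Tendsto (fun n => ∫ x, ‖F n x‖ ^ 2) atTop (𝓝 K)) : ∫ x, ‖f x‖ ^ 2 ≤ K := by
  -- The weak convergence is tested against the limit itself and combined with Cauchy-Schwarz.
  have h1 := (h f hf).norm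
  have h2 : ∀ n, ‖∫ x, inner ℂ (F n x) (f x)‖ ≤ √(∫ x, ‖F n x‖ ^ 2) * √(∫ x, ‖f x‖ ^ 2) := by
    intro n
    rw [← inner_toLp (hF n) hf, ← norm_toLp_eq (hF n), ← norm_toLp_eq hf]
    exact norm_inner_le_norm _ _
  have h3 : Tendsto (fun n => √(∫ x, ‖F n x‖ ^ 2) * √(∫ x, ‖f x‖ ^ 2)) atTop
      (𝓝 (√K * √(∫ x, ‖f x‖ ^ 2))) := ((Real.continuous_sqrt.tendsto K).comp hK).mul_const _
  have h4 := le_of_tendsto_of_tendsto' h1 h3 h2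
  have h0 : 0 ≤ ∫ x, ‖f x‖ ^ 2 := integral_nonneg fun x => by positivity
  have hK0 : 0 ≤ K := ge_of_tendsto' hK fun n => integral_nonneg fun x => by positivity
  rw [← inner_toLp hf hf, inner_self_eq_norm_sq_to_K, norm_toLp_eq hf] at h4
  rw [norm_pow, RCLike.norm_ofReal, abs_of_nonneg (Real.sqrt_nonneg _)] at h4
  -- Cancelling one factor of the norm of `f` needs it to be positive; the case of norm zero is
  -- immediate.
  rcases (Real.sqrt_nonneg (∫ x, ‖f x‖ ^ 2)).eq_or_lt with he | hlt
  · rw [← Real.sq_sqrt h0, ← he]; simpa using hK0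
  · have : √(∫ x, ‖f x‖ ^ 2) ≤ √K := by
      rw [sq] at h4
      exact le_of_mul_le_mul_right h4 hlt
    exact (Real.sqrt_le_sqrt_iff hK0).1 this

end

/-! ### Rellich compactness and confinement -/

section

variable {d : ℕ}

lemma WeakTendsto.tendsto_integral_smul {F : ℕ → Space d → ℂ} {f : Space d → ℂ}
    (h : WeakTendsto F f) {η : Space d → ℝ} (hη : MemLp η 2 volume) :
    Tendsto (fun n => ∫ x, η x • F n x) atTop (𝓝 (∫ x, η x • f x)) := by
  have hη' : MemLp (fun x => (η x : ℂ)) 2 volume := hη.ofReal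
  -- The inner product is conjugate linear in the first slot, so the test integral is the conjugate
  -- of a pairing with the real function `η`.
  have key : ∀ k : Space d → ℂ, ∫ x, η x • k x
      = (starRingEnd ℂ) (∫ x, inner ℂ (k x) ((η x : ℝ) : ℂ)) := fun k => by
    rw [← integral_conj]
    refine integral_congr_ae (.of_forall fun x => ?_)
    simp
  simp only [key]
  exact (Complex.continuous_conj.tendsto _).comp (h _ hη')

lemma WeakTendsto.tendsto_integral_smul_apply {G : ℕ → Space d → EuclideanSpace ℂ (Fin d)}
    {g : Space d → EuclideanSpace ℂ (Fin d)}
    (h : WeakTendsto G g) {η : Space d → ℝ} (hη : MemLp η 2 volume) (i : Fin d) :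
    Tendsto (fun n => ∫ x, η x • G n x i) atTop (𝓝 (∫ x, η x • g x i)) := by
  -- Pairing with the vector field η eᵢ isolates the i-th component.
  have hη' : MemLp (fun x => (EuclideanSpace.single i (η x : ℂ) : EuclideanSpace ℂ (Fin d))) 2
      volume := by
    refine hη.mono (aestronglyMeasurable_of_apply fun j => ?_) (.of_forall fun x => by simp)
    by_cases hj : j = i
    · subst hj
      simpa using Complex.continuous_ofReal.comp_aestronglyMeasurable hη.1
    · simpa [hj] using aestronglyMeasurable_const
  have key : ∀ k : Space d → EuclideanSpace ℂ (Fin d), ∫ x, η x • k x i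
      = (starRingEnd ℂ) (∫ x, inner ℂ (k x) (EuclideanSpace.single i (η x : ℂ))) := fun k => by
    rw [← integral_conj]
    refine integral_congr_ae (.of_forall fun x => ?_)
    simp [EuclideanSpace.inner_single_right]
  simp only [key]
  exact (Complex.continuous_conj.tendsto _).comp (h _ hη')

lemma WeakTendsto.isWeakGrad {F : ℕ → Space d → ℂ} {f : Space d → ℂ}
    {G : ℕ → Space d → EuclideanSpace ℂ (Fin d)} {g : Space d → EuclideanSpace ℂ (Fin d)}
    (hF : WeakTendsto F f) (hG : WeakTendsto G g) (h : ∀ n, IsWeakGrad (F n) (G n)) :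
    IsWeakGrad f g :=
  IsWeakGrad.of_tendsto h
    (fun _ hη hc => hF.tendsto_integral_smul (hη.continuous.memLp_of_hasCompactSupport hc))
    (fun _ hη hc i =>
      hG.tendsto_integral_smul_apply (hη.continuous.memLp_of_hasCompactSupport hc) i)

lemma eLpNorm_reflect {E : Type*} [NormedAddCommGroup E] {h : Space d → E}
    (hh : AEStronglyMeasurable h volume) (x : Space d) :
    eLpNorm (fun y => h (x - y)) 2 volume = eLpNorm h 2 volume :=
  eLpNorm_comp_measurePreserving (f := fun y => x - y) hh (Measure.measurePreserving_sub_left volume x)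

/-- Mollification turns weak convergence into local strong convergence. -/
lemma WeakTendsto.tendsto_mollify {F : ℕ → Space d → ℂ} {f : Space d → ℂ} (h : WeakTendsto F f)
    (hF : ∀ n, MemLp (F n) 2 volume) (hf : MemLp f 2 volume) {M : ℝ≥0∞} (hM : M ≠ ⊤)
    (hFM : ∀ n, eLpNorm (F n) 2 volume ≤ M) (φ : ContDiffBump (0 : Space d)) (R : ℝ) :
    Tendsto (fun n => eLpNorm
      ((φ.normed volume ⋆[ContinuousLinearMap.lsmul ℝ ℝ, volume] F n)
        - (φ.normed volume ⋆[ContinuousLinearMap.lsmul ℝ ℝ, volume] f)) 2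
      (volume.restrict (Metric.ball 0 R))) atTop (𝓝 0) := by
  set ρ : Space d → ℝ := φ.normed volume with hρ
  have hρc : Continuous ρ := φ.continuous_normed
  have hρs : HasCompactSupport ρ := φ.hasCompactSupport_normed
  have hρ2 : MemLp ρ 2 volume := hρc.memLp_of_hasCompactSupport hρs
  have hρx : ∀ x, MemLp (fun y => ρ (x - y)) 2 volume := fun x =>
    (hρc.comp (continuous_const.sub continuous_id)).memLp_of_hasCompactSupport
      (hρs.comp_homeomorph (Homeomorph.subLeft x))
  have hρn : ∀ x, eLpNorm (fun y => ρ (x - y)) 2 volume = eLpNorm ρ 2 volume := fun x =>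
    eLpNorm_reflect hρ2.1 x
  have hcts : ∀ k : Space d → ℂ, MemLp k 2 volume →
      Continuous (ρ ⋆[ContinuousLinearMap.lsmul ℝ ℝ, volume] k) := fun k hk =>
    hρs.continuous_convolution_left _ hρc (locInt hk)
  have hfin : IsFiniteMeasure ((volume : Measure (Space d)).restrict (Metric.ball 0 R)) :=
    ⟨by simpa using measure_ball_lt_top⟩
  -- Weak convergence gives pointwise convergence of the mollifications, and Cauchy-Schwarz bounds
  -- them by one constant, which is in L² of the ball.
  refine tendsto_eLpNorm_two_of_dominated
    (b := fun _ => (eLpNorm ρ 2 volume * M).toReal)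
    (fun n => (hcts _ (hF n)).aestronglyMeasurable) (hcts _ hf).aestronglyMeasurable
    (memLp_const _) (fun n => .of_forall fun x => ?_) (.of_forall fun x => ?_)
  · rw [convolution_lsmul_swap, ← toReal_enorm]
    refine ENNReal.toReal_mono (ENNReal.mul_ne_top hρ2.eLpNorm_ne_top hM) ?_
    calc ‖∫ t, ρ (x - t) • F n t‖ₑ ≤ ∫⁻ t, ‖ρ (x - t)‖ₑ * ‖F n t‖ₑ := by
          refine (enorm_integral_le_lintegral_enorm _).trans (le_of_eq ?_)
          simp only [enorm_smul]
      _ ≤ eLpNorm (fun y => ρ (x - y)) 2 volume * eLpNorm (F n) 2 volume :=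
          lintegral_mul_le_eLpNorm_two (hρx x).1 (hF n).1
      _ ≤ _ := by rw [hρn]; gcongr; exact hFM n
  · simp only [convolution_lsmul_swap]
    exact h.tendsto_integral_smul (hρx x)

/-- Local Rellich compactness. -/
lemma WeakTendsto.tendsto_restrict_ball {F : ℕ → Space d → ℂ} {f : Space d → ℂ}
    {G : ℕ → Space d → EuclideanSpace ℂ (Fin d)} {g : Space d → EuclideanSpace ℂ (Fin d)}
    (h : WeakTendsto F f) (hF : ∀ n, MemLp (F n) 2 volume) (hf : MemLp f 2 volume)
    (hG : ∀ n, MemLp (G n) 2 volume) (hg : MemLp g 2 volume)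
    (hFG : ∀ n, IsWeakGrad (F n) (G n)) (hfg : IsWeakGrad f g) {M : ℝ≥0∞} (hM : M ≠ ⊤)
    (hFM : ∀ n, eLpNorm (F n) 2 volume ≤ M) (hGM : ∀ n, eLpNorm (G n) 2 volume ≤ M) (R : ℝ) :
    Tendsto (fun n => eLpNorm (F n - f) 2 (volume.restrict (Metric.ball 0 R))) atTop (𝓝 0) := by
  rw [ENNReal.tendsto_nhds_zero]
  intro ε hε
  have hε3 : 0 < ε / 3 := ENNReal.div_pos hε.ne' (by simp)
  -- The mollification scale is fixed before n: the bound on the gradients makes the error small for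
  -- all members of the sequence at once.
  have hr : Tendsto (fun k => ENNReal.ofReal (mollifier d k).rOut * (M + eLpNorm g 2 volume)) atTop
      (𝓝 0) := by
    have h1 := ENNReal.tendsto_ofReal (tendsto_mollifier_rOut d)
    have h2 := ENNReal.Tendsto.mul_const (b := M + eLpNorm g 2 volume) h1
      (Or.inr (ENNReal.add_ne_top.2 ⟨hM, hg.eLpNorm_ne_top⟩))
    simpa using h2
  obtain ⟨k, hk⟩ := (ENNReal.tendsto_nhds_zero.1 hr _ hε3).exists
  set φ := mollifier d k
  set μ := (volume : Measure (Space d)).restrict (Metric.ball 0 R)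
  have hμ : μ ≤ volume := Measure.restrict_le_self
  filter_upwards [ENNReal.tendsto_nhds_zero.1 (h.tendsto_mollify hF hf hM hFM φ R) _ hε3] with n hn
  let m : (Space d → ℂ) → Space d → ℂ := fun k =>
    φ.normed volume ⋆[ContinuousLinearMap.lsmul ℝ ℝ, volume] k
  have hmc : ∀ k : Space d → ℂ, MemLp k 2 volume → AEStronglyMeasurable (m k) volume := fun k hk =>
    (φ.hasCompactSupport_normed.continuous_convolution_left _ φ.continuous_normed
      (locInt hk)).aestronglyMeasurable
  have e : F n - f = (-(fun x => m (F n) x - F n x)) + (m (F n) - m f) + (fun x => m f x - f x) := by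
    ext x; simp only [Pi.add_apply, Pi.neg_apply, Pi.sub_apply]; ring
  have b1 : eLpNorm (-(fun x => m (F n) x - F n x)) 2 μ ≤ ε / 3 := by
    rw [eLpNorm_neg]
    refine (eLpNorm_mono_measure _ hμ).trans
      ((eLpNorm_mollify_sub_le_grad φ (hF n) (hG n) (hFG n)).trans (le_trans ?_ hk))
    gcongr
    exact (hGM n).trans le_self_add
  have b3 : eLpNorm (fun x => m f x - f x) 2 μ ≤ ε / 3 := by
    refine (eLpNorm_mono_measure _ hμ).trans
      ((eLpNorm_mollify_sub_le_grad φ hf hg hfg).trans (le_trans ?_ hk))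
    gcongr
    exact le_add_self
  have ms1 : AEStronglyMeasurable (-(fun x => m (F n) x - F n x)) μ :=
    (((hmc _ (hF n)).sub (hF n).1).neg).mono_measure hμ
  have ms2 : AEStronglyMeasurable (m (F n) - m f) μ :=
    ((hmc _ (hF n)).sub (hmc _ hf)).mono_measure hμ
  have ms3 : AEStronglyMeasurable (fun x => m f x - f x) μ :=
    ((hmc _ hf).sub hf.1).mono_measure hμ
  rw [e]
  calc _ ≤ ε / 3 + ε / 3 + ε / 3 := by
        refine (eLpNorm_add_le (ms1.add ms2) ms3 (by norm_num)).trans (add_le_add ?_ b3)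
        exact (eLpNorm_add_le ms1 ms2 (by norm_num)).trans (add_le_add b1 hn)
    _ = ε := ENNReal.add_thirds ε

lemma tendsto_eLpNorm_compl_ball {f : Space d → ℂ} (hf : MemLp f 2 volume) :
    Tendsto (fun n : ℕ => eLpNorm f 2 (volume.restrict (Metric.ball 0 (n : ℝ))ᶜ)) atTop (𝓝 0) := by
  have hm : ∀ n : ℕ, MeasurableSet (Metric.ball (0 : Space d) (n : ℝ)) := fun n => measurableSet_ball
  have h1 := tendsto_eLpNorm_two_of_dominated
    (F := fun n : ℕ => (Metric.ball (0 : Space d) (n : ℝ)).indicator f) (f := f)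
    (fun n => hf.1.indicator (hm n)) hf.1 hf.norm
    (fun n => .of_forall fun x => norm_indicator_le_norm_self f x) (.of_forall fun x => by
      refine tendsto_const_nhds.congr' ?_
      filter_upwards [eventually_gt_atTop ⌈‖x‖⌉₊] with n hn
      rw [Set.indicator_of_mem]
      exact mem_ball_zero_iff.2 (Nat.lt_of_ceil_lt hn))
  refine h1.congr fun n => ?_
  rw [← eLpNorm_indicator_eq_eLpNorm_restrict (hm n).compl, ← eLpNorm_neg]
  congr 1
  ext1 x
  by_cases hx : x ∈ Metric.ball (0 : Space d) (n : ℝ) <;> simp_all [Set.indicator]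

/-- The confining potential controls the mass at infinity. -/
lemma exists_eLpNorm_compl_ball_le {V : Space d → ℝ} (hV0 : ∀ x, 0 ≤ V x)
    (hV : Tendsto V (cocompact (Space d)) atTop) {M : ℝ} {ε : ℝ≥0∞} (hε : 0 < ε) :
    ∃ N : ℕ, ∀ n ≥ N, ∀ f : Space d → ℂ, MemLp f 2 volume →
      Integrable (fun x => V x * ‖f x‖ ^ 2) volume → ∫ x, V x * ‖f x‖ ^ 2 ≤ M →
      eLpNorm f 2 (volume.restrict (Metric.ball 0 (n : ℝ))ᶜ) ≤ ε := by
  -- Chebyshev: where V ≥ L + 1, the mass is at most M / (L + 1).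
  have hlim : Tendsto (fun L : ℕ => ENNReal.ofReal (M / ((L : ℝ) + 1))) atTop (𝓝 0) := by
    have := (tendsto_one_div_add_atTop_nhds_zero_nat (𝕜 := ℝ)).const_mul M
    have h2 := ENNReal.tendsto_ofReal this
    simpa [div_eq_mul_inv] using h2
  obtain ⟨L, hL⟩ := (ENNReal.tendsto_nhds_zero.1 hlim (ε ^ 2) (ENNReal.pow_pos hε 2)).exists
  have hev := hV.eventually (eventually_ge_atTop ((L : ℝ) + 1))
  obtain ⟨K, hK, hKV⟩ := (Filter.mem_cocompact (X := Space d)).1 hev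
  obtain ⟨r, hr⟩ := hK.isBounded.subset_ball 0
  refine ⟨⌈r⌉₊, fun n hn f hf hint hM => ?_⟩
  rw [eLpNorm_two_le_iff]
  refine le_trans ?_ hL
  have hL0 : (0 : ℝ) < (L : ℝ) + 1 := by positivity
  have hm : MeasurableSet (Metric.ball (0 : Space d) (n : ℝ))ᶜ := measurableSet_ball.compl
  calc ∫⁻ x in (Metric.ball 0 (n : ℝ))ᶜ, ‖f x‖ₑ ^ 2
      ≤ ∫⁻ x in (Metric.ball 0 (n : ℝ))ᶜ, ENNReal.ofReal (V x * ‖f x‖ ^ 2 / ((L : ℝ) + 1)) := by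
        refine setLIntegral_mono_ae' hm (.of_forall fun x hx => ?_)
        rw [← ofReal_norm_pow]
        apply ENNReal.ofReal_le_ofReal
        rw [le_div_iff₀ hL0, mul_comm]
        have hxK : x ∉ K := fun hxK => by
          have := hr hxK
          rw [mem_ball_zero_iff] at this
          apply hx
          rw [mem_ball_zero_iff]
          exact this.trans_le ((Nat.le_ceil r).trans (by exact_mod_cast hn))
        have := hKV hxK
        gcongr
        exact this
    _ ≤ ∫⁻ x, ENNReal.ofReal (V x * ‖f x‖ ^ 2 / ((L : ℝ) + 1)) := setLIntegral_le_lintegral _ _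
    _ = ENNReal.ofReal (∫ x, V x * ‖f x‖ ^ 2 / ((L : ℝ) + 1)) :=
        (ofReal_integral_eq_lintegral_ofReal (hint.div_const _) (.of_forall fun x => by
          have := hV0 x; positivity)).symm
    _ ≤ _ := by
        apply ENNReal.ofReal_le_ofReal
        rw [integral_div]
        gcongr

/-- Compactness of the embedding of the form domain into `L²`. -/
lemma WeakTendsto.tendsto_eLpNorm {F : ℕ → Space d → ℂ} {f : Space d → ℂ}
    {G : ℕ → Space d → EuclideanSpace ℂ (Fin d)} {g : Space d → EuclideanSpace ℂ (Fin d)}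
    (h : WeakTendsto F f) (hF : ∀ n, MemLp (F n) 2 volume) (hf : MemLp f 2 volume)
    (hG : ∀ n, MemLp (G n) 2 volume) (hg : MemLp g 2 volume)
    (hFG : ∀ n, IsWeakGrad (F n) (G n)) (hfg : IsWeakGrad f g) {M : ℝ}
    (hFM : ∀ n, ∫ x, ‖F n x‖ ^ 2 ≤ M) (hGM : ∀ n, ∫ x, ‖G n x‖ ^ 2 ≤ M)
    {V : Space d → ℝ} (hV0 : ∀ x, 0 ≤ V x) (hV : Tendsto V (cocompact (Space d)) atTop)
    (hVi : ∀ n, Integrable (fun x => V x * ‖F n x‖ ^ 2) volume)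
    (hVM : ∀ n, ∫ x, V x * ‖F n x‖ ^ 2 ≤ M) :
    Tendsto (fun n => eLpNorm (F n - f) 2 volume) atTop (𝓝 0) := by
  rw [ENNReal.tendsto_nhds_zero]
  intro ε hε
  have hε3 : 0 < ε / 3 := ENNReal.div_pos hε.ne' (by simp)
  obtain ⟨N, hN⟩ := exists_eLpNorm_compl_ball_le hV0 hV (M := M) hε3
  obtain ⟨m, hm, hmN⟩ := ((ENNReal.tendsto_nhds_zero.1 (tendsto_eLpNorm_compl_ball hf) _ hε3).and
    (eventually_ge_atTop N)).exists
  have hloc := h.tendsto_restrict_ball hF hf hG hg hFG hfg (M := ENNReal.ofReal √M)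
    ENNReal.ofReal_ne_top
    (fun n => by
      rw [eLpNorm_two_eq_ofReal_sqrt (hF n)]
      exact ENNReal.ofReal_le_ofReal (Real.sqrt_le_sqrt (hFM n)))
    (fun n => by
      rw [eLpNorm_two_eq_ofReal_sqrt (hG n)]
      exact ENNReal.ofReal_le_ofReal (Real.sqrt_le_sqrt (hGM n))) m
  filter_upwards [ENNReal.tendsto_nhds_zero.1 hloc _ hε3] with n hn
  have hmeas : MeasurableSet (Metric.ball (0 : Space d) (m : ℝ)) := measurableSet_ball
  have hsub := (hF n).sub hf
  -- Inside the ball local Rellich applies; outside it the sequence is small by confinement and the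
  -- limit because it lies in L².
  have hsplit : F n - f = (Metric.ball (0 : Space d) (m : ℝ)).indicator (F n - f)
      + (Metric.ball (0 : Space d) (m : ℝ))ᶜ.indicator (F n - f) :=
    (Set.indicator_self_add_compl _ _).symm
  rw [hsplit]
  refine (eLpNorm_add_le (hsub.1.indicator hmeas) (hsub.1.indicator hmeas.compl)
    (by norm_num)).trans ?_
  rw [eLpNorm_indicator_eq_eLpNorm_restrict hmeas,
    eLpNorm_indicator_eq_eLpNorm_restrict hmeas.compl]
  calc _ ≤ ε / 3 + (ε / 3 + ε / 3) := by
        refine add_le_add hn ((eLpNorm_sub_le (hF n).1.restrict hf.1.restrict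
          (by norm_num)).trans (add_le_add ?_ hm))
        exact hN m hmN (F n) (hF n) (hVi n) (hVM n)
    _ = ε := by rw [← add_assoc]; exact ENNReal.add_thirds ε

end

/-! ### Finite-energy functions, the energy formula and the constant C_b -/

section

variable {d : ℕ}

/-- `u` is an `H¹` function with weak gradient `g`, of finite potential and quartic energy. -/
structure FiniteEnergy (V : Space d → ℝ) (u : Space d → ℂ)
    (g : Space d → EuclideanSpace ℂ (Fin d)) : Prop where
  memLp : MemLp u 2 volume
  memLp_grad : MemLp g 2 volume
  isWeakGrad : IsWeakGrad u g
  memLp_four : MemLp u 4 volume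
  integrable_V : Integrable (fun x => V x * ‖u x‖ ^ 2) volume

namespace FiniteEnergy

variable {V V' : Space d → ℝ} {u v : Space d → ℂ} {g g' : Space d → EuclideanSpace ℂ (Fin d)}

lemma integrable_sq (h : FiniteEnergy V u g) : Integrable (fun x => ‖u x‖ ^ 2) volume :=
  integrable_norm_sq h.memLp

lemma integrable_four (h : FiniteEnergy V u g) : Integrable (fun x => ‖u x‖ ^ 4) volume :=
  integrable_norm_four h.memLp_four

lemma integrable_grad_sq (h : FiniteEnergy V u g) : Integrable (fun x => ‖g x‖ ^ 2) volume :=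
  integrable_norm_sq h.memLp_grad

lemma integrable_sq_mul_sq (hu : FiniteEnergy V u g) (hv : FiniteEnergy V' v g') :
    Integrable (fun x => ‖u x‖ ^ 2 * ‖v x‖ ^ 2) volume := by
  refine (hu.integrable_four.add hv.integrable_four).mono'
    ((hu.memLp.1.norm.pow 2).mul (hv.memLp.1.norm.pow 2)) (.of_forall fun x => ?_)
  rw [Real.norm_of_nonneg (by positivity)]
  simp only [Pi.add_apply]
  nlinarith [sq_nonneg (‖u x‖ ^ 2 - ‖v x‖ ^ 2), sq_nonneg (‖u x‖ ^ 2), sq_nonneg (‖v x‖ ^ 2)]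

lemma integrable_re_mul_conj (hu : FiniteEnergy V u g) (hv : FiniteEnergy V' v g') :
    Integrable (fun x => (u x * conj (v x)).re) volume := by
  refine (hu.integrable_sq.add hv.integrable_sq).mono'
    (Complex.continuous_re.comp_aestronglyMeasurable (hu.memLp.1.mul
      (Complex.continuous_conj.comp_aestronglyMeasurable hv.memLp.1))) (.of_forall fun x => ?_)
  rw [Real.norm_eq_abs]
  refine (Complex.abs_re_le_norm _).trans ?_
  simp only [Pi.add_apply, norm_mul, RCLike.norm_conj]
  nlinarith [sq_nonneg (‖u x‖ - ‖v x‖), sq_nonneg (‖u x‖), sq_nonneg (‖v x‖)]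

lemma memH1 (h : FiniteEnergy V u g) : MemH1 u := ⟨h.memLp, g, h.memLp_grad, h.isWeakGrad⟩

end FiniteEnergy

lemma GPData.Admissible.finiteEnergy_u {P : GPData d} {u v : Space d → ℂ} (h : P.Admissible u v) :
    FiniteEnergy P.Vu u (weakGrad u) :=
  ⟨h.memH1_u.1, h.memH1_u.2.weakGrad_spec.1, h.memH1_u.2.weakGrad_spec.2, h.memL4_u,
    h.integrable_Vu⟩

lemma GPData.Admissible.finiteEnergy_v {P : GPData d} {u v : Space d → ℂ} (h : P.Admissible u v) :
    FiniteEnergy P.Vd v (weakGrad v) :=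
  ⟨h.memH1_v.1, h.memH1_v.2.weakGrad_spec.1, h.memH1_v.2.weakGrad_spec.2, h.memL4_v,
    h.integrable_Vd⟩

lemma GPData.Admissible.of_finiteEnergy {P : GPData d} {u v : Space d → ℂ}
    {gu gv : Space d → EuclideanSpace ℂ (Fin d)} (hu : FiniteEnergy P.Vu u gu)
    (hv : FiniteEnergy P.Vd v gv) (hm : (∫ x, ‖u x‖ ^ 2) + ∫ x, ‖v x‖ ^ 2 = 1) :
    P.Admissible u v :=
  ⟨hu.memH1, hv.memH1, hu.memLp_four, hv.memLp_four, hu.integrable_V, hv.integrable_V, by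
    rw [integral_add hu.integrable_sq hv.integrable_sq, hm]⟩

lemma GPData.Admissible.mass_eq {P : GPData d} {u v : Space d → ℂ} (h : P.Admissible u v) :
    (∫ x, ‖u x‖ ^ 2) + ∫ x, ‖v x‖ ^ 2 = 1 := by
  rw [← integral_add h.finiteEnergy_u.integrable_sq h.finiteEnergy_v.integrable_sq]
  exact h.mass

/-- The interaction energy. -/
noncomputable def GPData.interaction (P : GPData d) (u v : Space d → ℂ) : ℝ :=
  1 / 2 * P.βuu * (∫ x, ‖u x‖ ^ 4) + 1 / 2 * P.βdd * (∫ x, ‖v x‖ ^ 4)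
    + P.βud * ∫ x, ‖u x‖ ^ 2 * ‖v x‖ ^ 2

/-- Any square-integrable weak gradients may be used, since they agree almost everywhere with the
chosen `weakGrad`. Limits, moduli and dilations thus enter with explicit gradients. -/
lemma GPData.energy_eq {P : GPData d} {u v : Space d → ℂ}
    {gu gv : Space d → EuclideanSpace ℂ (Fin d)} (hu : FiniteEnergy P.Vu u gu)
    (hv : FiniteEnergy P.Vd v gv) :
    P.energy u v = 1 / 2 * (∫ x, ‖gu x‖ ^ 2) + (∫ x, P.Vu x * ‖u x‖ ^ 2)
      + (1 / 2 * (∫ x, ‖gv x‖ ^ 2) + (∫ x, P.Vd x * ‖v x‖ ^ 2))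
      + P.δ / 2 * ((∫ x, ‖u x‖ ^ 2) - ∫ x, ‖v x‖ ^ 2) + P.interaction u v
      + P.Ω * ∫ x, (u x * conj (v x)).re := by
  have hwu := weakGrad_ae_eq hu.memLp_grad hu.isWeakGrad
  have hwv := weakGrad_ae_eq hv.memLp_grad hv.isWeakGrad
  have e : P.energy u v = ∫ x, ((1 / 2 * ‖gu x‖ ^ 2 + P.Vu x * ‖u x‖ ^ 2)
    + (1 / 2 * ‖gv x‖ ^ 2 + P.Vd x * ‖v x‖ ^ 2)
    + P.δ / 2 * (‖u x‖ ^ 2 - ‖v x‖ ^ 2)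
    + 1 / 2 * P.βuu * ‖u x‖ ^ 4 + 1 / 2 * P.βdd * ‖v x‖ ^ 4
    + P.βud * (‖u x‖ ^ 2 * ‖v x‖ ^ 2)
    + P.Ω * (u x * conj (v x)).re) := by
    refine integral_congr_ae ?_
    filter_upwards [hwu, hwv] with x h1 h2
    rw [GPData.energyDensity, h1, h2]
  have i1 := hu.integrable_grad_sq.const_mul (1 / 2)
  have i2 := hu.integrable_V
  have i3 := hv.integrable_grad_sq.const_mul (1 / 2)
  have i4 := hv.integrable_V
  have i5 : Integrable (fun x => P.δ / 2 * (‖u x‖ ^ 2 - ‖v x‖ ^ 2)) volume :=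
    (hu.integrable_sq.sub hv.integrable_sq).const_mul (P.δ / 2)
  have i6 := hu.integrable_four.const_mul (1 / 2 * P.βuu)
  have i7 := hv.integrable_four.const_mul (1 / 2 * P.βdd)
  have i8 := (hu.integrable_sq_mul_sq hv).const_mul P.βud
  have i9 := (hu.integrable_re_mul_conj hv).const_mul P.Ω
  rw [e, integral_add ((((((i1.fun_add i2).fun_add (i3.fun_add i4)).fun_add i5).fun_add i6).fun_add i7).fun_add i8) i9,
    integral_add (((((i1.fun_add i2).fun_add (i3.fun_add i4)).fun_add i5).fun_add i6).fun_add i7) i8,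
    integral_add ((((i1.fun_add i2).fun_add (i3.fun_add i4)).fun_add i5).fun_add i6) i7,
    integral_add (((i1.fun_add i2).fun_add (i3.fun_add i4)).fun_add i5) i6,
    integral_add ((i1.fun_add i2).fun_add (i3.fun_add i4)) i5,
    integral_add (i1.fun_add i2) (i3.fun_add i4), integral_add i1 i2, integral_add i3 i4]
  simp only [integral_const_mul]
  rw [integral_sub hu.integrable_sq hv.integrable_sq, GPData.interaction]
  ring

lemma GPData.interaction_eq_integral {P : GPData d} {u v : Space d → ℂ}
    {gu gv : Space d → EuclideanSpace ℂ (Fin d)} (hu : FiniteEnergy P.Vu u gu)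
    (hv : FiniteEnergy P.Vd v gv) :
    P.interaction u v = ∫ x, (1 / 2 * P.βuu * ‖u x‖ ^ 4 + 1 / 2 * P.βdd * ‖v x‖ ^ 4
      + P.βud * (‖u x‖ ^ 2 * ‖v x‖ ^ 2)) := by
  have i6 := hu.integrable_four.const_mul (1 / 2 * P.βuu)
  have i7 := hv.integrable_four.const_mul (1 / 2 * P.βdd)
  have i8 := (hu.integrable_sq_mul_sq hv).const_mul P.βud
  rw [integral_add (i6.fun_add i7) i8, integral_add i6 i7]
  simp only [integral_const_mul, GPData.interaction]

lemma FiniteEnergy.zero (V : Space d → ℝ) : FiniteEnergy V (0 : Space d → ℂ) 0 :=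
  ⟨MemLp.zero, MemLp.zero, isWeakGrad_zero, MemLp.zero, by simp⟩

lemma FiniteEnergy.const_mul {V : Space d → ℝ} {u : Space d → ℂ}
    {g : Space d → EuclideanSpace ℂ (Fin d)} (h : FiniteEnergy V u g) (c : ℂ) :
    FiniteEnergy V (fun x => c * u x) (fun x => c • g x) :=
  ⟨h.memLp.const_mul c, h.memLp_grad.const_smul c, h.isWeakGrad.const_mul c,
    h.memLp_four.const_mul c, by
      refine (h.integrable_V.const_mul (‖c‖ ^ 2)).congr (.of_forall fun x => ?_)
      simp only [norm_mul]; ring⟩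

/-- Compact support is what lets a merely locally integrable potential have finite energy. -/
lemma FiniteEnergy.of_test {V : Space d → ℝ} (hV : LocallyIntegrable V volume) {F : Space d → ℂ}
    (hF : ContDiff ℝ 1 F) (hc : HasCompactSupport F) : FiniteEnergy V F (cgrad F) :=
  ⟨hF.continuous.memLp_of_hasCompactSupport hc,
    (continuous_cgrad hF).memLp_of_hasCompactSupport (hasCompactSupport_cgrad hc),
    isWeakGrad_cgrad hF, hF.continuous.memLp_of_hasCompactSupport hc, by
      have h1 : HasCompactSupport fun x => ‖F x‖ ^ 2 :=
        hc.comp_left (g := fun z : ℂ => ‖z‖ ^ 2) (by simp)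
      have := integrable_test_smul hV (hF.continuous.norm.pow 2) h1
      refine this.congr (.of_forall fun x => ?_)
      simp [mul_comm]⟩

/-- There are normalized test functions. -/
lemma exists_normalized_test (d : ℕ) : ∃ F : Space d → ℂ, ContDiff ℝ ∞ F ∧ HasCompactSupport F ∧
    ∫ x, ‖F x‖ ^ 2 = 1 := by
  let b : ContDiffBump (0 : Space d) := ⟨1, 2, one_pos, one_lt_two⟩
  let F₀ : Space d → ℂ := fun x => ((b x : ℝ) : ℂ)
  have hd : ContDiff ℝ ∞ F₀ := Complex.ofRealCLM.contDiff.comp b.contDiff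
  have hc : HasCompactSupport F₀ := b.hasCompactSupport.comp_left (g := fun r : ℝ => (r : ℂ)) rfl
  have hpos : 0 < ∫ x, ‖F₀ x‖ ^ 2 := by
    have h1 : HasCompactSupport fun x => ‖F₀ x‖ ^ 2 :=
      hc.comp_left (g := fun z : ℂ => ‖z‖ ^ 2) (by simp)
    refine (hd.continuous.norm.pow 2).integral_pos_of_hasCompactSupport_nonneg_nonzero h1
      (fun x => by positivity) (x := 0) ?_
    have : b 0 = 1 := b.one_of_mem_closedBall (by simp [b])
    simp [F₀, this]
  refine ⟨fun x => (((√(∫ x, ‖F₀ x‖ ^ 2))⁻¹ : ℝ) : ℂ) * F₀ x, contDiff_const.mul hd,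
    hc.mul_left, ?_⟩
  simp only [norm_mul, mul_pow, integral_const_mul, Complex.norm_real, norm_inv, inv_pow,
    Real.norm_eq_abs, sq_abs]
  rw [Real.sq_sqrt hpos.le, inv_mul_cancel₀ hpos.ne']

lemma exists_admissible (P : GPData d) (hVu : LocallyIntegrable P.Vu volume) :
    ∃ u v, P.Admissible u v := by
  obtain ⟨F, hF, hc, h1⟩ := exists_normalized_test d
  exact ⟨F, 0, GPData.Admissible.of_finiteEnergy (.of_test hVu (hF.of_le (by simp)) hc)
    (.zero P.Vd) (by simp [h1])⟩

/-- `C_b` is positive. -/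
lemma bestConst_pos : 0 < bestConst := by
  obtain ⟨C, hC, hGN⟩ := gagliardoNirenberg (d := 2) (by simp)
  obtain ⟨F, hF, hc, h1⟩ := exists_normalized_test 2
  have hFE := FiniteEnergy.of_test (V := fun _ => (0 : ℝ)) (locallyIntegrable_const _)
    (hF.of_le (by simp) : ContDiff ℝ 1 F) hc
  have hne : {r : ℝ | ∃ f : Space 2 → ℂ, MemH1 f ∧ ¬ (f =ᵐ[volume] 0) ∧
    r = (∫ x, ‖weakGrad f x‖ ^ 2) * (∫ x, ‖f x‖ ^ 2) / ∫ x, ‖f x‖ ^ 4}.Nonempty := by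
    refine ⟨_, F, hFE.memH1, fun h0 => ?_, rfl⟩
    have : ∫ x, ‖F x‖ ^ 2 = 0 := by
      rw [integral_congr_ae (h0.mono fun x hx => by rw [hx])]; simp
    linarith
  -- The reciprocal of any admissible Gagliardo-Nirenberg constant is a lower bound. Nonemptiness
  -- matters, as the infimum of the empty set of reals is 0 by convention.
  refine lt_of_lt_of_le (inv_pos.2 hC) (le_csInf hne ?_)
  rintro r ⟨f, hf, hf0, rfl⟩
  obtain ⟨hw1, hw2⟩ := hf.2.weakGrad_spec
  obtain ⟨h4, hle⟩ := hGN f _ hf.1 hw1 hw2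
  have hpos : 0 < ∫ x, ‖f x‖ ^ 4 := by
    refine (integral_nonneg fun x => by positivity).lt_of_ne fun h => hf0 ?_
    have := (integral_eq_zero_iff_of_nonneg (fun x => by positivity)
      (integrable_norm_four h4)).1 h.symm
    filter_upwards [this] with x hx
    simpa using hx
  have n1 : 0 ≤ ∫ x, ‖f x‖ ^ 2 := integral_nonneg fun x => by positivity
  have n2 : 0 ≤ ∫ x, ‖weakGrad f x‖ ^ 2 := integral_nonneg fun x => by positivity
  rw [show 4 - 2 = 2 from rfl, Real.sq_sqrt n1, Real.sq_sqrt n2] at hle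
  rw [le_div_iff₀ hpos, inv_mul_le_iff₀ hC]
  linarith

/-- The Gagliardo-Nirenberg inequality with the best constant. -/
lemma bestConst_mul_le {f : Space 2 → ℂ} {g : Space 2 → EuclideanSpace ℂ (Fin 2)}
    (hf : MemLp f 2 volume) (hg : MemLp g 2 volume) (hfg : IsWeakGrad f g) :
    bestConst * ∫ x, ‖f x‖ ^ 4 ≤ (∫ x, ‖g x‖ ^ 2) * ∫ x, ‖f x‖ ^ 2 := by
  obtain ⟨C, hC, hGN⟩ := gagliardoNirenberg (d := 2) (by simp)
  obtain ⟨h4, -⟩ := hGN f g hf hg hfg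
  have n1 : 0 ≤ ∫ x, ‖f x‖ ^ 2 := integral_nonneg fun x => by positivity
  have n2 : 0 ≤ ∫ x, ‖g x‖ ^ 2 := integral_nonneg fun x => by positivity
  by_cases hf0 : f =ᵐ[volume] 0
  · have : ∫ x, ‖f x‖ ^ 4 = 0 := by
      rw [integral_congr_ae (hf0.mono fun x hx => by rw [hx])]; simp
    rw [this, mul_zero]
    positivity
  · have hpos : 0 < ∫ x, ‖f x‖ ^ 4 := by
      refine (integral_nonneg fun x => by positivity).lt_of_ne fun h => hf0 ?_
      have := (integral_eq_zero_iff_of_nonneg (fun x => by positivity)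
        (integrable_norm_four h4)).1 h.symm
      filter_upwards [this] with x hx
      simpa using hx
    rw [← le_div_iff₀ hpos]
    refine csInf_le ⟨0, ?_⟩ ⟨f, ⟨hf, g, hg, hfg⟩, hf0, ?_⟩
    · rintro r ⟨f, -, -, rfl⟩
      exact div_nonneg (mul_nonneg (integral_nonneg fun x => by positivity)
        (integral_nonneg fun x => by positivity)) (integral_nonneg fun x => by positivity)
    · rw [integral_norm_weakGrad_sq hg hfg]

end

/-! ### Convergence of the energy terms and compactness of bounded sequences -/

section

variable {d : ℕ}

/-- The product is a continuous bilinear map from Lᵖ × Lᵖ to Lʳ. It is used for (p, r) = (2, 1) and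
(4, 2). -/
lemma tendsto_eLpNorm_mul {𝕜 : Type*} [NormedField 𝕜] {p r : ℝ≥0∞} [ENNReal.HolderTriple p p r]
    (hr : 1 ≤ r) (hp : 1 ≤ p) {a b : ℕ → Space d → 𝕜} {a' b' : Space d → 𝕜}
    (ha : ∀ n, MemLp (a n) p volume) (hb : ∀ n, MemLp (b n) p volume)
    (ha' : MemLp a' p volume) (hb' : MemLp b' p volume)
    (hal : Tendsto (fun n => eLpNorm (a n - a') p volume) atTop (𝓝 0))
    (hbl : Tendsto (fun n => eLpNorm (b n - b') p volume) atTop (𝓝 0)) :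
    Tendsto (fun n => eLpNorm ((fun x => a n x * b n x) - fun x => a' x * b' x) r volume) atTop
      (𝓝 0) := by
  have hle : ∀ n, eLpNorm ((fun x => a n x * b n x) - fun x => a' x * b' x) r volume
      ≤ eLpNorm (a n - a') p volume * (eLpNorm b' p volume + eLpNorm (b n - b') p volume)
        + eLpNorm a' p volume * eLpNorm (b n - b') p volume := by
    intro n
    have e : ((fun x => a n x * b n x) - fun x => a' x * b' x)
        = (a n - a') • b n + a' • (b n - b') := by
      ext x; simp only [Pi.sub_apply, Pi.add_apply, Pi.mul_apply, smul_eq_mul]; ring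
    have hbn : eLpNorm (b n) p volume ≤ eLpNorm b' p volume + eLpNorm (b n - b') p volume := by
      have : b n = b' + (b n - b') := by simp
      conv_lhs => rw [this]
      exact eLpNorm_add_le hb'.1 ((hb n).sub hb').1 hp
    rw [e]
    refine (eLpNorm_add_le (((ha n).sub ha').1.smul (hb n).1)
      (ha'.1.smul ((hb n).sub hb').1) hr).trans ?_
    refine add_le_add ((eLpNorm_smul_le_mul_eLpNorm (p := p) (q := p) (r := r) (hb n).1 ((ha n).sub ha').1).trans ?_)
      (eLpNorm_smul_le_mul_eLpNorm (p := p) (q := p) (r := r) ((hb n).sub hb').1 ha'.1)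
    gcongr
  refine tendsto_of_tendsto_of_tendsto_of_le_of_le tendsto_const_nhds ?_ (fun _ => zero_le) hle
  have h1 := ENNReal.Tendsto.mul hal (Or.inr (by simpa using hb'.eLpNorm_ne_top))
    (tendsto_const_nhds (x := eLpNorm b' p volume) |>.add hbl) (Or.inr (by simp))
  have h2 := ENNReal.Tendsto.const_mul hbl (a := eLpNorm a' p volume)
    (Or.inr ha'.eLpNorm_ne_top)
  simpa using h1.add h2

lemma tendsto_eLpNorm_norm {E : Type*} [NormedAddCommGroup E] {p : ℝ≥0∞} {F : ℕ → Space d → E}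
    {f : Space d → E}
    (h : Tendsto (fun n => eLpNorm (F n - f) p volume) atTop (𝓝 0)) :
    Tendsto (fun n => eLpNorm ((fun x => ‖F n x‖) - fun x => ‖f x‖) p volume) atTop (𝓝 0) :=
  tendsto_of_tendsto_of_tendsto_of_le_of_le tendsto_const_nhds h (fun _ => zero_le) fun n =>
    eLpNorm_mono fun x => by simpa using abs_norm_sub_norm_le (F n x) (f x)

lemma holderTriple_four : ENNReal.HolderTriple 4 4 2 := ⟨by
  rw [← two_mul, show (4 : ℝ≥0∞) = 2 * 2 by norm_num,
    ENNReal.mul_inv (Or.inl two_ne_zero) (Or.inl (by simp)), ← mul_assoc,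
    ENNReal.mul_inv_cancel two_ne_zero (by simp), one_mul]⟩

lemma tendsto_integral_norm_sq {E : Type*} [NormedAddCommGroup E] {F : ℕ → Space d → E}
    {f : Space d → E}
    (hF : ∀ n, MemLp (F n) 2 volume) (hf : MemLp f 2 volume)
    (h : Tendsto (fun n => eLpNorm (F n - f) 2 volume) atTop (𝓝 0)) :
    Tendsto (fun n => ∫ x, ‖F n x‖ ^ 2) atTop (𝓝 (∫ x, ‖f x‖ ^ 2)) := by
  have h1 := tendsto_eLpNorm_mul (r := 1) le_rfl (by norm_num) (fun n => (hF n).norm)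
    (fun n => (hF n).norm) hf.norm hf.norm (tendsto_eLpNorm_norm h) (tendsto_eLpNorm_norm h)
  simp only [← sq] at h1
  exact tendsto_integral_of_L1' _ (integrable_norm_sq hf).1
    (.of_forall fun n => integrable_norm_sq (hF n)) h1

lemma tendsto_integral_re_mul_conj {F H : ℕ → Space d → ℂ} {f h : Space d → ℂ}
    (hF : ∀ n, MemLp (F n) 2 volume) (hf : MemLp f 2 volume)
    (hH : ∀ n, MemLp (H n) 2 volume) (hh : MemLp h 2 volume)
    (hFl : Tendsto (fun n => eLpNorm (F n - f) 2 volume) atTop (𝓝 0))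
    (hHl : Tendsto (fun n => eLpNorm (H n - h) 2 volume) atTop (𝓝 0)) :
    Tendsto (fun n => ∫ x, (F n x * conj (H n x)).re) atTop (𝓝 (∫ x, (f x * conj (h x)).re)) := by
  have hm : ∀ k : Space d → ℂ, MemLp k 2 volume → MemLp (fun x => conj (k x)) 2 volume :=
    fun k hk => hk.star
  have hl : Tendsto (fun n => eLpNorm ((fun x => conj (H n x)) - fun x => conj (h x)) 2 volume)
      atTop (𝓝 0) := by
    refine hHl.congr fun n => (eLpNorm_congr_norm_ae (.of_forall fun x => ?_)).symm
    simp only [Pi.sub_apply]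
    rw [← map_sub, RCLike.norm_conj]
  have h1 := tendsto_eLpNorm_mul (r := 1) le_rfl (by norm_num) hF (fun n => hm _ (hH n)) hf
    (hm _ hh) hFl hl
  have hint : ∀ a b : Space d → ℂ, MemLp a 2 volume → MemLp b 2 volume →
      Integrable (fun x => a x * conj (b x)) volume := fun a b ha hb =>
    ha.integrable_mul (hm b hb)
  have h2 := tendsto_integral_of_L1' _ (hint _ _ hf hh).1
    (.of_forall fun n => hint _ _ (hF n) (hH n)) h1
  have h3 := (Complex.continuous_re.tendsto _).comp h2
  have e : ∀ a b : Space d → ℂ, MemLp a 2 volume → MemLp b 2 volume →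
      (∫ x, a x * conj (b x)).re = ∫ x, (a x * conj (b x)).re := fun a b ha hb =>
    (integral_re (hint a b ha hb)).symm
  rw [e _ _ hf hh] at h3
  exact h3.congr fun n => e _ _ (hF n) (hH n)

/-- Hölder twice: L⁴ convergence of the functions gives L² convergence of the densities and L¹
convergence of their product. -/
lemma tendsto_integral_sq_mul_sq {F H : ℕ → Space d → ℂ} {f h : Space d → ℂ}
    (hF : ∀ n, MemLp (F n) 4 volume) (hf : MemLp f 4 volume)
    (hH : ∀ n, MemLp (H n) 4 volume) (hh : MemLp h 4 volume)
    (hFl : Tendsto (fun n => eLpNorm (F n - f) 4 volume) atTop (𝓝 0))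
    (hHl : Tendsto (fun n => eLpNorm (H n - h) 4 volume) atTop (𝓝 0)) :
    Tendsto (fun n => ∫ x, ‖F n x‖ ^ 2 * ‖H n x‖ ^ 2) atTop
      (𝓝 (∫ x, ‖f x‖ ^ 2 * ‖h x‖ ^ 2)) := by
  have := holderTriple_four
  have hm : ∀ k : Space d → ℂ, MemLp k 4 volume → MemLp (fun x => ‖k x‖ ^ 2) 2 volume :=
    fun k hk => by
      have := hk.norm.mul (p := 4) (q := 4) (r := 2) hk.norm
      refine this.ae_eq (.of_forall fun x => ?_)
      simp [sq]
  have l : ∀ (K : ℕ → Space d → ℂ) (k : Space d → ℂ), (∀ n, MemLp (K n) 4 volume) →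
      MemLp k 4 volume → Tendsto (fun n => eLpNorm (K n - k) 4 volume) atTop (𝓝 0) →
      Tendsto (fun n => eLpNorm ((fun x => ‖K n x‖ ^ 2) - fun x => ‖k x‖ ^ 2) 2 volume) atTop
        (𝓝 0) := fun K k hK hk hl => by
    have h1 := tendsto_eLpNorm_mul (p := 4) (r := 2) (by norm_num) (by norm_num)
      (fun n => (hK n).norm) (fun n => (hK n).norm) hk.norm hk.norm (tendsto_eLpNorm_norm hl)
      (tendsto_eLpNorm_norm hl)
    simpa only [← sq] using h1
  have h1 := tendsto_eLpNorm_mul (r := 1) le_rfl (by norm_num) (fun n => hm _ (hF n))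
    (fun n => hm _ (hH n)) (hm _ hf) (hm _ hh) (l _ _ hF hf hFl) (l _ _ hH hh hHl)
  exact tendsto_integral_of_L1' _ ((hm _ hf).integrable_mul (hm _ hh)).1
    (.of_forall fun n => (hm _ (hF n)).integrable_mul (hm _ (hH n))) h1

lemma IsWeakGrad.sub {f₁ f₂ : Space d → ℂ} {g₁ g₂ : Space d → EuclideanSpace ℂ (Fin d)}
    (h₁ : IsWeakGrad f₁ g₁) (h₂ : IsWeakGrad f₂ g₂)
    (hf₁ : LocallyIntegrable f₁ volume) (hf₂ : LocallyIntegrable f₂ volume)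
    (hg₁ : LocallyIntegrable g₁ volume) (hg₂ : LocallyIntegrable g₂ volume) :
    IsWeakGrad (f₁ - f₂) (g₁ - g₂) := by
  have h := h₁.add (h₂.const_mul (-1)) hf₁ ?_ hg₁ ?_
  · refine h.congr (.of_forall fun x => ?_) (.of_forall fun x => ?_)
    · simp [sub_eq_add_neg]
    · simp [sub_eq_add_neg]
  · simp only [neg_mul, one_mul]; exact hf₂.neg
  · simp only [neg_smul, one_smul]; exact hg₂.neg

/-- `L²` convergence with bounded gradients implies `L⁴` convergence. -/
lemma tendsto_eLpNorm_four (hd : d = 1 ∨ d = 2 ∨ d = 3) {F : ℕ → Space d → ℂ} {f : Space d → ℂ}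
    {G : ℕ → Space d → EuclideanSpace ℂ (Fin d)} {g : Space d → EuclideanSpace ℂ (Fin d)}
    (hF : ∀ n, MemLp (F n) 2 volume) (hf : MemLp f 2 volume)
    (hG : ∀ n, MemLp (G n) 2 volume) (hg : MemLp g 2 volume)
    (hFG : ∀ n, IsWeakGrad (F n) (G n)) (hfg : IsWeakGrad f g) {M : ℝ}
    (hGM : ∀ n, ∫ x, ‖G n x‖ ^ 2 ≤ M)
    (h : Tendsto (fun n => eLpNorm (F n - f) 2 volume) atTop (𝓝 0)) :
    Tendsto (fun n => eLpNorm (F n - f) 4 volume) atTop (𝓝 0) := by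
  obtain ⟨C, hC, hGN⟩ := gagliardoNirenberg hd
  have hs : ∀ n, IsWeakGrad (F n - f) (G n - g) := fun n =>
    (hFG n).sub hfg (locInt (hF n)) (locInt hf) (locInt (hG n)) (locInt hg)
  have hb : ∀ n, √(∫ x, ‖(G n - g) x‖ ^ 2) ≤ √M + √(∫ x, ‖g x‖ ^ 2) := by
    intro n
    have e := eLpNorm_sub_le (hG n).1 hg.1 (p := 2) (by norm_num)
    rw [eLpNorm_two_eq_ofReal_sqrt ((hG n).sub hg), eLpNorm_two_eq_ofReal_sqrt (hG n),
      eLpNorm_two_eq_ofReal_sqrt hg, ← ENNReal.ofReal_add (Real.sqrt_nonneg _) (Real.sqrt_nonneg _),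
      ENNReal.ofReal_le_ofReal_iff (by positivity)] at e
    exact e.trans (by gcongr; exact hGM n)
  have ha : Tendsto (fun n => √(∫ x, ‖(F n - f) x‖ ^ 2)) atTop (𝓝 0) := by
    have h2 := (ENNReal.tendsto_toReal (by simp : (0 : ℝ≥0∞) ≠ ⊤)).comp h
    refine h2.congr fun n => ?_
    simp only [Function.comp_apply]
    rw [eLpNorm_two_eq_ofReal_sqrt ((hF n).sub hf), ENNReal.toReal_ofReal (Real.sqrt_nonneg _)]
  have h4 : Tendsto (fun n => ∫ x, ‖(F n - f) x‖ ^ 4) atTop (𝓝 0) := by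
    -- The L² norm enters with the positive power 4 - d, and this is what forces convergence to
    -- zero.
    have hd4 : 4 - d ≠ 0 := by omega
    have hup : Tendsto (fun n => C * (√(∫ x, ‖(F n - f) x‖ ^ 2) ^ (4 - d)
        * (√M + √(∫ x, ‖g x‖ ^ 2)) ^ d)) atTop (𝓝 0) := by
      have := ((ha.pow (4 - d)).mul_const ((√M + √(∫ x, ‖g x‖ ^ 2)) ^ d)).const_mul C
      simpa [hd4] using this
    refine squeeze_zero (fun n => integral_nonneg fun x => by positivity) (fun n => ?_) hup
    refine (hGN _ _ ((hF n).sub hf) ((hG n).sub hg) (hs n)).2.trans ?_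
    gcongr
    exact hb n
  have h5 := ENNReal.tendsto_ofReal h4
  have h6 : ∀ n, ENNReal.ofReal (∫ x, ‖(F n - f) x‖ ^ 4)
      = (eLpNorm (F n - f) 4 volume ^ 2) ^ 2 := fun n => by
    rw [ofReal_integral_norm_pow (integrable_norm_four
      (hGN _ _ ((hF n).sub hf) ((hG n).sub hg) (hs n)).1), ← eLpNorm_four_pow, ← pow_mul]
  simp only [h6, ENNReal.ofReal_zero] at h5
  exact tendsto_zero_of_sq (tendsto_zero_of_sq h5)

lemma exists_tendsto_subseq_of_bounded {a : ℕ → ℝ} {M : ℝ} (h0 : ∀ n, 0 ≤ a n)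
    (hM : ∀ n, a n ≤ M) : ∃ (K : ℝ) (φ : ℕ → ℕ), StrictMono φ ∧
      Tendsto (fun n => a (φ n)) atTop (𝓝 K) := by
  obtain ⟨K, -, φ, hφ, h⟩ := (isCompact_Icc (a := (0 : ℝ)) (b := M)).tendsto_subseq
    (fun n => ⟨h0 n, hM n⟩)
  exact ⟨K, φ, hφ, h⟩

/-- `F` converges to `f` strongly in `L²` and `L⁴`, with the kinetic and potential energies of `f`
at most the limits `K` and `L` of those of `F`. -/
structure FormTendsto (V : Space d → ℝ) (F : ℕ → Space d → ℂ)
    (G : ℕ → Space d → EuclideanSpace ℂ (Fin d)) (f : Space d → ℂ)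
    (g : Space d → EuclideanSpace ℂ (Fin d)) (K L : ℝ) : Prop where
  finiteEnergy : FiniteEnergy V f g
  two : Tendsto (fun n => eLpNorm (F n - f) 2 volume) atTop (𝓝 0)
  four : Tendsto (fun n => eLpNorm (F n - f) 4 volume) atTop (𝓝 0)
  kinetic : Tendsto (fun n => ∫ x, ‖G n x‖ ^ 2) atTop (𝓝 K)
  potential : Tendsto (fun n => ∫ x, V x * ‖F n x‖ ^ 2) atTop (𝓝 L)
  kinetic_le : ∫ x, ‖g x‖ ^ 2 ≤ K
  potential_le : ∫ x, V x * ‖f x‖ ^ 2 ≤ L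

lemma FormTendsto.comp {V : Space d → ℝ} {F : ℕ → Space d → ℂ}
    {G : ℕ → Space d → EuclideanSpace ℂ (Fin d)} {f : Space d → ℂ}
    {g : Space d → EuclideanSpace ℂ (Fin d)} {K L : ℝ} (h : FormTendsto V F G f g K L)
    {φ : ℕ → ℕ} (hφ : StrictMono φ) :
    FormTendsto V (fun n => F (φ n)) (fun n => G (φ n)) f g K L :=
  ⟨h.finiteEnergy, h.two.comp hφ.tendsto_atTop, h.four.comp hφ.tendsto_atTop,
    h.kinetic.comp hφ.tendsto_atTop, h.potential.comp hφ.tendsto_atTop, h.kinetic_le,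
    h.potential_le⟩

/-- Fatou's lemma, as V ≥ 0. Finiteness of the potential energy of the limit is obtained at the same
time. -/
lemma fatou_potential {V : Space d → ℝ} (hV0 : ∀ x, 0 ≤ V x)
    (hVm : AEStronglyMeasurable V volume) {F : ℕ → Space d → ℂ}
    {f : Space d → ℂ} (hf : AEStronglyMeasurable f volume)
    (hFm : ∀ n, AEStronglyMeasurable (F n) volume)
    (hF : ∀ n, Integrable (fun x => V x * ‖F n x‖ ^ 2) volume)
    (hae : ∀ᵐ x, Tendsto (fun n => F n x) atTop (𝓝 (f x))) {L : ℝ}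
    (hL : Tendsto (fun n => ∫ x, V x * ‖F n x‖ ^ 2) atTop (𝓝 L)) :
    Integrable (fun x => V x * ‖f x‖ ^ 2) volume ∧ ∫ x, V x * ‖f x‖ ^ 2 ≤ L := by
  have hn : ∀ (k : Space d → ℂ) x, 0 ≤ V x * ‖k x‖ ^ 2 := fun k x => by have := hV0 x; positivity
  have key : ∫⁻ x, ENNReal.ofReal (V x * ‖f x‖ ^ 2) ≤ ENNReal.ofReal L := by
    calc ∫⁻ x, ENNReal.ofReal (V x * ‖f x‖ ^ 2)
        = ∫⁻ x, liminf (fun n => ENNReal.ofReal (V x * ‖F n x‖ ^ 2)) atTop := by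
          refine lintegral_congr_ae ?_
          filter_upwards [hae] with x hx
          exact (ENNReal.tendsto_ofReal ((hx.norm.pow 2).const_mul (V x))).liminf_eq.symm
      _ ≤ liminf (fun n => ∫⁻ x, ENNReal.ofReal (V x * ‖F n x‖ ^ 2)) atTop :=
          lintegral_liminf_le' fun n =>
            (hVm.mul ((hFm n).norm.pow 2)).aemeasurable.ennreal_ofReal
      _ = liminf (fun n => ENNReal.ofReal (∫ x, V x * ‖F n x‖ ^ 2)) atTop := by
          congr 1
          ext n
          rw [ofReal_integral_eq_lintegral_ofReal (hF n) (.of_forall (hn (F n)))]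
      _ = ENNReal.ofReal L := (ENNReal.tendsto_ofReal hL).liminf_eq
  have hL0 : 0 ≤ L := ge_of_tendsto' hL fun n => integral_nonneg (hn (F n))
  have hi : Integrable (fun x => V x * ‖f x‖ ^ 2) volume := by
    refine ⟨hVm.mul (hf.norm.pow 2), ?_⟩
    rw [hasFiniteIntegral_iff_ofReal (.of_forall (hn f))]
    exact key.trans_lt ENNReal.ofReal_lt_top
  refine ⟨hi, ?_⟩
  rwa [← ofReal_integral_eq_lintegral_ofReal hi (.of_forall (hn f)),
    ENNReal.ofReal_le_ofReal_iff hL0] at key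

/-- Compactness of energy-bounded sequences. -/
lemma exists_formTendsto_subseq (hd : d = 1 ∨ d = 2 ∨ d = 3) {V : Space d → ℝ}
    (hV0 : ∀ x, 0 ≤ V x) (hVm : AEStronglyMeasurable V volume)
    (hV : Tendsto V (cocompact (Space d)) atTop) {F : ℕ → Space d → ℂ}
    {G : ℕ → Space d → EuclideanSpace ℂ (Fin d)} (h : ∀ n, FiniteEnergy V (F n) (G n)) {M : ℝ}
    (hFM : ∀ n, ∫ x, ‖F n x‖ ^ 2 ≤ M) (hGM : ∀ n, ∫ x, ‖G n x‖ ^ 2 ≤ M)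
    (hVM : ∀ n, ∫ x, V x * ‖F n x‖ ^ 2 ≤ M) :
    ∃ (φ : ℕ → ℕ) (f : Space d → ℂ) (g : Space d → EuclideanSpace ℂ (Fin d)) (K L : ℝ),
      StrictMono φ ∧ FormTendsto V (fun n => F (φ n)) (fun n => G (φ n)) f g K L := by
  -- Five extractions: weak limit of the functions, weak limit of the gradients, almost everywhere
  -- convergence, and limits of the kinetic and of the potential energies.
  obtain ⟨f, φ₁, hφ₁, hf, hw₁⟩ := exists_weakTendsto_subseq (fun n => (h n).memLp) hFM
  obtain ⟨g, φ₂, hφ₂, hg, hw₂⟩ := exists_weakTendsto_subseq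
    (fun n => (h (φ₁ n)).memLp_grad) (fun n => hGM (φ₁ n))
  have hw₁' : WeakTendsto (fun n => F (φ₁ (φ₂ n))) f := fun k hk =>
    (hw₁ k hk).comp hφ₂.tendsto_atTop
  have hfg : IsWeakGrad f g := hw₁'.isWeakGrad hw₂ fun n => (h _).isWeakGrad
  have hstrong := hw₁'.tendsto_eLpNorm (fun n => (h _).memLp) hf (fun n => (h _).memLp_grad) hg
    (fun n => (h _).isWeakGrad) hfg (fun n => hFM _) (fun n => hGM _) hV0 hV
    (fun n => (h _).integrable_V) (fun n => hVM _)
  obtain ⟨φ₃, hφ₃, hae⟩ := (tendstoInMeasure_of_tendsto_eLpNorm two_ne_zero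
    (fun n => (h (φ₁ (φ₂ n))).memLp.1) hf.1 hstrong).exists_seq_tendsto_ae
  obtain ⟨K, φ₄, hφ₄, hK⟩ := exists_tendsto_subseq_of_bounded
    (a := fun n => ∫ x, ‖G (φ₁ (φ₂ (φ₃ n))) x‖ ^ 2) (fun n => integral_nonneg fun x => by positivity)
    (fun n => hGM _)
  obtain ⟨L, φ₅, hφ₅, hL⟩ := exists_tendsto_subseq_of_bounded
    (a := fun n => ∫ x, V x * ‖F (φ₁ (φ₂ (φ₃ (φ₄ n)))) x‖ ^ 2)
    (fun n => integral_nonneg fun x => mul_nonneg (hV0 x) (by positivity)) (fun n => hVM _)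
  have hK' := hK.comp hφ₅.tendsto_atTop
  have hφ₃₅ : StrictMono fun n => φ₃ (φ₄ (φ₅ n)) := hφ₃.comp (hφ₄.comp hφ₅)
  have hstrong' := hstrong.comp hφ₃₅.tendsto_atTop
  obtain ⟨hVi, hVL⟩ := fatou_potential hV0 hVm hf.1
    (F := fun n => F (φ₁ (φ₂ (φ₃ (φ₄ (φ₅ n)))))) (fun n => (h _).memLp.1)
    (fun n => (h _).integrable_V) (hae.mono fun x hx => hx.comp (hφ₄.comp hφ₅).tendsto_atTop) hL
  obtain ⟨C, hC, hGN⟩ := gagliardoNirenberg hd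
  refine ⟨fun n => φ₁ (φ₂ (φ₃ (φ₄ (φ₅ n)))), f, g, K, L,
    hφ₁.comp (hφ₂.comp (hφ₃.comp (hφ₄.comp hφ₅))),
    ⟨hf, hg, hfg, (hGN f g hf hg hfg).1, hVi⟩, hstrong', ?_, hK', hL, ?_, hVL⟩
  · exact tendsto_eLpNorm_four hd (fun n => (h _).memLp) hf (fun n => (h _).memLp_grad) hg
      (fun n => (h _).isWeakGrad) hfg (fun n => hGM _) hstrong'
  · exact WeakTendsto.integral_norm_sq_le (fun k hk => (hw₂ k hk).comp hφ₃₅.tendsto_atTop)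
      (fun n => (h _).memLp_grad) hg hK'

end

/-! ### Stability, coercivity and existence -/

section

variable {d : ℕ}

lemma GPData.quadForm_nonneg {P : GPData d} (hB : P.B.PosSemidef) (a b : ℝ) :
    0 ≤ P.βuu * a ^ 2 + 2 * P.βud * (a * b) + P.βdd * b ^ 2 := by
  have h := hB.dotProduct_mulVec_nonneg ![a, b]
  simp only [GPData.B, star_trivial, dotProduct,
    Fin.sum_univ_two, Matrix.cons_val_zero, Matrix.cons_val_one] at h
  simp at h
  linarith

/-- The interaction energy is controlled by a fraction of the kinetic energy. -/
def GPData.Stable (P : GPData d) : Prop :=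
  ∃ θ C : ℝ, 0 ≤ θ ∧ θ < 1 ∧ ∀ (u v : Space d → ℂ) (gu gv : Space d → EuclideanSpace ℂ (Fin d)),
    FiniteEnergy P.Vu u gu → FiniteEnergy P.Vd v gv →
    (∫ x, ‖u x‖ ^ 2) + ∫ x, ‖v x‖ ^ 2 = 1 →
    -(θ / 2 * ((∫ x, ‖gu x‖ ^ 2) + ∫ x, ‖gv x‖ ^ 2)) - C ≤ P.interaction u v

/-- Only nonnegative arguments matter because the densities |u|² and |v|² are nonnegative. This
covers both alternatives for d = 3. -/
lemma stable_of_interaction_nonneg {P : GPData d}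
    (h : ∀ a b : ℝ, 0 ≤ a → 0 ≤ b → 0 ≤ P.βuu * a ^ 2 + 2 * P.βud * (a * b) + P.βdd * b ^ 2) :
    P.Stable := by
  refine ⟨0, 0, le_rfl, one_pos, fun u v gu gv hu hv _ => ?_⟩
  rw [GPData.interaction_eq_integral hu hv]
  simp only [zero_div, zero_mul, neg_zero, sub_zero]
  refine integral_nonneg fun x => ?_
  have := h (‖u x‖ ^ 2) (‖v x‖ ^ 2) (by positivity) (by positivity)
  simp only [Pi.zero_apply]
  nlinarith

/-- For d = 1 the quartic term is bounded by C times the first power of the gradient norm when the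
mass is at most 1, so Young's inequality absorbs it into the kinetic energy. -/
lemma stable_one (P : GPData 1) : P.Stable := by
  obtain ⟨C, hC, hGN⟩ := gagliardoNirenberg (d := 1) (by simp)
  set b := |P.βuu| + |P.βdd| + |P.βud| with hb
  have hb0 : 0 ≤ b := by positivity
  -- Young leaves a quarter of each kinetic energy, that is θ/2 with θ = 1/2, and the constant (bC)²
  -- once per component.
  refine ⟨1 / 2, 2 * (b * C) ^ 2, by norm_num, by norm_num, fun u v gu gv hu hv hm => ?_⟩
  have key : ∀ (w : Space 1 → ℂ) (g : Space 1 → EuclideanSpace ℂ (Fin 1)), MemLp w 2 volume →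
      MemLp g 2 volume → IsWeakGrad w g → ∫ x, ‖w x‖ ^ 2 ≤ 1 →
      b * ∫ x, ‖w x‖ ^ 4 ≤ 1 / 4 * (∫ x, ‖g x‖ ^ 2) + (b * C) ^ 2 := by
    intro w g hw hg hwg hw1
    have h := (hGN w g hw hg hwg).2
    have h0 : 0 ≤ ∫ x, ‖g x‖ ^ 2 := integral_nonneg fun x => by positivity
    have h1 : √(∫ x, ‖w x‖ ^ 2) ≤ 1 := Real.sqrt_le_one.2 hw1
    have h2 : ∫ x, ‖w x‖ ^ 4 ≤ C * √(∫ x, ‖g x‖ ^ 2) := by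
      refine h.trans ?_
      gcongr
      rw [pow_one]
      exact mul_le_of_le_one_left (Real.sqrt_nonneg _) (pow_le_one₀ (Real.sqrt_nonneg _) h1)
    calc b * ∫ x, ‖w x‖ ^ 4 ≤ b * (C * √(∫ x, ‖g x‖ ^ 2)) := by gcongr
      _ ≤ 1 / 4 * (∫ x, ‖g x‖ ^ 2) + (b * C) ^ 2 := by
        nlinarith [sq_nonneg (1 / 2 * √(∫ x, ‖g x‖ ^ 2) - b * C), Real.sq_sqrt h0]
  have nu : 0 ≤ ∫ x, ‖u x‖ ^ 2 := integral_nonneg fun x => by positivity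
  have nv : 0 ≤ ∫ x, ‖v x‖ ^ 2 := integral_nonneg fun x => by positivity
  have ku := key u gu hu.memLp hu.memLp_grad hu.isWeakGrad (by linarith)
  have kv := key v gv hv.memLp hv.memLp_grad hv.isWeakGrad (by linarith)
  have hlow : -(b * ((∫ x, ‖u x‖ ^ 4) + ∫ x, ‖v x‖ ^ 4)) ≤ P.interaction u v := by
    rw [GPData.interaction_eq_integral hu hv, ← integral_add hu.integrable_four hv.integrable_four,
      ← integral_const_mul, ← integral_neg]
    refine integral_mono ((hu.integrable_four.fun_add hv.integrable_four).const_mul b).fun_neg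
      (((hu.integrable_four.const_mul _).fun_add (hv.integrable_four.const_mul _)).fun_add
        ((hu.integrable_sq_mul_sq hv).const_mul _)) fun x => ?_
    have a1 := neg_abs_le P.βuu
    have a2 := neg_abs_le P.βdd
    have a3 := neg_abs_le P.βud
    have p1 := abs_nonneg P.βuu
    have p2 := abs_nonneg P.βdd
    have p3 := abs_nonneg P.βud
    have q1 : 0 ≤ ‖u x‖ ^ 4 := by positivity
    have q2 : 0 ≤ ‖v x‖ ^ 4 := by positivity
    have q3 : 0 ≤ ‖u x‖ ^ 2 * ‖v x‖ ^ 2 := by positivity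
    have q4 : ‖u x‖ ^ 2 * ‖v x‖ ^ 2 ≤ ‖u x‖ ^ 4 + ‖v x‖ ^ 4 := by
      nlinarith [sq_nonneg (‖u x‖ ^ 2 - ‖v x‖ ^ 2)]
    have r1 : -(|P.βuu| * ‖u x‖ ^ 4) ≤ 1 / 2 * P.βuu * ‖u x‖ ^ 4 := by nlinarith
    have r2 : -(|P.βdd| * ‖v x‖ ^ 4) ≤ 1 / 2 * P.βdd * ‖v x‖ ^ 4 := by nlinarith
    have r3 : -(|P.βud| * (‖u x‖ ^ 4 + ‖v x‖ ^ 4)) ≤ P.βud * (‖u x‖ ^ 2 * ‖v x‖ ^ 2) := by nlinarith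
    have r4 := mul_nonneg p1 q2
    have r5 := mul_nonneg p2 q1
    simp only [hb]
    linarith
  linarith

/-- The conditions are open in c, so they persist for slightly smaller c'. The quotient c'/c < 1
will be the fraction θ. -/
lemma exists_perturbed_const {c p q r : ℝ} (hc : 0 < c) (hp : -c < p) (hq : -c < q)
    (hr : -c - √(c + p) * √(c + q) < r) :
    ∃ c', 0 < c' ∧ c' < c ∧ 0 < c' + p ∧ 0 < c' + q ∧ -c' - √(c' + p) * √(c' + q) < r := by
  have hcont : Continuous fun t : ℝ => r + t + √(t + p) * √(t + q) := by fun_prop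
  have h1 : ∀ᶠ t in 𝓝[<] c, 0 < r + t + √(t + p) * √(t + q) :=
    (hcont.tendsto c).mono_left nhdsWithin_le_nhds |>.eventually (lt_mem_nhds (by linarith))
  have h2 : ∀ᶠ t in 𝓝[<] c, 0 < t := nhdsWithin_le_nhds (lt_mem_nhds hc)
  have h3 : ∀ᶠ t in 𝓝[<] c, -p < t := nhdsWithin_le_nhds (lt_mem_nhds (by linarith))
  have h4 : ∀ᶠ t in 𝓝[<] c, -q < t := nhdsWithin_le_nhds (lt_mem_nhds (by linarith))
  obtain ⟨t, h1, h2, h3, h4, h5⟩ :=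
    (h1.and (h2.and (h3.and (h4.and self_mem_nhdsWithin)))).exists
  exact ⟨t, h2, h5, by linarith, by linarith, by linarith⟩

/-- The conditions say that the form with entries β + c is nonnegative on the quadrant, so the
interaction is at least -(c/2) ∫ ρ⁴ with ρ the modulus of the pair. The sharp inequality for ρ, of
unit mass, bounds this by c / C_b times half the kinetic energy. -/
lemma stable_two {P : GPData 2} (h1 : -bestConst < P.βuu) (h2 : -bestConst < P.βdd)
    (h3 : -bestConst - √(bestConst + P.βuu) * √(bestConst + P.βdd) < P.βud) : P.Stable := by
  have hcb := bestConst_pos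
  obtain ⟨c, hc0, hc, hp, hq, hr⟩ := exists_perturbed_const hcb h1 h2 h3
  refine ⟨c / bestConst, 0, by positivity, (div_lt_one hcb).2 hc, fun u v gu gv hu hv hm => ?_⟩
  have hw := bestConst_mul_le (memLp_pairAbs hu.memLp hv.memLp)
    (memLp_pairAbsGrad hu.memLp hu.memLp_grad hv.memLp hv.memLp_grad)
    (isWeakGrad_pairAbs hu.memLp hu.memLp_grad hu.isWeakGrad hv.memLp hv.memLp_grad hv.isWeakGrad)
  have e2 : ∫ x, ‖pairAbs u v x‖ ^ 2 = 1 := by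
    simp only [norm_pairAbs_sq]
    rw [integral_add hu.integrable_sq hv.integrable_sq, hm]
  have e4 : ∀ x, ‖pairAbs u v x‖ ^ 4 = ‖u x‖ ^ 4 + ‖v x‖ ^ 4 + 2 * (‖u x‖ ^ 2 * ‖v x‖ ^ 2) := by
    intro x
    have : ‖pairAbs u v x‖ ^ 4 = (‖pairAbs u v x‖ ^ 2) ^ 2 := by ring
    rw [this, norm_pairAbs_sq]; ring
  have hk : ∫ x, ‖pairAbsGrad u v gu gv x‖ ^ 2 ≤ (∫ x, ‖gu x‖ ^ 2) + ∫ x, ‖gv x‖ ^ 2 := by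
    rw [← integral_add hu.integrable_grad_sq hv.integrable_grad_sq]
    exact integral_mono (integrable_norm_sq
      (memLp_pairAbsGrad hu.memLp hu.memLp_grad hv.memLp hv.memLp_grad))
      (hu.integrable_grad_sq.add hv.integrable_grad_sq) (norm_pairAbsGrad_sq_le u v gu gv)
  rw [e2, mul_one] at hw
  have i4 : Integrable (fun x => ‖pairAbs u v x‖ ^ 4) volume :=
    integrable_norm_four (memLp_pairAbs hu.memLp_four hv.memLp_four)
  have hlow : -(c / 2 * ∫ x, ‖pairAbs u v x‖ ^ 4) ≤ P.interaction u v := by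
    rw [GPData.interaction_eq_integral hu hv, ← integral_const_mul, ← integral_neg]
    refine integral_mono (i4.const_mul _).fun_neg
      (((hu.integrable_four.const_mul _).fun_add (hv.integrable_four.const_mul _)).fun_add
        ((hu.integrable_sq_mul_sq hv).const_mul _)) fun x => ?_
    simp only [e4]
    have hP : 0 ≤ ‖u x‖ ^ 2 * ‖v x‖ ^ 2 := by positivity
    have s1 := Real.sq_sqrt hp.le
    have s2 := Real.sq_sqrt hq.le
    -- Completing the square handles the diagonal; the remaining mixed coefficient βud + c + √(c +
    -- βuu) √(c + βdd) is positive by the choice of c.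
    have hsq := sq_nonneg (√(c + P.βuu) * ‖u x‖ ^ 2 - √(c + P.βdd) * ‖v x‖ ^ 2)
    have hexp : (√(c + P.βuu) * ‖u x‖ ^ 2 - √(c + P.βdd) * ‖v x‖ ^ 2) ^ 2
        = (c + P.βuu) * ‖u x‖ ^ 4 + (c + P.βdd) * ‖v x‖ ^ 4
          - 2 * (√(c + P.βuu) * √(c + P.βdd)) * (‖u x‖ ^ 2 * ‖v x‖ ^ 2) := by
      rw [← s1, ← s2]
      simp only [Real.sqrt_sq (Real.sqrt_nonneg _)]
      ring
    have hr' : 0 ≤ (P.βud + c + √(c + P.βuu) * √(c + P.βdd)) * (‖u x‖ ^ 2 * ‖v x‖ ^ 2) :=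
      mul_nonneg (by linarith) hP
    linarith
  have hfin : c / 2 * (∫ x, ‖pairAbs u v x‖ ^ 4)
      ≤ c / bestConst / 2 * ((∫ x, ‖gu x‖ ^ 2) + ∫ x, ‖gv x‖ ^ 2) := by
    have : c / 2 * (∫ x, ‖pairAbs u v x‖ ^ 4)
        = c / bestConst / 2 * (bestConst * ∫ x, ‖pairAbs u v x‖ ^ 4) := by
      field_simp
    rw [this]
    gcongr
    exact hw.trans hk
  linarith

lemma GPData.ExistenceCond.dim {P : GPData d} (h : P.ExistenceCond) : d = 1 ∨ d = 2 ∨ d = 3 := by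
  rcases h with h | h | h
  · exact Or.inl h
  · exact Or.inr (Or.inl h.1)
  · exact Or.inr (Or.inr h.1)

lemma GPData.ExistenceCond.stable {P : GPData d} (h : P.ExistenceCond) : P.Stable := by
  rcases h with rfl | ⟨rfl, h1, h2, h3⟩ | ⟨rfl, h⟩
  · exact stable_one P
  · exact stable_two h1 h2 h3
  · refine stable_of_interaction_nonneg fun a b ha hb => ?_
    rcases h with h | ⟨h1, h2, h3⟩
    · exact GPData.quadForm_nonneg h a b
    · positivity

lemma abs_integral_re_mul_conj_le {V V' : Space d → ℝ} {u v : Space d → ℂ}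
    {gu gv : Space d → EuclideanSpace ℂ (Fin d)} (hu : FiniteEnergy V u gu)
    (hv : FiniteEnergy V' v gv) :
    |∫ x, (u x * conj (v x)).re| ≤ (∫ x, ‖u x‖ ^ 2) + ∫ x, ‖v x‖ ^ 2 := by
  rw [← integral_add hu.integrable_sq hv.integrable_sq]
  refine abs_integral_le_integral_abs.trans (integral_mono (hu.integrable_re_mul_conj hv).abs
    (hu.integrable_sq.add hv.integrable_sq) fun x => ?_)
  refine (Complex.abs_re_le_norm _).trans ?_
  simp only [norm_mul, RCLike.norm_conj]
  nlinarith [sq_nonneg (‖u x‖ - ‖v x‖), sq_nonneg (‖u x‖), sq_nonneg (‖v x‖)]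

/-- Coercivity of the energy. -/
lemma GPData.Stable.coercive {P : GPData d} (h : P.Stable) :
    ∃ c C : ℝ, 0 < c ∧ ∀ (u v : Space d → ℂ) (gu gv : Space d → EuclideanSpace ℂ (Fin d)),
      FiniteEnergy P.Vu u gu → FiniteEnergy P.Vd v gv →
      (∫ x, ‖u x‖ ^ 2) + ∫ x, ‖v x‖ ^ 2 = 1 →
      c * ((∫ x, ‖gu x‖ ^ 2) + ∫ x, ‖gv x‖ ^ 2) + (∫ x, P.Vu x * ‖u x‖ ^ 2)
        + (∫ x, P.Vd x * ‖v x‖ ^ 2) - C ≤ P.energy u v := by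
  obtain ⟨θ, C, h0, h1, hθ⟩ := h
  -- The detuning term is at most |δ|/2 because the masses differ by at most 1, and the coupling
  -- term is at most |Ω| by the unit mass.
  refine ⟨(1 - θ) / 2, C + |P.δ| / 2 + |P.Ω|, by linarith, fun u v gu gv hu hv hm => ?_⟩
  have hI := hθ u v gu gv hu hv hm
  rw [GPData.energy_eq hu hv]
  have nu : 0 ≤ ∫ x, ‖u x‖ ^ 2 := integral_nonneg fun x => by positivity
  have nv : 0 ≤ ∫ x, ‖v x‖ ^ 2 := integral_nonneg fun x => by positivity
  have hδ : -(|P.δ| / 2) ≤ P.δ / 2 * ((∫ x, ‖u x‖ ^ 2) - ∫ x, ‖v x‖ ^ 2) := by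
    have hd : |(∫ x, ‖u x‖ ^ 2) - ∫ x, ‖v x‖ ^ 2| ≤ 1 := abs_le.2 ⟨by linarith, by linarith⟩
    have h5 : |P.δ / 2 * ((∫ x, ‖u x‖ ^ 2) - ∫ x, ‖v x‖ ^ 2)| ≤ |P.δ| / 2 := by
      rw [abs_mul, abs_div, abs_two]
      exact mul_le_of_le_one_right (by positivity) hd
    linarith [(abs_le.1 h5).1]
  have hΩ : -|P.Ω| ≤ P.Ω * ∫ x, (u x * conj (v x)).re := by
    have hr := abs_integral_re_mul_conj_le hu hv
    rw [hm] at hr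
    have h5 : |P.Ω * ∫ x, (u x * conj (v x)).re| ≤ |P.Ω| := by
      rw [abs_mul]
      exact mul_le_of_le_one_right (abs_nonneg _) hr
    exact (abs_le.1 h5).1
  linarith

/-- Existence of ground states. -/
theorem exists_groundState {P : GPData d} (hVu0 : ∀ x, 0 ≤ P.Vu x) (hVd0 : ∀ x, 0 ≤ P.Vd x)
    (hVu : LocallyIntegrable P.Vu volume) (hVd : LocallyIntegrable P.Vd volume)
    (hVuc : Tendsto P.Vu (cocompact (Space d)) atTop)
    (hVdc : Tendsto P.Vd (cocompact (Space d)) atTop) (h : P.ExistenceCond) :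
    ∃ u v, P.IsGroundState u v := by
  have hd := h.dim
  obtain ⟨c, C, hc, hcoer⟩ := h.stable.coercive
  have hpos : ∀ {V : Space d → ℝ}, (∀ x, 0 ≤ V x) → ∀ w : Space d → ℂ,
      0 ≤ ∫ x, V x * ‖w x‖ ^ 2 := fun hV w =>
    integral_nonneg fun x => mul_nonneg (hV x) (by positivity)
  have hsq : ∀ w : Space d → ℂ, 0 ≤ ∫ x, ‖w x‖ ^ 2 := fun w =>
    integral_nonneg fun x => by positivity
  have hsq' : ∀ w : Space d → EuclideanSpace ℂ (Fin d), 0 ≤ ∫ x, ‖w x‖ ^ 2 := fun w =>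
    integral_nonneg fun x => by positivity
  let S : Set ℝ := {e | ∃ u v, P.Admissible u v ∧ P.energy u v = e}
  have hSne : S.Nonempty := by
    obtain ⟨u, v, huv⟩ := exists_admissible P hVu
    exact ⟨_, u, v, huv, rfl⟩
  have hSb : BddBelow S := by
    refine ⟨-C, ?_⟩
    rintro e ⟨u, v, huv, rfl⟩
    have := hcoer u v _ _ huv.finiteEnergy_u huv.finiteEnergy_v huv.mass_eq
    have h1 := mul_nonneg hc.le (add_nonneg (hsq' (weakGrad u)) (hsq' (weakGrad v)))
    linarith [hpos hVu0 u, hpos hVd0 v]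
  obtain ⟨e, -, he, heS⟩ := exists_seq_tendsto_sInf hSne hSb
  choose u v huv hE using heS
  obtain ⟨M₀, hM₀⟩ := he.bddAbove_range
  have hEM : ∀ n, P.energy (u n) (v n) ≤ M₀ := fun n => by
    rw [hE n]; exact hM₀ (Set.mem_range_self n)
  have hFu := fun n => (huv n).finiteEnergy_u
  have hFv := fun n => (huv n).finiteEnergy_v
  set M := max 1 (max (M₀ + C) ((M₀ + C) / c)) with hM
  have hM1 : 1 ≤ M := le_max_left _ _
  have hM2 : M₀ + C ≤ M := (le_max_left _ _).trans (le_max_right _ _)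
  have hM3 : (M₀ + C) / c ≤ M := (le_max_right _ _).trans (le_max_right _ _)
  have hall : ∀ n, c * ((∫ x, ‖weakGrad (u n) x‖ ^ 2) + ∫ x, ‖weakGrad (v n) x‖ ^ 2)
      + (∫ x, P.Vu x * ‖u n x‖ ^ 2) + (∫ x, P.Vd x * ‖v n x‖ ^ 2) ≤ M₀ + C := fun n => by
    have := hcoer _ _ _ _ (hFu n) (hFv n) (huv n).mass_eq
    linarith [hEM n]
  have hkin : ∀ n, (∫ x, ‖weakGrad (u n) x‖ ^ 2) + ∫ x, ‖weakGrad (v n) x‖ ^ 2 ≤ M := fun n => by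
    refine le_trans ?_ hM3
    rw [le_div_iff₀ hc, mul_comm]
    linarith [hall n, hpos hVu0 (u n), hpos hVd0 (v n)]
  have hpot : ∀ n, (∫ x, P.Vu x * ‖u n x‖ ^ 2) + (∫ x, P.Vd x * ‖v n x‖ ^ 2) ≤ M := fun n => by
    have h1 := mul_nonneg hc.le (add_nonneg (hsq' (weakGrad (u n))) (hsq' (weakGrad (v n))))
    linarith [hall n]
  -- The second extraction below is made along the first, so that both components converge along the
  -- common subsequence `σ`.
  obtain ⟨φ, f, gf, Ku, Lu, hφ, hf⟩ := exists_formTendsto_subseq hd hVu0 hVu.aestronglyMeasurable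
    hVuc hFu (M := M) (fun n => by linarith [(huv n).mass_eq, hsq (v n)])
    (fun n => by linarith [hkin n, hsq' (weakGrad (v n))])
    (fun n => by linarith [hpot n, hpos hVd0 (v n)])
  obtain ⟨ψ, k, gk, Kv, Lv, hψ, hk⟩ := exists_formTendsto_subseq hd hVd0 hVd.aestronglyMeasurable
    hVdc (fun n => hFv (φ n)) (M := M)
    (fun n => by linarith [(huv (φ n)).mass_eq, hsq (u (φ n))])
    (fun n => by linarith [hkin (φ n), hsq' (weakGrad (u (φ n)))])
    (fun n => by linarith [hpot (φ n), hpos hVu0 (u (φ n))])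
  replace hf := hf.comp hψ
  set σ : ℕ → ℕ := fun n => φ (ψ n) with hσ
  have hσm : StrictMono σ := hφ.comp hψ
  have t1 := tendsto_integral_norm_sq (fun n => (hFu (σ n)).memLp) hf.finiteEnergy.memLp hf.two
  have t2 := tendsto_integral_norm_sq (fun n => (hFv (σ n)).memLp) hk.finiteEnergy.memLp hk.two
  have t3 := tendsto_integral_re_mul_conj (fun n => (hFu (σ n)).memLp) hf.finiteEnergy.memLp
    (fun n => (hFv (σ n)).memLp) hk.finiteEnergy.memLp hf.two hk.two
  have t4 := tendsto_integral_sq_mul_sq (fun n => (hFu (σ n)).memLp_four) hf.finiteEnergy.memLp_four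
    (fun n => (hFv (σ n)).memLp_four) hk.finiteEnergy.memLp_four hf.four hk.four
  have t5 := tendsto_integral_sq_mul_sq (fun n => (hFu (σ n)).memLp_four) hf.finiteEnergy.memLp_four
    (fun n => (hFu (σ n)).memLp_four) hf.finiteEnergy.memLp_four hf.four hf.four
  have t6 := tendsto_integral_sq_mul_sq (fun n => (hFv (σ n)).memLp_four) hk.finiteEnergy.memLp_four
    (fun n => (hFv (σ n)).memLp_four) hk.finiteEnergy.memLp_four hk.four hk.four
  simp only [← pow_add] at t5 t6
  have hmass : (∫ x, ‖f x‖ ^ 2) + ∫ x, ‖k x‖ ^ 2 = 1 :=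
    tendsto_nhds_unique (t1.add t2) (tendsto_const_nhds.congr fun n => (huv (σ n)).mass_eq.symm)
  have hlim := ((((hf.kinetic.const_mul (1 / 2)).add hf.potential).add
    ((hk.kinetic.const_mul (1 / 2)).add hk.potential)).add ((t1.sub t2).const_mul (P.δ / 2))).add
    (((t5.const_mul (1 / 2 * P.βuu)).add (t6.const_mul (1 / 2 * P.βdd))).add (t4.const_mul P.βud))
    |>.add (t3.const_mul P.Ω)
  have hlimE : Tendsto (fun n => P.energy (u (σ n)) (v (σ n))) atTop (𝓝 (sInf S)) :=
    (he.comp hσm.tendsto_atTop).congr fun n => (hE (σ n)).symm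
  -- The infimum equals the energy formula with the limits K and L in the place of the kinetic and
  -- potential energies of the limit pair, which are no larger.
  have heq := tendsto_nhds_unique hlimE (hlim.congr fun n =>
    (GPData.energy_eq (hFu (σ n)) (hFv (σ n))).symm)
  refine ⟨f, k, .of_finiteEnergy hf.finiteEnergy hk.finiteEnergy hmass, fun u' v' h' => ?_⟩
  have hle : sInf S ≤ P.energy u' v' := csInf_le hSb ⟨u', v', h', rfl⟩
  refine le_trans ?_ hle
  rw [heq, GPData.energy_eq hf.finiteEnergy hk.finiteEnergy, GPData.interaction]
  linarith [hf.kinetic_le, hf.potential_le, hk.kinetic_le, hk.potential_le]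

end

/-! ### Dilations and unboundedness from below -/

section

variable {d : ℕ}

/-- The mass-preserving dilation `x ↦ l^{d/2} F(l x)`. -/
noncomputable def dilate (l : ℝ) (F : Space d → ℂ) (x : Space d) : ℂ :=
  ((√(l ^ d) : ℝ) : ℂ) * F (l • x)

lemma contDiff_dilate (l : ℝ) {F : Space d → ℂ} (hF : ContDiff ℝ ∞ F) :
    ContDiff ℝ ∞ (dilate l F) :=
  contDiff_const.mul (hF.comp (contDiff_const_smul l))

lemma hasCompactSupport_dilate {l : ℝ} (hl : 0 < l) {F : Space d → ℂ} (hF : HasCompactSupport F) :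
    HasCompactSupport (dilate l F) :=
  (hF.comp_homeomorph (Homeomorph.smulOfNeZero l hl.ne')).mul_left

lemma norm_dilate_sq {l : ℝ} (hl : 0 < l) (F : Space d → ℂ) (x : Space d) :
    ‖dilate l F x‖ ^ 2 = l ^ d * ‖F (l • x)‖ ^ 2 := by
  rw [dilate, norm_mul, mul_pow, Complex.norm_real, Real.norm_eq_abs, sq_abs,
    Real.sq_sqrt (by positivity)]

lemma integral_comp_smul_space {l : ℝ} (hl : 0 < l) (f : Space d → ℝ) :
    l ^ d * ∫ x, f (l • x) = ∫ x, f x := by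
  rw [Measure.integral_comp_smul, finrank_euclideanSpace, Fintype.card_fin,
    abs_of_pos (by positivity), smul_eq_mul, ← mul_assoc, mul_inv_cancel₀ (by positivity), one_mul]

lemma integral_norm_dilate_sq {l : ℝ} (hl : 0 < l) (F : Space d → ℂ) :
    ∫ x, ‖dilate l F x‖ ^ 2 = ∫ x, ‖F x‖ ^ 2 := by
  simp only [norm_dilate_sq hl, integral_const_mul]
  exact integral_comp_smul_space hl fun x => ‖F x‖ ^ 2

lemma integral_norm_dilate_four {l : ℝ} (hl : 0 < l) (F : Space d → ℂ) :
    ∫ x, ‖dilate l F x‖ ^ 4 = l ^ d * ∫ x, ‖F x‖ ^ 4 := by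
  have : ∀ x, ‖dilate l F x‖ ^ 4 = l ^ d * (l ^ d * ‖F (l • x)‖ ^ 4) := fun x => by
    rw [show ‖dilate l F x‖ ^ 4 = (‖dilate l F x‖ ^ 2) ^ 2 by ring, norm_dilate_sq hl]; ring
  simp only [this, integral_const_mul]
  rw [integral_comp_smul_space hl fun x => ‖F x‖ ^ 4]

lemma cgrad_dilate (l : ℝ) {F : Space d → ℂ} (hF : ContDiff ℝ ∞ F) (x : Space d) :
    cgrad (dilate l F) x = ((√(l ^ d) * l : ℝ) : ℂ) • cgrad F (l • x) := by
  have h1 : HasFDerivAt F (fderiv ℝ F (l • x)) (l • x) :=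
    (hF.differentiable (by simp) _).hasFDerivAt
  have h2 : HasFDerivAt (fun y : Space d => l • y) (l • ContinuousLinearMap.id ℝ (Space d)) x :=
    (hasFDerivAt_id x).const_smul l
  have h3 : HasFDerivAt (dilate l F) (((√(l ^ d) : ℝ) : ℂ) • (fderiv ℝ F (l • x)).comp
      (l • ContinuousLinearMap.id ℝ (Space d))) x := (h1.comp x h2).const_mul _
  ext i
  rw [cgrad_apply, h3.fderiv]
  simp only [_root_.smul_apply, ContinuousLinearMap.comp_apply,
    ContinuousLinearMap.id_apply, map_smul, PiLp.smul_apply, cgrad_apply, smul_eq_mul,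
    Complex.real_smul, Complex.ofReal_mul]
  ring

lemma integral_norm_cgrad_dilate_sq {l : ℝ} (hl : 0 < l) {F : Space d → ℂ} (hF : ContDiff ℝ ∞ F) :
    ∫ x, ‖cgrad (dilate l F) x‖ ^ 2 = l ^ 2 * ∫ x, ‖cgrad F x‖ ^ 2 := by
  have : ∀ x, ‖cgrad (dilate l F) x‖ ^ 2 = l ^ 2 * (l ^ d * ‖cgrad F (l • x)‖ ^ 2) := fun x => by
    rw [cgrad_dilate l hF, norm_smul, mul_pow, Complex.norm_real, Real.norm_eq_abs, sq_abs,
      mul_pow, Real.sq_sqrt (by positivity)]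
    ring
  simp only [this, integral_const_mul]
  rw [integral_comp_smul_space hl fun x => ‖cgrad F x‖ ^ 2]

/-- The potential energy of dilations is `o(l^d)`. -/
lemma exists_potential_dilate_le (hd : 0 < d) {V : Space d → ℝ} (hV0 : ∀ x, 0 ≤ V x)
    (hV : LocallyIntegrable V volume) {F : Space d → ℂ} (hF : Continuous F)
    (hc : HasCompactSupport F) :
    ∃ ε : ℕ → ℝ, Tendsto ε atTop (𝓝 0) ∧ ∀ n : ℕ,
      ∫ x, V x * ‖dilate ((n : ℝ) + 1) F x‖ ^ 2 ≤ ((n : ℝ) + 1) ^ d * ε n := by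
  -- In positive dimension the origin is a null set, so the integral of V over balls shrinking to it
  -- tends to zero.
  have : Nonempty (Fin d) := ⟨⟨0, hd⟩⟩
  obtain ⟨b, hb⟩ := hF.bounded_above_of_compact_support hc
  obtain ⟨R, hR⟩ := hc.isCompact.isBounded.subset_closedBall (0 : Space d)
  -- Balls containing the supports of the dilated profiles.
  let s : ℕ → Set (Space d) := fun n => Metric.closedBall 0 (|R| / ((n : ℝ) + 1))
  have hs : Antitone s := fun m n hmn => Metric.closedBall_subset_closedBall (by gcongr)
  have hi : ∀ n, IntegrableOn V (s n) volume := fun n =>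
    hV.integrableOn_isCompact (isCompact_closedBall _ _)
  have hlim := tendsto_setIntegral_of_antitone (f := V) (μ := volume) (s := s)
    (fun n => measurableSet_closedBall) hs ⟨0, hi 0⟩
  have hinter : (⋂ n, s n) ⊆ {0} := by
    intro x hx
    simp only [s, Set.mem_iInter, mem_closedBall_zero_iff] at hx
    have h1 : Tendsto (fun n : ℕ => |R| / ((n : ℝ) + 1)) atTop (𝓝 0) :=
      tendsto_const_nhds.div_atTop (tendsto_natCast_atTop_atTop.atTop_add tendsto_const_nhds)
    have h2 := ge_of_tendsto' h1 hx
    simpa using h2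
  have h0 : ∫ x in ⋂ n, s n, V x = 0 :=
    setIntegral_measure_zero _ (measure_mono_null hinter (measure_singleton _))
  rw [h0] at hlim
  refine ⟨fun n => b ^ 2 * ∫ x in s n, V x, by simpa using hlim.const_mul (b ^ 2), fun n => ?_⟩
  have hl : (0 : ℝ) < (n : ℝ) + 1 := by positivity
  have hb0 : 0 ≤ b := (norm_nonneg _).trans (hb 0)
  have hsm : MeasurableSet (s n) := measurableSet_closedBall
  beta_reduce
  rw [← integral_indicator hsm, ← integral_const_mul, ← integral_const_mul]
  refine integral_mono_of_nonneg (.of_forall fun x => mul_nonneg (hV0 x) (by positivity))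
    ((((hi n).integrable_indicator hsm).const_mul _).const_mul _)
    (.of_forall fun x => ?_)
  simp only [norm_dilate_sq hl]
  by_cases hx : x ∈ s n
  · rw [Set.indicator_of_mem hx]
    have h1 : ‖F (((n : ℝ) + 1) • x)‖ ^ 2 ≤ b ^ 2 := by gcongr; exact hb _
    calc V x * (((n : ℝ) + 1) ^ d * ‖F (((n : ℝ) + 1) • x)‖ ^ 2)
        = ((n : ℝ) + 1) ^ d * (‖F (((n : ℝ) + 1) • x)‖ ^ 2 * V x) := by ring
      _ ≤ _ := by gcongr; exact hV0 x
  · have h2 : F (((n : ℝ) + 1) • x) = 0 := by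
      by_contra hne
      have h3 := hR (subset_tsupport F hne)
      rw [mem_closedBall_zero_iff, norm_smul, Real.norm_eq_abs, abs_of_pos hl] at h3
      refine hx ?_
      simp only [s, mem_closedBall_zero_iff]
      rw [le_div_iff₀ hl, mul_comm]
      exact h3.trans (le_abs_self R)
    rw [Set.indicator_of_notMem hx, h2]
    simp

/-- Concentration at a point makes the energy arbitrarily negative. -/
lemma exists_energy_lt (hd : 0 < d) {P : GPData d} (hVu0 : ∀ x, 0 ≤ P.Vu x)
    (hVd0 : ∀ x, 0 ≤ P.Vd x) (hVu : LocallyIntegrable P.Vu volume)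
    (hVd : LocallyIntegrable P.Vd volume) {F : Space d → ℂ} (hF : ContDiff ℝ ∞ F)
    (hc : HasCompactSupport F) (h1 : ∫ x, ‖F x‖ ^ 2 = 1) {a b κ : ℝ} (ha : 0 ≤ a) (hb : 0 ≤ b)
    (hab : a + b = 1)
    (hκ : Tendsto (fun n : ℕ => ((n : ℝ) + 1) ^ 2 / ((n : ℝ) + 1) ^ d) atTop (𝓝 κ))
    (hneg : κ * (∫ x, ‖cgrad F x‖ ^ 2)
      + (P.βuu * a ^ 2 + 2 * P.βud * (a * b) + P.βdd * b ^ 2) * (∫ x, ‖F x‖ ^ 4) < 0) (M : ℝ) :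
    ∃ u v : Space d → ℂ, P.Admissible u v ∧ P.energy u v < M := by
  set K := ∫ x, ‖cgrad F x‖ ^ 2
  set N := ∫ x, ‖F x‖ ^ 4
  set Q := P.βuu * a ^ 2 + 2 * P.βud * (a * b) + P.βdd * b ^ 2 with hQ
  obtain ⟨ε, hε, hεV⟩ := exists_potential_dilate_le hd hVu0 hVu hF.continuous hc
  obtain ⟨ε', hε', hεV'⟩ := exists_potential_dilate_le hd hVd0 hVd hF.continuous hc
  -- The expression is an upper bound for the energy with l^d factored out. The bracket tends to
  -- half of the quantity in `hneg`, which is negative.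
  have hlim : Tendsto (fun n : ℕ => ((n : ℝ) + 1) ^ d * (1 / 2 * (((n : ℝ) + 1) ^ 2 /
      ((n : ℝ) + 1) ^ d * K + Q * N) + a * ε n + b * ε' n) + (|P.δ| + |P.Ω|)) atTop atBot := by
    refine tendsto_atBot_add_const_right _ _ (Tendsto.atTop_mul_neg
      (C := 1 / 2 * (κ * K + Q * N) + a * 0 + b * 0) (by linarith) ?_ ?_)
    · exact (tendsto_pow_atTop hd.ne').comp
        (tendsto_natCast_atTop_atTop.atTop_add tendsto_const_nhds)
    · exact ((((hκ.mul_const K).add_const _).const_mul _).add (hε.const_mul a)).add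
        (hε'.const_mul b)
  obtain ⟨n, hn⟩ := (hlim.eventually_lt_atBot M).exists
  set l := (n : ℝ) + 1 with hl
  have hl0 : 0 < l := by positivity
  have hD := contDiff_dilate l hF
  have hDc := hasCompactSupport_dilate hl0 hc
  -- Both components are multiples of the same concentrating profile, with mass shares a and b.
  have hu := (FiniteEnergy.of_test hVu (hD.of_le (by simp)) hDc).const_mul ((√a : ℝ) : ℂ)
  have hv := (FiniteEnergy.of_test hVd (hD.of_le (by simp)) hDc).const_mul ((√b : ℝ) : ℂ)
  have hcs : ∀ t : ℝ, 0 ≤ t → ∀ z : ℂ, ‖((√t : ℝ) : ℂ) * z‖ ^ 2 = t * ‖z‖ ^ 2 := fun t ht z => by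
    rw [norm_mul, mul_pow, Complex.norm_real, Real.norm_eq_abs, sq_abs, Real.sq_sqrt ht]
  have hcg : ∀ t : ℝ, 0 ≤ t → ∀ z : EuclideanSpace ℂ (Fin d),
      ‖((√t : ℝ) : ℂ) • z‖ ^ 2 = t * ‖z‖ ^ 2 := fun t ht z => by
    rw [norm_smul, mul_pow, Complex.norm_real, Real.norm_eq_abs, sq_abs, Real.sq_sqrt ht]
  have hc4 : ∀ t : ℝ, 0 ≤ t → ∀ z : ℂ, ‖((√t : ℝ) : ℂ) * z‖ ^ 4 = t ^ 2 * ‖z‖ ^ 4 :=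
    fun t ht z => by
      rw [show ‖((√t : ℝ) : ℂ) * z‖ ^ 4 = (‖((√t : ℝ) : ℂ) * z‖ ^ 2) ^ 2 by ring, hcs t ht]; ring
  have m1 : ∀ t : ℝ, 0 ≤ t → ∫ x, ‖((√t : ℝ) : ℂ) * dilate l F x‖ ^ 2 = t := fun t ht => by
    simp only [hcs t ht, integral_const_mul, integral_norm_dilate_sq hl0, h1, mul_one]
  have hmass : (∫ x, ‖((√a : ℝ) : ℂ) * dilate l F x‖ ^ 2)
      + ∫ x, ‖((√b : ℝ) : ℂ) * dilate l F x‖ ^ 2 = 1 := by rw [m1 a ha, m1 b hb, hab]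
  refine ⟨_, _, .of_finiteEnergy hu hv hmass, lt_of_le_of_lt ?_ hn⟩
  have hδ : P.δ / 2 * (a - b) ≤ |P.δ| := by
    have h3 : |a - b| ≤ 1 := abs_le.2 ⟨by linarith, by linarith⟩
    refine (le_abs_self _).trans ?_
    rw [abs_mul, abs_div, abs_two]
    nlinarith [abs_nonneg P.δ, abs_nonneg (a - b)]
  have hΩ : P.Ω * (∫ x, (((√a : ℝ) : ℂ) * dilate l F x
      * conj (((√b : ℝ) : ℂ) * dilate l F x)).re) ≤ |P.Ω| := by
    have h3 := abs_integral_re_mul_conj_le hu hv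
    rw [hmass] at h3
    refine (le_abs_self _).trans ?_
    rw [abs_mul]
    exact mul_le_of_le_one_right (abs_nonneg _) h3
  have e22 : ∫ x, ‖((√a : ℝ) : ℂ) * dilate l F x‖ ^ 2 * ‖((√b : ℝ) : ℂ) * dilate l F x‖ ^ 2
      = a * b * (l ^ d * N) := by
    rw [← integral_norm_dilate_four hl0, ← integral_const_mul]
    refine integral_congr_ae (.of_forall fun x => ?_)
    simp only [hcs a ha, hcs b hb]
    ring
  have eV : ∀ (V : Space d → ℝ) (t : ℝ), 0 ≤ t →
      ∫ x, V x * ‖((√t : ℝ) : ℂ) * dilate l F x‖ ^ 2 = t * ∫ x, V x * ‖dilate l F x‖ ^ 2 :=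
    fun V t ht => by
      rw [← integral_const_mul]
      refine integral_congr_ae (.of_forall fun x => ?_)
      simp only [hcs t ht]
      ring
  rw [GPData.energy_eq hu hv, GPData.interaction, m1 a ha, m1 b hb, e22, eV P.Vu a ha, eV P.Vd b hb]
  simp only [hc4 a ha, hc4 b hb, hcg a ha, hcg b hb, integral_const_mul,
    integral_norm_dilate_four hl0, integral_norm_cgrad_dilate_sq hl0 hF]
  have k1 := mul_le_mul_of_nonneg_left (hεV n) ha
  have k2 := mul_le_mul_of_nonneg_left (hεV' n) hb
  have hexp : l ^ d * (1 / 2 * (l ^ 2 / l ^ d * K + Q * N) + a * ε n + b * ε' n)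
      = 1 / 2 * (l ^ 2 * K) + 1 / 2 * Q * (l ^ d * N) + a * (l ^ d * ε n) + b * (l ^ d * ε' n) := by
    field_simp
  rw [hexp]
  have hK : 1 / 2 * (l ^ 2 * K) = 1 / 2 * (a * (l ^ 2 * K)) + 1 / 2 * (b * (l ^ 2 * K)) := by
    rw [← mul_add, ← add_mul, hab, one_mul]
  have hQ' : 1 / 2 * Q * (l ^ d * N) = 1 / 2 * P.βuu * (a ^ 2 * (l ^ d * N))
      + 1 / 2 * P.βdd * (b ^ 2 * (l ^ d * N)) + P.βud * (a * b * (l ^ d * N)) := by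
    rw [hQ]; ring
  rw [hK, hQ']
  linarith

/-- For p, q ≥ 0 the form is smallest, relative to the mixed term, in the direction (√q, √p), where
it equals 2√p √q (√p √q + r). If p or q is negative, a coordinate direction suffices. -/
lemma exists_quadForm_neg {p q r : ℝ} (h : p < 0 ∨ q < 0 ∨ r < -(√p * √q)) :
    ∃ a b : ℝ, 0 ≤ a ∧ 0 ≤ b ∧ a + b = 1 ∧ p * a ^ 2 + 2 * r * (a * b) + q * b ^ 2 < 0 := by
  by_cases hp : p < 0
  · exact ⟨1, 0, by simp [hp]⟩
  by_cases hq : q < 0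
  · exact ⟨0, 1, by simp [hq]⟩
  push Not at hp hq
  replace h : r < -(√p * √q) := by
    rcases h with h | h | h
    · linarith
    · linarith
    · exact h
  -- Replacing p and q by p + t and q + t with small t > 0 keeps the direction admissible when p or
  -- q is zero.
  have hcont : Continuous fun t : ℝ => r + √(p + t) * √(q + t) := by fun_prop
  have h1 : ∀ᶠ t in 𝓝[>] (0 : ℝ), r + √(p + t) * √(q + t) < 0 :=
    (hcont.tendsto 0).mono_left nhdsWithin_le_nhds |>.eventually
      (gt_mem_nhds (by simp only [add_zero]; linarith))
  obtain ⟨t, h1, ht⟩ := (h1.and self_mem_nhdsWithin).exists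
  have ht : 0 < t := ht
  set x := √(p + t) with hx
  set y := √(q + t) with hy
  have hx0 : 0 < x := Real.sqrt_pos.2 (by linarith)
  have hy0 : 0 < y := Real.sqrt_pos.2 (by linarith)
  have hx2 : x ^ 2 = p + t := Real.sq_sqrt (by linarith)
  have hy2 : y ^ 2 = q + t := Real.sq_sqrt (by linarith)
  refine ⟨y / (x + y), x / (x + y), by positivity, by positivity, by field_simp; ring, ?_⟩
  have e : p * (y / (x + y)) ^ 2 + 2 * r * (y / (x + y) * (x / (x + y))) + q * (x / (x + y)) ^ 2
      = (p * y ^ 2 + 2 * r * (x * y) + q * x ^ 2) / (x + y) ^ 2 := by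
    field_simp
  rw [e]
  refine div_neg_of_neg_of_pos ?_ (by positivity)
  have hxy : 0 < x * y := by positivity
  have e1 : p * y ^ 2 = x ^ 2 * y ^ 2 - t * y ^ 2 := by rw [hx2]; ring
  have e2 : q * x ^ 2 = x ^ 2 * y ^ 2 - t * x ^ 2 := by rw [hy2]; ring
  have e3 : 0 < t * y ^ 2 := by positivity
  have e4 : 0 < t * x ^ 2 := by positivity
  nlinarith [mul_neg_of_pos_of_neg hxy h1]

/-- Almost optimal test functions for the Gagliardo-Nirenberg inequality. -/
lemma exists_test_lt_of_bestConst_lt {q : ℝ} (hq : bestConst < q) :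
    ∃ F : Space 2 → ℂ, ContDiff ℝ ∞ F ∧ HasCompactSupport F ∧ ∫ x, ‖F x‖ ^ 2 = 1 ∧
      (∫ x, ‖cgrad F x‖ ^ 2) - q * (∫ x, ‖F x‖ ^ 4) < 0 := by
  have hne : {r : ℝ | ∃ f : Space 2 → ℂ, MemH1 f ∧ ¬ (f =ᵐ[volume] 0) ∧
      r = (∫ x, ‖weakGrad f x‖ ^ 2) * (∫ x, ‖f x‖ ^ 2) / ∫ x, ‖f x‖ ^ 4}.Nonempty := by
    -- An empty set would have infimum 0, against the positivity of `bestConst`.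
    by_contra h
    have h0 := bestConst_pos
    rw [bestConst, Set.not_nonempty_iff_eq_empty.1 h, Real.sInf_empty] at h0
    exact lt_irrefl _ h0
  obtain ⟨r, ⟨f, hf, hf0, rfl⟩, hr⟩ := exists_lt_of_csInf_lt hne hq
  obtain ⟨hg, hfg⟩ := hf.2.weakGrad_spec
  obtain ⟨C, hC, hGN⟩ := gagliardoNirenberg (d := 2) (by simp)
  obtain ⟨h4, -⟩ := hGN f _ hf.1 hg hfg
  have hpos : ∀ k : ℕ, k ≠ 0 → Integrable (fun x => ‖f x‖ ^ k) volume → 0 < ∫ x, ‖f x‖ ^ k :=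
    fun k hk hi => by
      refine (integral_nonneg fun x => by positivity).lt_of_ne fun h => hf0 ?_
      have := (integral_eq_zero_iff_of_nonneg (fun x => by positivity) hi).1 h.symm
      filter_upwards [this] with x hx
      simpa [hk] using hx
  have hp4 := hpos 4 (by norm_num) (integrable_norm_four h4)
  have hp2 := hpos 2 (by norm_num) (integrable_norm_sq hf.1)
  rw [div_lt_iff₀ hp4] at hr
  obtain ⟨F, hF⟩ := exists_approximates hf.1 hg hfg
  have t1 := tendsto_integral_norm_sq (fun n => hF.memLp n 2) hf.1 hF.tendsto_L2
  have t2 := tendsto_integral_norm_sq (fun n => hF.memLp_cgrad n 2) hg hF.tendsto_grad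
  obtain ⟨M, hM⟩ := t2.bddAbove_range
  have l4 := tendsto_eLpNorm_four (d := 2) (by simp) (fun n => hF.memLp n 2) hf.1
    (fun n => hF.memLp_cgrad n 2) hg
    (fun n => isWeakGrad_cgrad ((hF.contDiff n).of_le (by simp))) hfg
    (fun n => hM (Set.mem_range_self n)) hF.tendsto_L2
  have t4 := tendsto_integral_sq_mul_sq (fun n => hF.memLp n 4) h4 (fun n => hF.memLp n 4) h4 l4 l4
  simp only [← pow_add] at t4
  have e1 : ∀ᶠ n in atTop, 0 < ∫ x, ‖F n x‖ ^ 2 := t1.eventually (lt_mem_nhds hp2)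
  -- The strict inequality is first passed to test functions in the form with the mass as a factor,
  -- and only then normalized.
  have e2 := ((t2.mul t1).sub (t4.const_mul q)).eventually (gt_mem_nhds (sub_neg.2 hr))
  obtain ⟨n, hm, hn⟩ := (e1.and e2).exists
  set m := ∫ x, ‖F n x‖ ^ 2 with hmdef
  have hcs : ‖(((√m)⁻¹ : ℝ) : ℂ)‖ ^ 2 = m⁻¹ := by
    rw [Complex.norm_real, Real.norm_eq_abs, sq_abs, inv_pow, Real.sq_sqrt hm.le]
  have hcgr : ∀ x, cgrad (fun x => (((√m)⁻¹ : ℝ) : ℂ) * F n x) x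
      = (((√m)⁻¹ : ℝ) : ℂ) • cgrad (F n) x := fun x => by
    ext i
    have h3 := (((hF.contDiff n).differentiable (by simp) x).hasFDerivAt.const_mul
      (((√m)⁻¹ : ℝ) : ℂ)).fderiv
    simp only [cgrad_apply, PiLp.smul_apply]
    rw [h3]
    rfl
  refine ⟨fun x => (((√m)⁻¹ : ℝ) : ℂ) * F n x, contDiff_const.mul (hF.contDiff n),
    (hF.hasCompactSupport n).mul_left, ?_, ?_⟩
  · simp only [norm_mul, mul_pow, hcs, integral_const_mul]
    exact inv_mul_cancel₀ hm.ne'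
  · have hc4 : ‖(((√m)⁻¹ : ℝ) : ℂ)‖ ^ 4 = m⁻¹ ^ 2 := by rw [← hcs]; ring
    simp only [hcgr, norm_smul, norm_mul, mul_pow, hcs, hc4, integral_const_mul]
    have e : m⁻¹ * (∫ x, ‖cgrad (F n) x‖ ^ 2) - q * (m⁻¹ ^ 2 * ∫ x, ‖F n x‖ ^ (2 + 2))
        = m⁻¹ ^ 2 * ((∫ x, ‖cgrad (F n) x‖ ^ 2) * m - q * ∫ x, ‖F n x‖ ^ (2 + 2)) := by
      field_simp
    rw [show (4 : ℕ) = 2 + 2 from rfl, e]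
    exact mul_neg_of_pos_of_neg (by positivity) hn

/-- The energy is unbounded below under the nonexistence conditions. -/
theorem exists_energy_lt_of_nonexistenceCond {P : GPData d} (hVu0 : ∀ x, 0 ≤ P.Vu x)
    (hVd0 : ∀ x, 0 ≤ P.Vd x) (hVu : LocallyIntegrable P.Vu volume)
    (hVd : LocallyIntegrable P.Vd volume) (h : P.NonexistenceCond) (M : ℝ) :
    ∃ u v : Space d → ℂ, P.Admissible u v ∧ P.energy u v < M := by
  rcases h with ⟨rfl, h⟩ | ⟨rfl, h⟩
  · obtain ⟨a, b, ha, hb, hab, hQ⟩ := exists_quadForm_neg (p := bestConst + P.βuu)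
      (q := bestConst + P.βdd) (r := bestConst + P.βud) (by
        rcases h with h | h | h
        · exact Or.inl (by linarith)
        · exact Or.inr (Or.inl (by linarith))
        · exact Or.inr (Or.inr (by linarith)))
    -- Since a + b = 1, adding C_b to every entry adds exactly C_b to the value of the form.
    have hQ' : P.βuu * a ^ 2 + 2 * P.βud * (a * b) + P.βdd * b ^ 2 < -bestConst := by
      have e : (bestConst + P.βuu) * a ^ 2 + 2 * (bestConst + P.βud) * (a * b)
          + (bestConst + P.βdd) * b ^ 2 = bestConst * (a + b) ^ 2
          + (P.βuu * a ^ 2 + 2 * P.βud * (a * b) + P.βdd * b ^ 2) := by ring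
      rw [e, hab] at hQ
      linarith
    obtain ⟨F, hF, hc, h1, hlt⟩ := exists_test_lt_of_bestConst_lt (lt_neg_of_lt_neg hQ')
    -- For d = 2 kinetic and interaction energies scale alike.
    refine exists_energy_lt (by norm_num) hVu0 hVd0 hVu hVd hF hc h1 ha hb hab (κ := 1) ?_ ?_ M
    · refine tendsto_const_nhds.congr fun n => ?_
      rw [div_self (by positivity)]
    · linarith
  · obtain ⟨a, b, ha, hb, hab, hQ⟩ := exists_quadForm_neg (p := P.βuu) (q := P.βdd) (r := P.βud) (by
        by_cases hp : P.βuu < 0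
        · exact Or.inl hp
        by_cases hq : P.βdd < 0
        · exact Or.inr (Or.inl hq)
        push Not at hp hq
        refine Or.inr (Or.inr ?_)
        rcases h with h | h | ⟨h, h'⟩
        · linarith
        · linarith
        · rw [← Real.sqrt_mul hp]
          have h5 : √(P.βuu * P.βdd) < -P.βud :=
            (Real.sqrt_lt' (by linarith)).2 (by rw [neg_sq]; exact h')
          linarith)
    obtain ⟨F, hF, hc, h1⟩ := exists_normalized_test 3
    have hN : 0 < ∫ x, ‖F x‖ ^ 4 := by
      have hi := integrable_norm_four (hF.continuous.memLp_of_hasCompactSupport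
        (μ := volume) (p := 4) hc)
      refine (integral_nonneg fun x => by positivity).lt_of_ne fun h0 => ?_
      have h2 := (integral_eq_zero_iff_of_nonneg (fun x => by positivity) hi).1 h0.symm
      have h3 : ∫ x, ‖F x‖ ^ 2 = 0 := by
        rw [integral_congr_ae (g := fun _ => (0 : ℝ)) (h2.mono fun x hx => by simpa using hx)]
        simp
      linarith
    -- For d = 3 the kinetic energy is negligible against the interaction.
    refine exists_energy_lt (by norm_num) hVu0 hVd0 hVu hVd hF hc h1 ha hb hab (κ := 0) ?_ ?_ M
    · have h2 : Tendsto (fun n : ℕ => 1 / ((n : ℝ) + 1)) atTop (𝓝 0) :=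
        tendsto_one_div_add_atTop_nhds_zero_nat
      refine h2.congr fun n => ?_
      field_simp
    · rw [zero_mul, zero_add]
      exact mul_neg_of_neg_of_pos hQ hN

end

/-! ### Optimal phases, reduced ground states and the kinetic defect -/

section

variable {d : ℕ}

/-- `u` is nonnegative, with a real gradient `g` that vanishes on the zero set of `u`. -/
structure IsModulus (u : Space d → ℂ) (g : Space d → EuclideanSpace ℂ (Fin d)) : Prop where
  eq_norm : ∀ x, u x = (‖u x‖ : ℂ)
  real : ∀ x i, (g x i).im = 0
  zero : ∀ x, u x = 0 → g x = 0

lemma isModulus_pairAbs (u v : Space d → ℂ) (g₁ g₂ : Space d → EuclideanSpace ℂ (Fin d)) :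
    IsModulus (pairAbs u v) (pairAbsGrad u v g₁ g₂) := by
  refine ⟨fun x => ?_, fun x i => ?_, fun x hx => ?_⟩
  · rw [pairAbs, Complex.norm_real, Real.norm_of_nonneg (Real.sqrt_nonneg _)]
  · simp [pairAbsGrad]
  · have h0 : √(‖u x‖ ^ 2 + ‖v x‖ ^ 2) = 0 := by simpa [pairAbs] using hx
    ext i
    simp [pairAbsGrad, h0]

lemma IsModulus.const_mul {u : Space d → ℂ} {g : Space d → EuclideanSpace ℂ (Fin d)}
    (h : IsModulus u g) {c : ℝ} (hc : 0 < c) :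
    IsModulus (fun x => (c : ℂ) * u x) (fun x => (c : ℂ) • g x) := by
  refine ⟨fun x => ?_, fun x i => ?_, fun x hx => ?_⟩
  · rw [norm_mul, Complex.norm_real, Real.norm_of_nonneg hc.le, Complex.ofReal_mul, ← h.eq_norm]
  · simp [h.real]
  · have : u x = 0 := by simpa [hc.ne'] using hx
    simp [h.zero x this]

lemma FiniteEnergy.pairAbs {V : Space d → ℝ} {u v : Space d → ℂ}
    {g₁ g₂ : Space d → EuclideanSpace ℂ (Fin d)} (hu : FiniteEnergy V u g₁)
    (hv : FiniteEnergy V v g₂) :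
    FiniteEnergy V (pairAbs u v) (pairAbsGrad u v g₁ g₂) :=
  ⟨memLp_pairAbs hu.memLp hv.memLp,
    memLp_pairAbsGrad hu.memLp hu.memLp_grad hv.memLp hv.memLp_grad,
    isWeakGrad_pairAbs hu.memLp hu.memLp_grad hu.isWeakGrad hv.memLp hv.memLp_grad hv.isWeakGrad,
    memLp_pairAbs hu.memLp_four hv.memLp_four, by
      refine (hu.integrable_V.add hv.integrable_V).congr (.of_forall fun x => ?_)
      simp only [norm_pairAbs_sq, Pi.add_apply]
      ring⟩

lemma pairAbs_zero_right (u : Space d → ℂ) : pairAbs u 0 = fun x => (‖u x‖ : ℂ) := by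
  ext x
  simp [pairAbs]

lemma integrable_norm_mul_norm {V V' : Space d → ℝ} {u v : Space d → ℂ}
    {gu gv : Space d → EuclideanSpace ℂ (Fin d)} (hu : FiniteEnergy V u gu)
    (hv : FiniteEnergy V' v gv) : Integrable (fun x => ‖u x‖ * ‖v x‖) volume :=
  hu.memLp.norm.integrable_mul hv.memLp.norm

/-- The quadratic part of the energy, with the optimal relative phase. -/
noncomputable def GPData.quadPart (P : GPData d) (u v : Space d → ℂ)
    (gu gv : Space d → EuclideanSpace ℂ (Fin d)) : ℝ :=
  1 / 2 * (∫ x, ‖gu x‖ ^ 2) + (∫ x, P.Vu x * ‖u x‖ ^ 2)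
    + (1 / 2 * (∫ x, ‖gv x‖ ^ 2) + (∫ x, P.Vd x * ‖v x‖ ^ 2))
    + P.δ / 2 * ((∫ x, ‖u x‖ ^ 2) - ∫ x, ‖v x‖ ^ 2) - |P.Ω| * ∫ x, ‖u x‖ * ‖v x‖

/-- Constant phases are invisible to every term except the coupling, where the hypothesis on the
relative phase makes it as negative as possible. -/
lemma energy_phase_eq {P : GPData d} {u v : Space d → ℂ}
    {gu gv : Space d → EuclideanSpace ℂ (Fin d)} (hu : FiniteEnergy P.Vu u gu)
    (hv : FiniteEnergy P.Vd v gv) (hu' : IsModulus u gu) (hv' : IsModulus v gv) {c₁ c₂ : ℂ}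
    (h₁ : ‖c₁‖ = 1) (h₂ : ‖c₂‖ = 1) (h : P.Ω * (c₁ * conj c₂).re = -|P.Ω|) :
    P.energy (fun x => c₁ * u x) (fun x => c₂ * v x)
      = P.quadPart u v gu gv + P.interaction u v := by
  rw [GPData.energy_eq (hu.const_mul c₁) (hv.const_mul c₂), GPData.quadPart, GPData.interaction,
    GPData.interaction]
  have e : ∀ x, (c₁ * u x * conj (c₂ * v x)).re = (c₁ * conj c₂).re * (‖u x‖ * ‖v x‖) := by
    intro x
    rw [hu'.eq_norm x, hv'.eq_norm x, map_mul, Complex.conj_ofReal, mul_mul_mul_comm,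
      ← Complex.ofReal_mul, Complex.re_mul_ofReal]
    simp
  simp only [e, norm_mul, norm_smul, h₁, h₂, one_mul, integral_const_mul]
  rw [← mul_assoc, h]
  ring

/-- Passing to moduli lowers the kinetic energy, and Re(u v̄) is at most |u||v| in absolute value.
-/
lemma quadPart_norm_le {P : GPData d} {u v : Space d → ℂ}
    {gu gv : Space d → EuclideanSpace ℂ (Fin d)} (hu : FiniteEnergy P.Vu u gu)
    (hv : FiniteEnergy P.Vd v gv) :
    P.quadPart (pairAbs u 0) (pairAbs v 0) (pairAbsGrad u 0 gu 0) (pairAbsGrad v 0 gv 0)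
      + P.interaction (pairAbs u 0) (pairAbs v 0) ≤ P.energy u v := by
  have k : ∀ {V : Space d → ℝ} {w : Space d → ℂ} {g : Space d → EuclideanSpace ℂ (Fin d)},
      FiniteEnergy V w g → ∫ x, ‖pairAbsGrad w 0 g 0 x‖ ^ 2 ≤ ∫ x, ‖g x‖ ^ 2 := fun {V w g} hw => by
    refine integral_mono (integrable_norm_sq (memLp_pairAbsGrad hw.memLp hw.memLp_grad MemLp.zero
      MemLp.zero)) hw.integrable_grad_sq fun x => ?_
    simpa using norm_pairAbsGrad_sq_le w 0 g 0 x
  rw [GPData.energy_eq hu hv, GPData.quadPart, GPData.interaction, GPData.interaction]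
  simp only [pairAbs_zero_right, Complex.norm_real, norm_norm]
  have hΩ : -(P.Ω * ∫ x, (u x * conj (v x)).re) ≤ |P.Ω| * ∫ x, ‖u x‖ * ‖v x‖ := by
    refine (neg_le_abs _).trans ?_
    rw [abs_mul]
    gcongr
    refine abs_integral_le_integral_abs.trans (integral_mono (hu.integrable_re_mul_conj hv).abs
      (integrable_norm_mul_norm hu hv) fun x => ?_)
    refine (Complex.abs_re_le_norm _).trans ?_
    simp
  linarith [k hu, k hv]

lemma GPData.IsGroundState.phase {P : GPData d} {u v : Space d → ℂ} (h : P.IsGroundState u v)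
    {c₁ c₂ : ℂ} (h₁ : ‖c₁‖ = 1) (h₂ : ‖c₂‖ = 1) (hc : P.Ω * (c₁ * conj c₂).re = -|P.Ω|) :
    P.IsGroundState (fun x => c₁ * (‖u x‖ : ℂ)) (fun x => c₂ * (‖v x‖ : ℂ)) := by
  have hu := h.1.finiteEnergy_u
  have hv := h.1.finiteEnergy_v
  have hu' := hu.pairAbs (.zero P.Vu)
  have hv' := hv.pairAbs (.zero P.Vd)
  have e := energy_phase_eq hu' hv' (isModulus_pairAbs _ _ _ _) (isModulus_pairAbs _ _ _ _) h₁ h₂ hc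
  have hle := quadPart_norm_le hu hv
  have ha := GPData.Admissible.of_finiteEnergy (hu'.const_mul c₁) (hv'.const_mul c₂) (by
    simp only [pairAbs_zero_right, norm_mul, h₁, h₂, one_mul, Complex.norm_real, norm_norm]
    exact h.1.mass_eq)
  rw [← e] at hle
  simp only [pairAbs_zero_right] at hle ha
  exact ⟨ha, fun u' v' h' => hle.trans (h.2 u' v' h')⟩

/-- The real part is cos(θ₁ - θ₂), which is -1 at ±π and 1 at 0; for Ω = 0 both sides vanish. -/
lemma mul_cos_eq_neg_abs {Ω θ₁ θ₂ : ℝ} (h₁ : 0 < Ω → θ₁ - θ₂ = Real.pi ∨ θ₁ - θ₂ = -Real.pi)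
    (h₂ : Ω < 0 → θ₁ - θ₂ = 0) :
    Ω * (Complex.exp (Complex.I * θ₁) * conj (Complex.exp (Complex.I * θ₂))).re = -|Ω| := by
  have e : (Complex.exp (Complex.I * θ₁) * conj (Complex.exp (Complex.I * θ₂)))
      = Complex.exp (((θ₁ - θ₂ : ℝ) : ℂ) * Complex.I) := by
    rw [← Complex.exp_conj, ← Complex.exp_add]
    congr 1
    simp only [map_mul, Complex.conj_I, Complex.conj_ofReal, Complex.ofReal_sub]
    ring
  rw [e, Complex.exp_ofReal_mul_I_re]
  rcases lt_trichotomy Ω 0 with h | h | h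
  · rw [h₂ h, abs_of_neg h]; simp
  · simp [h]
  · rw [abs_of_pos h]
    rcases h₁ h with h3 | h3 <;> simp [h3]

/-- A minimizer among pairs of nonnegative functions, with energy `E`. -/
structure GPData.IsReducedGroundState (P : GPData d) (a b : Space d → ℂ)
    (ga gb : Space d → EuclideanSpace ℂ (Fin d)) (E : ℝ) : Prop where
  finiteEnergy_a : FiniteEnergy P.Vu a ga
  finiteEnergy_b : FiniteEnergy P.Vd b gb
  isModulus_a : IsModulus a ga
  isModulus_b : IsModulus b gb
  mass : (∫ x, ‖a x‖ ^ 2) + ∫ x, ‖b x‖ ^ 2 = 1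
  energy : P.quadPart a b ga gb + P.interaction a b = E
  le : ∀ {u v : Space d → ℂ} {gu gv : Space d → EuclideanSpace ℂ (Fin d)} {M : ℝ},
    FiniteEnergy P.Vu u gu → FiniteEnergy P.Vd v gv → IsModulus u gu → IsModulus v gv → 0 < M →
    (∫ x, ‖u x‖ ^ 2) + ∫ x, ‖v x‖ ^ 2 = M →
    E * M ^ 2 ≤ P.quadPart u v gu gv * M + P.interaction u v

/-- The minimality of pairs of mass M comes from dividing them by √M: the quadratic part scales by
1/M and the interaction by 1/M². The homogeneous form avoids normalizing competitors later. -/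
lemma GPData.IsGroundState.reduced {P : GPData d} {u v : Space d → ℂ} (h : P.IsGroundState u v) :
    P.IsReducedGroundState (pairAbs u 0) (pairAbs v 0) (pairAbsGrad u 0 (weakGrad u) 0)
      (pairAbsGrad v 0 (weakGrad v) 0) (P.energy u v) := by
  have hu := h.1.finiteEnergy_u
  have hv := h.1.finiteEnergy_v
  have hu' := hu.pairAbs (.zero P.Vu)
  have hv' := hv.pairAbs (.zero P.Vd)
  obtain ⟨c, hc1, hc⟩ : ∃ c : ℂ, ‖c‖ = 1 ∧ P.Ω * ((1 : ℂ) * conj c).re = -|P.Ω| := by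
    rcases le_total P.Ω 0 with h0 | h0
    · exact ⟨1, by simp, by simp [abs_of_nonpos h0]⟩
    · exact ⟨-1, by simp, by simp [abs_of_nonneg h0]⟩
  have hm : (∫ x, ‖pairAbs u 0 x‖ ^ 2) + ∫ x, ‖pairAbs v 0 x‖ ^ 2 = 1 := by
    simp only [pairAbs_zero_right, Complex.norm_real, norm_norm]
    exact h.1.mass_eq
  refine ⟨hu', hv', isModulus_pairAbs _ _ _ _, isModulus_pairAbs _ _ _ _, hm,
    le_antisymm (quadPart_norm_le hu hv) ?_, ?_⟩
  · have e := energy_phase_eq hu' hv' (isModulus_pairAbs _ _ _ _) (isModulus_pairAbs _ _ _ _)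
      (norm_one (α := ℂ)) hc1 hc
    rw [← e]
    refine h.2 _ _ (.of_finiteEnergy (hu'.const_mul 1) (hv'.const_mul c) ?_)
    simpa only [norm_mul, hc1, norm_one, one_mul] using hm
  · intro w z gw gz M hw hz hw' hz' hM hmass
    set s : ℝ := (√M)⁻¹ with hs
    have hs0 : 0 < s := inv_pos.2 (Real.sqrt_pos.2 hM)
    have hs2 : s ^ 2 = M⁻¹ := by rw [hs, inv_pow, Real.sq_sqrt hM.le]
    have hw2 := hw.const_mul (s : ℂ)
    have hz2 := hz.const_mul (s : ℂ)
    have hns : ‖(s : ℂ)‖ = s := by rw [Complex.norm_real, Real.norm_of_nonneg hs0.le]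
    have e := energy_phase_eq hw2 hz2 (hw'.const_mul hs0) (hz'.const_mul hs0)
      (norm_one (α := ℂ)) hc1 hc
    have hle := h.2 _ _ (.of_finiteEnergy (hw2.const_mul 1) (hz2.const_mul c) (by
      simp only [norm_mul, hc1, one_mul, hns, mul_pow, hs2, integral_const_mul]
      rw [← mul_add, hmass, inv_mul_cancel₀ hM.ne']))
    rw [e] at hle
    have e1 : P.quadPart (fun x => (s : ℂ) * w x) (fun x => (s : ℂ) * z x)
        (fun x => (s : ℂ) • gw x) (fun x => (s : ℂ) • gz x) = M⁻¹ * P.quadPart w z gw gz := by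
      have k1 : ∀ r t : ℝ, s * r * (s * t) = M⁻¹ * (r * t) := fun r t => by rw [← hs2]; ring
      have k2 : ∀ r t : ℝ, r * (M⁻¹ * t) = M⁻¹ * (r * t) := fun r t => by ring
      simp only [GPData.quadPart, norm_mul, norm_smul, hns, mul_pow, hs2, k1, k2,
        integral_const_mul]
      ring
    have e2 : P.interaction (fun x => (s : ℂ) * w x) (fun x => (s : ℂ) * z x)
        = M⁻¹ ^ 2 * P.interaction w z := by
      have k1 : s ^ 4 = M⁻¹ ^ 2 := by rw [← hs2]; ring
      have k2 : ∀ r t : ℝ, M⁻¹ * r * (M⁻¹ * t) = M⁻¹ ^ 2 * (r * t) := fun r t => by ring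
      simp only [GPData.interaction, norm_mul, hns, mul_pow, hs2, k1, k2, integral_const_mul]
      ring
    rw [e1, e2] at hle
    have := mul_le_mul_of_nonneg_right hle (sq_nonneg M)
    refine this.trans (le_of_eq ?_)
    field_simp

/-- The loss of kinetic energy in passing from a pair of functions to its modulus. -/
noncomputable def defect (u v : Space d → ℂ) (g₁ g₂ : Space d → EuclideanSpace ℂ (Fin d))
    (x : Space d) : ℝ :=
  ‖u x • g₂ x - v x • g₁ x‖ ^ 2 / (‖u x‖ ^ 2 + ‖v x‖ ^ 2)

lemma defect_nonneg (u v : Space d → ℂ) (g₁ g₂ : Space d → EuclideanSpace ℂ (Fin d))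
    (x : Space d) : 0 ≤ defect u v g₁ g₂ x := by
  rw [defect]; positivity

/-- Lagrange's identity (u g₁ + v g₂)² + (u g₂ - v g₁)² = (u² + v²)(g₁² + g₂²) in each coordinate,
valid because all values are real. It is an inequality only where u = v = 0. -/
lemma norm_pairAbsGrad_sq_add_defect_le {u v : Space d → ℂ}
    {g₁ g₂ : Space d → EuclideanSpace ℂ (Fin d)} {x : Space d} (hu : (u x).im = 0)
    (hv : (v x).im = 0) (h₁ : ∀ i, (g₁ x i).im = 0) (h₂ : ∀ i, (g₂ x i).im = 0) :
    ‖pairAbsGrad u v g₁ g₂ x‖ ^ 2 + defect u v g₁ g₂ x ≤ ‖g₁ x‖ ^ 2 + ‖g₂ x‖ ^ 2 := by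
  simp only [defect, norm_sq_eq_sum, Finset.sum_div, ← Finset.sum_add_distrib]
  refine Finset.sum_le_sum fun i _ => ?_
  have hn : ∀ z : ℂ, z.im = 0 → ‖z‖ ^ 2 = z.re ^ 2 := fun z hz => by
    rw [Complex.sq_norm, Complex.normSq_apply, hz]; ring
  have hd : (u x * g₂ x i - v x * g₁ x i).im = 0 := by
    simp [hu, hv, h₁ i, h₂ i]
  have hr : (u x * g₂ x i - v x * g₁ x i).re = (u x).re * (g₂ x i).re - (v x).re * (g₁ x i).re := by
    simp [hu, hv]
  have hin : innerPair (u x, v x) (g₁ x i, g₂ x i)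
      = (u x).re * (g₁ x i).re + (v x).re * (g₂ x i).re := by
    rw [innerPair_apply]
    simp only [Complex.inner, Complex.mul_re, Complex.conj_re, Complex.conj_im, hu, hv]
    ring
  have hp : ‖pairAbsGrad u v g₁ g₂ x i‖ ^ 2
      = ((u x).re * (g₁ x i).re + (v x).re * (g₂ x i).re) ^ 2 / ((u x).re ^ 2 + (v x).re ^ 2) := by
    simp only [pairAbsGrad, Complex.norm_real, Real.norm_eq_abs, sq_abs]
    rw [hin, div_pow, Real.sq_sqrt (by positivity), hn _ hu, hn _ hv]
  simp only [PiLp.sub_apply, PiLp.smul_apply, smul_eq_mul]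
  rw [hp, hn _ hd, hr, hn _ hu, hn _ hv, hn _ (h₁ i), hn _ (h₂ i), ← add_div]
  rcases eq_or_ne ((u x).re ^ 2 + (v x).re ^ 2) 0 with h0 | h0
  · rw [h0, div_zero]; positivity
  · have : 0 < (u x).re ^ 2 + (v x).re ^ 2 := lt_of_le_of_ne (by positivity) h0.symm
    rw [div_le_iff₀ this]
    nlinarith

lemma IsModulus.im_eq_zero {u : Space d → ℂ} {g : Space d → EuclideanSpace ℂ (Fin d)}
    (h : IsModulus u g) (x : Space d) : (u x).im = 0 := by
  rw [h.eq_norm x, Complex.ofReal_im]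

lemma integrable_defect {u v : Space d → ℂ} {g₁ g₂ : Space d → EuclideanSpace ℂ (Fin d)}
    (hu : MemLp u 2 volume) (hg₁ : MemLp g₁ 2 volume) (hv : MemLp v 2 volume)
    (hg₂ : MemLp g₂ 2 volume) (hu' : ∀ x, (u x).im = 0) (hv' : ∀ x, (v x).im = 0)
    (h₁ : ∀ x i, (g₁ x i).im = 0) (h₂ : ∀ x i, (g₂ x i).im = 0) :
    Integrable (defect u v g₁ g₂) volume ∧
      (∫ x, ‖pairAbsGrad u v g₁ g₂ x‖ ^ 2) + ∫ x, defect u v g₁ g₂ x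
        ≤ (∫ x, ‖g₁ x‖ ^ 2) + ∫ x, ‖g₂ x‖ ^ 2 := by
  have hle := fun x => norm_pairAbsGrad_sq_add_defect_le (hu' x) (hv' x) (h₁ x) (h₂ x)
  have hi := (integrable_norm_sq hg₁).add (integrable_norm_sq hg₂)
  have hd : Integrable (defect u v g₁ g₂) volume := by
    refine hi.mono' ?_ (.of_forall fun x => ?_)
    · have m1 := ((hu.1.smul hg₂.1).sub (hv.1.smul hg₁.1)).norm.pow 2
      have m2 := (hu.1.norm.pow 2).add (hv.1.norm.pow 2)
      exact (m1.aemeasurable.div m2.aemeasurable).aestronglyMeasurable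
    · rw [Real.norm_of_nonneg (defect_nonneg _ _ _ _ x)]
      have := hle x
      simp only [Pi.add_apply]
      nlinarith [sq_nonneg ‖pairAbsGrad u v g₁ g₂ x‖]
  refine ⟨hd, ?_⟩
  have hp := integrable_norm_sq (memLp_pairAbsGrad hu hg₁ hv hg₂)
  rw [← integral_add hp hd, ← integral_add (integrable_norm_sq hg₁) (integrable_norm_sq hg₂)]
  exact integral_mono (hp.add hd) hi hle

end

/-! ### Comparison of two minimizers and a one-parameter variation -/

section

variable {d : ℕ}

lemma integral_norm_pairAbs_sq {V : Space d → ℝ} {u v : Space d → ℂ}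
    {g₁ g₂ : Space d → EuclideanSpace ℂ (Fin d)} (hu : FiniteEnergy V u g₁)
    (hv : FiniteEnergy V v g₂) :
    ∫ x, ‖pairAbs u v x‖ ^ 2 = (∫ x, ‖u x‖ ^ 2) + ∫ x, ‖v x‖ ^ 2 := by
  simp only [norm_pairAbs_sq]
  exact integral_add hu.integrable_sq hv.integrable_sq

lemma integral_potential_pairAbs {V : Space d → ℝ} {u v : Space d → ℂ}
    {g₁ g₂ : Space d → EuclideanSpace ℂ (Fin d)} (hu : FiniteEnergy V u g₁)
    (hv : FiniteEnergy V v g₂) :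
    ∫ x, V x * ‖pairAbs u v x‖ ^ 2 = (∫ x, V x * ‖u x‖ ^ 2) + ∫ x, V x * ‖v x‖ ^ 2 := by
  simp only [norm_pairAbs_sq, mul_add]
  exact integral_add hu.integrable_V hv.integrable_V

/-- Cauchy-Schwarz in the plane: the coupling energy does not increase under the combination of two
pairs. -/
lemma norm_pairAbs_mul_norm_pairAbs_ge (a a' b b' : Space d → ℂ) (x : Space d) :
    ‖a x‖ * ‖b x‖ + ‖a' x‖ * ‖b' x‖ ≤ ‖pairAbs a a' x‖ * ‖pairAbs b b' x‖ := by
  refine (pow_le_pow_iff_left₀ (by positivity) (by positivity) two_ne_zero).1 ?_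
  rw [mul_pow, norm_pairAbs_sq, norm_pairAbs_sq]
  nlinarith [sq_nonneg (‖a x‖ * ‖b' x‖ - ‖a' x‖ * ‖b x‖)]

/-- Two reduced ground states are pointwise proportional, and so are the gradients of their first
components. -/
lemma GPData.IsReducedGroundState.proportional {P : GPData d} {a b a' b' : Space d → ℂ}
    {ga gb ga' gb' : Space d → EuclideanSpace ℂ (Fin d)} {E : ℝ}
    (h : P.IsReducedGroundState a b ga gb E) (h' : P.IsReducedGroundState a' b' ga' gb' E)
    (hB : P.B.PosSemidef) (hΩ : P.Ω ≠ 0) :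
    (∀ᵐ x, ‖a x‖ * ‖b' x‖ = ‖a' x‖ * ‖b x‖) ∧ ∀ᵐ x, a x • ga' x = a' x • ga x := by
  have fa := h.finiteEnergy_a
  have fb := h.finiteEnergy_b
  have fa' := h'.finiteEnergy_a
  have fb' := h'.finiteEnergy_b
  have fU := fa.pairAbs fa'
  have fW := fb.pairAbs fb'
  have mU := integral_norm_pairAbs_sq fa fa'
  have mW := integral_norm_pairAbs_sq fb fb'
  have hm : (∫ x, ‖pairAbs a a' x‖ ^ 2) + ∫ x, ‖pairAbs b b' x‖ ^ 2 = 2 := by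
    rw [mU, mW]; linarith [h.mass, h'.mass]
  -- The combined pair has mass 2, so minimality reads 4E ≤ 2 · quadratic part + interaction.
  have hle := h.le fU fW (isModulus_pairAbs _ _ _ _) (isModulus_pairAbs _ _ _ _) two_pos hm
  obtain ⟨iD, kU⟩ := integrable_defect fa.memLp fa.memLp_grad fa'.memLp fa'.memLp_grad
    h.isModulus_a.im_eq_zero h'.isModulus_a.im_eq_zero h.isModulus_a.real h'.isModulus_a.real
  obtain ⟨iD', kW⟩ := integrable_defect fb.memLp fb.memLp_grad fb'.memLp fb'.memLp_grad
    h.isModulus_b.im_eq_zero h'.isModulus_b.im_eq_zero h.isModulus_b.real h'.isModulus_b.real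
  have nD' : 0 ≤ ∫ x, defect b b' gb gb' x := integral_nonneg (defect_nonneg _ _ _ _)
  have nD : 0 ≤ ∫ x, defect a a' ga ga' x := integral_nonneg (defect_nonneg _ _ _ _)
  have hj : ∀ x, 0 ≤ ‖pairAbs a a' x‖ * ‖pairAbs b b' x‖ - (‖a x‖ * ‖b x‖ + ‖a' x‖ * ‖b' x‖) :=
    fun x => sub_nonneg.2 (norm_pairAbs_mul_norm_pairAbs_ge a a' b b' x)
  have iUW := integrable_norm_mul_norm fU fW
  have iab := integrable_norm_mul_norm fa fb
  have iab' := integrable_norm_mul_norm fa' fb'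
  have iJ := iUW.sub (iab.fun_add iab')
  set J := ∫ x, (‖pairAbs a a' x‖ * ‖pairAbs b b' x‖ - (‖a x‖ * ‖b x‖ + ‖a' x‖ * ‖b' x‖)) with hJ
  have nJ : 0 ≤ J := integral_nonneg hj
  have eJ : J = (∫ x, ‖pairAbs a a' x‖ * ‖pairAbs b b' x‖)
      - ((∫ x, ‖a x‖ * ‖b x‖) + ∫ x, ‖a' x‖ * ‖b' x‖) := by
    rw [hJ, integral_sub iUW (iab.fun_add iab'), integral_add iab iab']
  have hI : P.interaction (pairAbs a a') (pairAbs b b')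
      ≤ 2 * P.interaction a b + 2 * P.interaction a' b' := by
    have ii : ∀ {u v : Space d → ℂ} {gu gv : Space d → EuclideanSpace ℂ (Fin d)},
        FiniteEnergy P.Vu u gu → FiniteEnergy P.Vd v gv → Integrable (fun x =>
          1 / 2 * P.βuu * ‖u x‖ ^ 4 + 1 / 2 * P.βdd * ‖v x‖ ^ 4
            + P.βud * (‖u x‖ ^ 2 * ‖v x‖ ^ 2)) volume := fun hu hv =>
      ((hu.integrable_four.const_mul _).fun_add (hv.integrable_four.const_mul _)).fun_add
        ((hu.integrable_sq_mul_sq hv).const_mul _)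
    rw [GPData.interaction_eq_integral fU fW, GPData.interaction_eq_integral fa fb,
      GPData.interaction_eq_integral fa' fb', ← integral_const_mul, ← integral_const_mul,
      ← integral_add ((ii fa fb).const_mul _) ((ii fa' fb').const_mul _)]
    refine integral_mono (ii fU fW) (((ii fa fb).const_mul _).fun_add ((ii fa' fb').const_mul _))
      fun x => ?_
    have e4 : ∀ r : ℝ, r ^ 4 = (r ^ 2) ^ 2 := fun r => by ring
    simp only [e4, norm_pairAbs_sq]
    -- Parallelogram identity: for a quadratic form q, 2q(x) + 2q(y) - q(x + y) = q(x - y) ≥ 0,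
    -- applied to the densities.
    have := GPData.quadForm_nonneg hB (‖a x‖ ^ 2 - ‖a' x‖ ^ 2) (‖b x‖ ^ 2 - ‖b' x‖ ^ 2)
    nlinarith
  have hQ : P.quadPart (pairAbs a a') (pairAbs b b') (pairAbsGrad a a' ga ga')
      (pairAbsGrad b b' gb gb') ≤ P.quadPart a b ga gb + P.quadPart a' b' ga' gb'
        - 1 / 2 * (∫ x, defect a a' ga ga' x) - |P.Ω| * J := by
    simp only [GPData.quadPart]
    rw [mU, mW, integral_potential_pairAbs fa fa', integral_potential_pairAbs fb fb', eJ]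
    linarith
  have hΩ' : 0 < |P.Ω| := abs_pos.2 hΩ
  -- The energies cancel exactly, leaving only the nonnegative losses in the kinetic and coupling
  -- terms, which must both vanish.
  have hsum : (∫ x, defect a a' ga ga' x) + 2 * (|P.Ω| * J) ≤ 0 := by
    linarith [h.energy, h'.energy]
  have hΩJ : 0 ≤ |P.Ω| * J := by positivity
  have hD0 : ∫ x, defect a a' ga ga' x = 0 := by linarith
  have hJ0 : J = 0 := by
    have : |P.Ω| * J = 0 := by linarith
    simpa [hΩ] using this
  constructor
  · filter_upwards [(integral_eq_zero_iff_of_nonneg hj iJ).1 hJ0] with x hx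
    have h1 : ‖pairAbs a a' x‖ * ‖pairAbs b b' x‖ = ‖a x‖ * ‖b x‖ + ‖a' x‖ * ‖b' x‖ := by
      simpa [sub_eq_zero] using hx
    have h2 := congrArg (· ^ 2) h1
    simp only [mul_pow, norm_pairAbs_sq] at h2
    -- Equality in Cauchy-Schwarz.
    have h3 : (‖a x‖ * ‖b' x‖ - ‖a' x‖ * ‖b x‖) ^ 2 = 0 := by linarith
    exact sub_eq_zero.1 (by simpa using h3)
  · filter_upwards [(integral_eq_zero_iff_of_nonneg (defect_nonneg _ _ _ _) iD).1 hD0] with x hx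
    simp only [defect, Pi.zero_apply, div_eq_zero_iff, pow_eq_zero_iff two_ne_zero,
      norm_eq_zero, sub_eq_zero] at hx
    rcases hx with hx | hx
    · exact hx
    · have h1 : a x = 0 := by
        rw [← norm_eq_zero]; nlinarith [sq_nonneg ‖a x‖, sq_nonneg ‖a' x‖]
      have h2 : a' x = 0 := by
        rw [← norm_eq_zero]; nlinarith [sq_nonneg ‖a x‖, sq_nonneg ‖a' x‖]
      simp [h1, h2]

lemma cgrad_ofReal_im {η : Space d → ℝ} (hη : ContDiff ℝ ∞ η) (x : Space d) (i : Fin d) :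
    (cgrad (fun x => (η x : ℂ)) x i).im = 0 := by
  have h := Complex.ofRealCLM.hasFDerivAt.comp x (hη.differentiable (by simp) x).hasFDerivAt
  have h2 : fderiv ℝ (fun x => (η x : ℂ)) x = _ := h.fderiv
  rw [cgrad_apply, h2]
  simp

/-- Comparison of a reduced ground state `(a, b)` with `(√(a² + t η²), b)`. -/
lemma GPData.IsReducedGroundState.exists_variation_le {P : GPData d} {a b : Space d → ℂ}
    {ga gb : Space d → EuclideanSpace ℂ (Fin d)} {E : ℝ}
    (h : P.IsReducedGroundState a b ga gb E) (hVu : LocallyIntegrable P.Vu volume)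
    {η : Space d → ℝ} (hη : ContDiff ℝ ∞ η) (hc : HasCompactSupport η) :
    ∃ C : ℝ, ∀ t : ℝ, 0 < t → t ≤ 1 →
      Integrable (defect a (fun x => ((√t : ℝ) : ℂ) * (η x : ℂ)) ga
        (fun x => ((√t : ℝ) : ℂ) • cgrad (fun x => (η x : ℂ)) x)) volume ∧
      1 / 2 * (∫ x, defect a (fun x => ((√t : ℝ) : ℂ) * (η x : ℂ)) ga
        (fun x => ((√t : ℝ) : ℂ) • cgrad (fun x => (η x : ℂ)) x) x)
      + |P.Ω| * (∫ x, (‖pairAbs a (fun x => ((√t : ℝ) : ℂ) * (η x : ℂ)) x‖ - ‖a x‖) * ‖b x‖)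
        ≤ C * t := by
  have fa := h.finiteEnergy_a
  have fb := h.finiteEnergy_b
  have hηc : ContDiff ℝ ∞ fun x => (η x : ℂ) := Complex.ofRealCLM.contDiff.comp hη
  have fη := FiniteEnergy.of_test hVu (hηc.of_le (by simp))
    (hc.comp_left (g := fun r : ℝ => (r : ℂ)) rfl)
  set m := ∫ x, ‖(η x : ℂ)‖ ^ 2 with hm
  set k := ∫ x, ‖cgrad (fun x => (η x : ℂ)) x‖ ^ 2 with hk
  set n := ∫ x, P.Vu x * ‖(η x : ℂ)‖ ^ 2 with hn
  set N := ∫ x, ‖(η x : ℂ)‖ ^ 4 with hN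
  set X := ∫ x, ‖a x‖ ^ 2 * ‖(η x : ℂ)‖ ^ 2 with hX
  set Y := ∫ x, ‖(η x : ℂ)‖ ^ 2 * ‖b x‖ ^ 2 with hY
  set Q := P.quadPart a b ga gb with hQ
  set R := P.interaction a b with hR
  set q := 1 / 2 * k + n + P.δ / 2 * m with hq
  set r := P.βuu * X + P.βud * Y with hr
  -- The coefficients of t and of t² in the expansion of the minimality inequality; t² ≤ t since t ≤
  -- 1.
  refine ⟨|q + Q * m + r - 2 * E * m| + |q * m + 1 / 2 * P.βuu * N - E * m ^ 2|,
    fun t ht ht1 => ?_⟩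
  have fw := fη.const_mul ((√t : ℝ) : ℂ)
  set w : Space d → ℂ := fun x => ((√t : ℝ) : ℂ) * (η x : ℂ) with hw
  set gw : Space d → EuclideanSpace ℂ (Fin d) :=
    fun x => ((√t : ℝ) : ℂ) • cgrad (fun x => (η x : ℂ)) x with hgw
  have hst : ‖((√t : ℝ) : ℂ)‖ ^ 2 = t := by
    rw [Complex.norm_real, Real.norm_eq_abs, sq_abs, Real.sq_sqrt ht.le]
  have hw2 : ∀ x, ‖w x‖ ^ 2 = t * ‖(η x : ℂ)‖ ^ 2 := fun x => by rw [hw, norm_mul, mul_pow, hst]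
  have hgw2 : ∀ x, ‖gw x‖ ^ 2 = t * ‖cgrad (fun x => (η x : ℂ)) x‖ ^ 2 := fun x => by
    rw [hgw, norm_smul, mul_pow, hst]
  have im_w : ∀ x, (w x).im = 0 := fun x => by simp [hw]
  have im_gw : ∀ x i, (gw x i).im = 0 := fun x i => by
    simp only [hgw, PiLp.smul_apply, smul_eq_mul, Complex.im_ofReal_mul, cgrad_ofReal_im hη,
      mul_zero]
  obtain ⟨iD, hD⟩ := integrable_defect fa.memLp fa.memLp_grad fw.memLp fw.memLp_grad
    h.isModulus_a.im_eq_zero im_w h.isModulus_a.real im_gw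
  refine ⟨iD, ?_⟩
  have fU := fa.pairAbs fw
  have iUb := integrable_norm_mul_norm fU fb
  have iab := integrable_norm_mul_norm fa fb
  set D := ∫ x, defect a w ga gw x with hDdef
  set J := ∫ x, (‖pairAbs a w x‖ - ‖a x‖) * ‖b x‖ with hJdef
  have eJ : J = (∫ x, ‖pairAbs a w x‖ * ‖b x‖) - ∫ x, ‖a x‖ * ‖b x‖ := by
    rw [hJdef, ← integral_sub iUb iab]
    simp only [sub_mul]
  have nD : 0 ≤ D := integral_nonneg (defect_nonneg _ _ _ _)
  have nJ : 0 ≤ J := integral_nonneg fun x => by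
    refine mul_nonneg (sub_nonneg.2 ?_) (norm_nonneg _)
    refine (pow_le_pow_iff_left₀ (norm_nonneg _) (norm_nonneg _) two_ne_zero).1 ?_
    rw [norm_pairAbs_sq]
    linarith [sq_nonneg ‖w x‖]
  have ew : ∫ x, ‖w x‖ ^ 2 = t * m := by simp only [hw2, integral_const_mul, hm]
  have egw : ∫ x, ‖gw x‖ ^ 2 = t * k := by simp only [hgw2, integral_const_mul, hk]
  have eVw : ∫ x, P.Vu x * ‖w x‖ ^ 2 = t * n := by
    rw [hn, ← integral_const_mul]
    refine integral_congr_ae (.of_forall fun x => ?_)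
    simp only [hw2]; ring
  have hmU := integral_norm_pairAbs_sq fa fw
  have hmass : (∫ x, ‖pairAbs a w x‖ ^ 2) + ∫ x, ‖b x‖ ^ 2 = 1 + t * m := by
    rw [hmU, ew]; linarith [h.mass]
  have nm : 0 ≤ m := integral_nonneg fun x => by positivity
  have htm : 0 ≤ t * m := by positivity
  have hle := h.le fU fb (isModulus_pairAbs _ _ _ _) h.isModulus_b (by linarith) hmass
  have hquad : P.quadPart (pairAbs a w) b (pairAbsGrad a w ga gw) gb
      ≤ Q + t * q - (1 / 2 * D + |P.Ω| * J) := by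
    rw [hQ, GPData.quadPart, GPData.quadPart, hmU, ew, integral_potential_pairAbs fa fw, eVw, eJ,
      hq]
    rw [egw] at hD
    linarith
  have hinter : P.interaction (pairAbs a w) b
      = R + t * r + t ^ 2 * (1 / 2 * P.βuu * N) := by
    have e4 : ∫ x, ‖pairAbs a w x‖ ^ 4 = (∫ x, ‖a x‖ ^ 4) + 2 * t * X + t ^ 2 * N := by
      have e : ∀ x, ‖pairAbs a w x‖ ^ 4 = ‖a x‖ ^ 4 + 2 * t * (‖a x‖ ^ 2 * ‖(η x : ℂ)‖ ^ 2)
          + t ^ 2 * ‖(η x : ℂ)‖ ^ 4 := fun x => by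
        rw [show ‖pairAbs a w x‖ ^ 4 = (‖pairAbs a w x‖ ^ 2) ^ 2 by ring, norm_pairAbs_sq, hw2]
        ring
      simp only [e]
      rw [integral_add (fa.integrable_four.fun_add ((fa.integrable_sq_mul_sq fη).const_mul _))
        (fη.integrable_four.const_mul _), integral_add fa.integrable_four
        ((fa.integrable_sq_mul_sq fη).const_mul _), integral_const_mul, integral_const_mul]
    have e2 : ∫ x, ‖pairAbs a w x‖ ^ 2 * ‖b x‖ ^ 2 = (∫ x, ‖a x‖ ^ 2 * ‖b x‖ ^ 2) + t * Y := by
      have e : ∀ x, ‖pairAbs a w x‖ ^ 2 * ‖b x‖ ^ 2 = ‖a x‖ ^ 2 * ‖b x‖ ^ 2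
          + t * (‖(η x : ℂ)‖ ^ 2 * ‖b x‖ ^ 2) := fun x => by
        rw [norm_pairAbs_sq, hw2]; ring
      simp only [e]
      rw [integral_add (fa.integrable_sq_mul_sq fb) ((fη.integrable_sq_mul_sq fb).const_mul _),
        integral_const_mul]
    rw [hR, GPData.interaction, GPData.interaction, e4, e2, hr]
    ring
  set T := 1 / 2 * D + |P.Ω| * J with hT
  have nT : 0 ≤ T := by positivity
  have hE : E = Q + R := h.energy.symm
  have h1 : E * (1 + t * m) ^ 2 ≤ (Q + t * q - T) * (1 + t * m) + (R + t * r
      + t ^ 2 * (1 / 2 * P.βuu * N)) := by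
    rw [← hinter]
    exact hle.trans (by gcongr)
  -- The mass of the competitor is 1 + tm ≥ 1, so the factor it puts on the gain `T` can be dropped.
  have h2 : T ≤ T * (1 + t * m) := le_mul_of_one_le_right nT (by linarith)
  have h3 : T * (1 + t * m) ≤ t * (q + Q * m + r - 2 * E * m)
      + t ^ 2 * (q * m + 1 / 2 * P.βuu * N - E * m ^ 2) := by
    have : R = E - Q := by linarith
    rw [this] at h1
    linarith
  have h4 : t * (q + Q * m + r - 2 * E * m) ≤ t * |q + Q * m + r - 2 * E * m| := by
    gcongr; exact le_abs_self _
  have h5 : t ^ 2 * (q * m + 1 / 2 * P.βuu * N - E * m ^ 2)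
      ≤ t * |q * m + 1 / 2 * P.βuu * N - E * m ^ 2| := by
    have : t ^ 2 ≤ t := pow_le_of_le_one ht.le ht1 two_ne_zero
    calc _ ≤ t ^ 2 * |q * m + 1 / 2 * P.βuu * N - E * m ^ 2| := by gcongr; exact le_abs_self _
      _ ≤ _ := by gcongr
  linarith

end

/-! ### Logarithmic gradient and constancy of the ratio -/

section

variable {d : ℕ}

/-- A function with vanishing weak gradient is constant. -/
lemma ae_const_of_isWeakGrad_zero {f : Space d → ℂ} (hf : LocallyIntegrable f volume)
    (h : IsWeakGrad f 0) : ∃ c : ℂ, ∀ᵐ x, f x = c := by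
  -- Lebesgue differentiation recovers `f` almost everywhere from its mollifications, each of which
  -- is smooth with zero gradient and hence constant.
  have hae := ContDiffBump.ae_convolution_tendsto_right_of_locallyIntegrable (μ := volume)
    (φ := mollifier d) (K := 2) (tendsto_mollifier_rOut d) (.of_forall fun n => by
      change 2 / ((n : ℝ) + 1) ≤ 2 * (1 / ((n : ℝ) + 1))
      rw [mul_one_div]) hf
  have hconst : ∀ n x y,
      ((mollifier d n).normed volume ⋆[ContinuousLinearMap.lsmul ℝ ℝ, volume] f) x
        = ((mollifier d n).normed volume ⋆[ContinuousLinearMap.lsmul ℝ ℝ, volume] f) y := by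
    intro n
    have hs : ContDiff ℝ ∞
        ((mollifier d n).normed volume ⋆[ContinuousLinearMap.lsmul ℝ ℝ, volume] f) :=
      (mollifier d n).hasCompactSupport_normed.contDiff_convolution_left _
        (mollifier d n).contDiff_normed hf
    refine is_const_of_fderiv_eq_zero (𝕜 := ℝ) (hs.differentiable (by simp)) fun x => ?_
    rw [← norm_le_zero_iff]
    refine (norm_fderiv_le_norm_cgrad _ x).trans ?_
    rw [cgrad_mollify (mollifier d n) h hf locallyIntegrable_zero]
    simp [convolution]
  obtain ⟨x₀, hx₀⟩ := hae.exists
  refine ⟨f x₀, hae.mono fun x hx => ?_⟩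
  exact tendsto_nhds_unique hx (hx₀.congr fun n => hconst n x₀ x)

/-- Fatou's lemma. -/
lemma integrable_of_tendsto_of_integral_le {F : ℕ → Space d → ℝ} {f : Space d → ℝ}
    (h0 : ∀ n x, 0 ≤ F n x) (hF : ∀ n, Integrable (F n) volume) {C : ℝ}
    (hC : ∀ n, ∫ x, F n x ≤ C) (hlim : ∀ᵐ x, Tendsto (fun n => F n x) atTop (𝓝 (f x))) :
    Integrable f volume := by
  have hm : AEStronglyMeasurable f volume :=
    aestronglyMeasurable_of_tendsto_ae atTop (fun n => (hF n).1) hlim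
  have hf0 : ∀ᵐ x, 0 ≤ f x := hlim.mono fun x hx => ge_of_tendsto' hx fun n => h0 n x
  refine ⟨hm, ?_⟩
  rw [hasFiniteIntegral_iff_ofReal hf0]
  calc ∫⁻ x, ENNReal.ofReal (f x)
      = ∫⁻ x, liminf (fun n => ENNReal.ofReal (F n x)) atTop := by
        refine lintegral_congr_ae (hlim.mono fun x hx => ?_)
        exact (ENNReal.tendsto_ofReal hx).liminf_eq.symm
    _ ≤ liminf (fun n => ∫⁻ x, ENNReal.ofReal (F n x)) atTop :=
        lintegral_liminf_le' fun n => (hF n).1.aemeasurable.ennreal_ofReal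
    _ ≤ liminf (fun _ : ℕ => ENNReal.ofReal C) atTop := by
        refine liminf_le_liminf (.of_forall fun n => ?_)
        rw [← ofReal_integral_eq_lintegral_ofReal (hF n) (.of_forall (h0 n))]
        exact ENNReal.ofReal_le_ofReal (hC n)
    _ < ⊤ := by simp

/-- The logarithmic gradient of a reduced ground state is locally integrable. -/
lemma GPData.IsReducedGroundState.locallyIntegrable_log {P : GPData d} {a b : Space d → ℂ}
    {ga gb : Space d → EuclideanSpace ℂ (Fin d)} {E : ℝ}
    (h : P.IsReducedGroundState a b ga gb E) (hVu : LocallyIntegrable P.Vu volume) :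
    LocallyIntegrable (fun x => ‖ga x‖ / ‖a x‖) volume := by
  rw [locallyIntegrable_iff]
  intro K hK
  obtain ⟨R, hR⟩ := hK.isBounded.subset_closedBall (0 : Space d)
  let η : ContDiffBump (0 : Space d) := ⟨|R| + 1, |R| + 2, by positivity, by linarith⟩
  have hη : ContDiff ℝ ∞ η := η.contDiff
  obtain ⟨C, hC⟩ := h.exists_variation_le hVu hη η.hasCompactSupport
  set Dη : Space d → EuclideanSpace ℂ (Fin d) := cgrad (fun x => (η x : ℂ)) with hDη
  have fa := h.finiteEnergy_a
  have fb := h.finiteEnergy_b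
  let t : ℕ → ℝ := fun n => 1 / ((n : ℝ) + 1)
  have ht : ∀ n, 0 < t n := fun n => by positivity
  have ht1 : ∀ n, t n ≤ 1 := fun n => by
    simp only [t]
    rw [div_le_one (by positivity)]
    linarith [Nat.cast_nonneg (α := ℝ) n]
  have hst : ∀ n, ‖((√(t n) : ℝ) : ℂ)‖ ^ 2 = t n := fun n => by
    rw [Complex.norm_real, Real.norm_eq_abs, sq_abs, Real.sq_sqrt (ht n).le]
  have hdef : ∀ n x, defect a (fun x => ((√(t n) : ℝ) : ℂ) * (η x : ℂ)) ga
      (fun x => ((√(t n) : ℝ) : ℂ) • Dη x) x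
      = t n * (‖a x • Dη x - (η x : ℂ) • ga x‖ ^ 2 / (‖a x‖ ^ 2 + t n * ‖(η x : ℂ)‖ ^ 2)) := by
    intro n x
    have e : a x • ((√(t n) : ℝ) : ℂ) • Dη x - (((√(t n) : ℝ) : ℂ) * (η x : ℂ)) • ga x
        = ((√(t n) : ℝ) : ℂ) • (a x • Dη x - (η x : ℂ) • ga x) := by
      rw [smul_sub, smul_comm, mul_smul]
    rw [defect, e, norm_smul, mul_pow, hst, norm_mul, mul_pow, hst, mul_div_assoc]
  let F : ℕ → Space d → ℝ := fun n x =>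
    ‖a x • Dη x - (η x : ℂ) • ga x‖ ^ 2 / (‖a x‖ ^ 2 + t n * ‖(η x : ℂ)‖ ^ 2)
  have hFd : ∀ n, F n = fun x => (t n)⁻¹ * defect a (fun x => ((√(t n) : ℝ) : ℂ) * (η x : ℂ)) ga
      (fun x => ((√(t n) : ℝ) : ℂ) • Dη x) x := fun n => by
    ext x
    rw [hdef, ← mul_assoc, inv_mul_cancel₀ (ht n).ne', one_mul]
  -- The defect of the variation is at most 2Ct; dividing by t and letting t → 0 gives a bound on
  -- a∇η - η∇a relative to a.
  have hint : Integrable (fun x => ‖a x • Dη x - (η x : ℂ) • ga x‖ ^ 2 / ‖a x‖ ^ 2) volume := by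
    refine integrable_of_tendsto_of_integral_le (F := F) (C := 2 * C)
      (fun n x => div_nonneg (by positivity) (add_nonneg (by positivity)
        (mul_nonneg (ht n).le (by positivity)))) (fun n => ?_) (fun n => ?_)
      (.of_forall fun x => ?_)
    · rw [hFd]
      exact (hC (t n) (ht n) (ht1 n)).1.const_mul _
    · have h1 := (hC (t n) (ht n) (ht1 n)).2
      have h2 : 0 ≤ |P.Ω| * (∫ x, (‖pairAbs a (fun x => ((√(t n) : ℝ) : ℂ) * (η x : ℂ)) x‖ - ‖a x‖)
          * ‖b x‖) := by
        refine mul_nonneg (abs_nonneg _) (integral_nonneg fun x => mul_nonneg (sub_nonneg.2 ?_)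
          (norm_nonneg _))
        refine (pow_le_pow_iff_left₀ (norm_nonneg _) (norm_nonneg _) two_ne_zero).1 ?_
        rw [norm_pairAbs_sq]
        exact le_add_of_nonneg_right (by positivity)
      rw [hFd, integral_const_mul, inv_mul_le_iff₀ (ht n)]
      linarith
    -- Where a vanishes so does its gradient, hence the numerator, and every term of the sequence is
    -- 0.
    · by_cases hx : a x = 0
      · simp [F, hx, h.isModulus_a.zero x hx]
      · refine tendsto_const_nhds.div ?_ (by positivity)
        have h1 := ((tendsto_one_div_add_atTop_nhds_zero_nat (𝕜 := ℝ)).mul_const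
          (‖(η x : ℂ)‖ ^ 2)).const_add (‖a x‖ ^ 2)
        simpa only [zero_mul, add_zero] using h1
  have hcont : Continuous fun x => 1 + ‖Dη x‖ :=
    continuous_const.add (continuous_cgrad ((Complex.ofRealCLM.contDiff.comp hη).of_le
      (by simp))).norm
  have hbound : IntegrableOn (fun x => (1 + ‖Dη x‖)
      + ‖a x • Dη x - (η x : ℂ) • ga x‖ ^ 2 / ‖a x‖ ^ 2) K volume :=
    (hcont.locallyIntegrable.integrableOn_isCompact hK).add hint.integrableOn
  refine Integrable.mono' hbound (fa.memLp_grad.1.norm.aemeasurable.div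
    fa.memLp.1.norm.aemeasurable).aestronglyMeasurable.restrict ?_
  filter_upwards [ae_restrict_mem hK.measurableSet] with x hx
  have hη1 : η x = 1 := η.one_of_mem_closedBall (by
    have := hR hx
    rw [mem_closedBall_zero_iff] at this ⊢
    linarith [le_abs_self R])
  rw [Real.norm_of_nonneg (by positivity)]
  by_cases hx0 : a x = 0
  · rw [hx0, norm_zero, div_zero]
    positivity
  · have hpos : 0 < ‖a x‖ := norm_pos_iff.2 hx0
    rw [hη1, Complex.ofReal_one, one_smul]
    have h1 : ‖ga x‖ ≤ ‖a x • Dη x - ga x‖ + ‖a x‖ * ‖Dη x‖ := by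
      rw [← norm_smul]
      have : ga x = a x • Dη x - (a x • Dη x - ga x) := by abel
      calc ‖ga x‖ = ‖a x • Dη x - (a x • Dη x - ga x)‖ := by rw [← this]
        _ ≤ ‖a x • Dη x‖ + ‖a x • Dη x - ga x‖ := norm_sub_le _ _
        _ = _ := add_comm _ _
    have h2 : ‖ga x‖ / ‖a x‖ ≤ ‖a x • Dη x - ga x‖ / ‖a x‖ + ‖Dη x‖ := by
      rw [div_le_iff₀ hpos, add_mul, div_mul_cancel₀ _ hpos.ne']
      linarith
    -- The elementary bound s ≤ 1 + s² passes from the square-integrable quotient to a locally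
    -- integrable one.
    have h3 : ‖a x • Dη x - ga x‖ / ‖a x‖ ≤ 1 + (‖a x • Dη x - ga x‖ / ‖a x‖) ^ 2 := by
      nlinarith [sq_nonneg (‖a x • Dη x - ga x‖ / ‖a x‖ - 1)]
    rw [← div_pow]
    linarith

/-- The regularized normalization `p.1 / |p|`. -/
noncomputable def regDir (ε : ℝ) (p : ℂ × ℂ) : ℂ := (regAbs ε p)⁻¹ • p.1

lemma contDiff_regDir {ε : ℝ} (hε : 0 < ε) : ContDiff ℝ 1 (regDir ε) :=
  (((contDiff_regAbs hε).of_le (by simp)).inv fun p => (regAbs_pos hε p).ne').smul contDiff_fst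

lemma fderiv_regDir {ε : ℝ} (hε : 0 < ε) (p q : ℂ × ℂ) :
    fderiv ℝ (regDir ε) p q = (regAbs ε p)⁻¹ • q.1
      - ((innerPair p q / regAbs ε p) / regAbs ε p ^ 2) • p.1 := by
  have h0 := (regAbs_pos hε p).ne'
  have h1 := (hasDerivAt_inv h0).comp_hasFDerivAt p (hasFDerivAt_regAbs hε p)
  have h2 : HasFDerivAt (regDir ε) _ p := h1.smul (hasFDerivAt_fst (𝕜 := ℝ) (p := p))
  rw [h2.fderiv]
  simp only [add_apply, smul_apply, ContinuousLinearMap.smulRight_apply,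
    ContinuousLinearMap.coe_fst', Function.comp_apply, smul_eq_mul]
  rw [sub_eq_add_neg, ← neg_smul]
  congr 2
  field_simp

lemma le_regAbs {ε : ℝ} (p : ℂ × ℂ) : ‖p.1‖ ≤ regAbs ε p :=
  Real.le_sqrt_of_sq_le (by nlinarith [sq_nonneg ‖p.2‖, sq_nonneg ε])

lemma le_regAbs' {ε : ℝ} (p : ℂ × ℂ) : ε ≤ regAbs ε p :=
  Real.le_sqrt_of_sq_le (by nlinarith [sq_nonneg ‖p.2‖, sq_nonneg ‖p.1‖])

/-- The bound blows up as ε → 0. It only licenses the chain rule at fixed ε; the limit uses the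
explicit gradient instead. -/
lemma norm_fderiv_regDir_le {ε : ℝ} (hε : 0 < ε) (p : ℂ × ℂ) :
    ‖fderiv ℝ (regDir ε) p‖ ≤ 2 * ε⁻¹ * 2 := by
  refine norm_fderiv_le_of_pair (by positivity) fun z w => ?_
  have hr := regAbs_pos hε p
  have h1 : (regAbs ε p)⁻¹ ≤ ε⁻¹ := inv_anti₀ hε (le_regAbs' p)
  rw [fderiv_regDir hε]
  refine (norm_sub_le _ _).trans ?_
  rw [norm_smul, norm_smul, norm_div, norm_inv, norm_pow, Real.norm_of_nonneg hr.le]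
  have h2 := abs_innerPair_div_regAbs_le hε p z w
  have h3 : ‖innerPair p (z, w) / regAbs ε p‖ / regAbs ε p ^ 2 * ‖p.1‖
      ≤ (‖z‖ + ‖w‖) * ε⁻¹ := by
    calc ‖innerPair p (z, w) / regAbs ε p‖ / regAbs ε p ^ 2 * ‖p.1‖
        ≤ (‖z‖ + ‖w‖) / regAbs ε p ^ 2 * regAbs ε p := by
          gcongr
          · exact h2
          · exact le_regAbs p
      _ = (‖z‖ + ‖w‖) * (regAbs ε p)⁻¹ := by field_simp
      _ ≤ _ := by gcongr
  have h4 : (regAbs ε p)⁻¹ * ‖z‖ ≤ ε⁻¹ * (‖z‖ + ‖w‖) := by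
    gcongr
    linarith [norm_nonneg w]
  linarith

/-- If `a∇a' = a'∇a`, then the regularized direction of `(a, a')` has an explicit small gradient. -/
lemma chainGrad_regDir {a a' : Space d → ℂ} {ga ga' : Space d → EuclideanSpace ℂ (Fin d)}
    (h : IsModulus a ga) (h' : IsModulus a' ga') {x : Space d} (hx : a x • ga' x = a' x • ga x)
    {ε : ℝ} (hε : 0 < ε) (i : Fin d) :
    chainGrad (regDir ε) a a' ga ga' x i = (ε ^ 2 / regAbs ε (a x, a' x) ^ 3) • ga x i := by
  have hr := (regAbs_pos hε (a x, a' x)).ne'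
  have hxi : a x * ga' x i = a' x * ga x i := by
    have := congrArg (fun z : EuclideanSpace ℂ (Fin d) => z i) hx
    simpa using this
  have hre : ∀ z : ℂ, z.im = 0 → z = (z.re : ℂ) := fun z hz => by
    apply Complex.ext <;> simp [hz]
  have ea := hre _ (h.im_eq_zero x)
  have eg := hre _ (h.real x i)
  change fderiv ℝ (regDir ε) (a x, a' x) (ga x i, ga' x i) = _
  rw [fderiv_regDir hε]
  have hin : innerPair (a x, a' x) (ga x i, ga' x i)
      = (a x).re * (ga x i).re + (a' x).re * (ga' x i).re := by
    rw [innerPair_apply]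
    simp only [Complex.inner, Complex.mul_re, Complex.conj_re, Complex.conj_im, h.im_eq_zero x,
      h'.im_eq_zero x]
    ring
  have hsq : regAbs ε (a x, a' x) ^ 2 = (a x).re ^ 2 + (a' x).re ^ 2 + ε ^ 2 := by
    rw [regAbs_sq]
    simp only [Complex.sq_norm, Complex.normSq_apply, h.im_eq_zero x, h'.im_eq_zero x]
    ring
  have hxr : (a x).re * (ga' x i).re = (a' x).re * (ga x i).re := by
    simpa [h.im_eq_zero x, h'.im_eq_zero x] using congrArg Complex.re hxi
  set r := regAbs ε (a x, a' x) with hrdef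
  rw [hin]
  rw [ea, eg]
  simp only [Complex.ofReal_re, Complex.real_smul]
  norm_cast
  -- Proportionality of the gradients turns a(a∇a + a'∇a') into (a² + a'²)∇a, so the two terms of
  -- the derivative cancel up to ε²∇a / r³.
  have : (a x).re * ((a x).re * (ga x i).re + (a' x).re * (ga' x i).re)
      = ((a x).re ^ 2 + (a' x).re ^ 2) * (ga x i).re := by
    calc _ = (a x).re ^ 2 * (ga x i).re + (a' x).re * ((a x).re * (ga' x i).re) := by ring
      _ = _ := by rw [hxr]; ring
  have e3 : ε ^ 2 = r ^ 2 - ((a x).re ^ 2 + (a' x).re ^ 2) := by rw [hsq]; ring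
  rw [e3]
  field_simp
  linear_combination (-1 : ℝ) * this

/-- The direction of `(a, a')` is constant if `a∇a' = a'∇a` and `∇a / a` is locally integrable. -/
lemma ratio_ae_const {a a' : Space d → ℂ} {ga ga' : Space d → EuclideanSpace ℂ (Fin d)}
    (ha : MemLp a 2 volume) (hga : MemLp ga 2 volume) (hw : IsWeakGrad a ga)
    (ha' : MemLp a' 2 volume) (hga' : MemLp ga' 2 volume) (hw' : IsWeakGrad a' ga')
    (h : IsModulus a ga) (h' : IsModulus a' ga')
    (hlog : LocallyIntegrable (fun x => ‖ga x‖ / ‖a x‖) volume)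
    (hprop : ∀ᵐ x, a x • ga' x = a' x • ga x) :
    ∃ c : ℂ, ∀ᵐ x, (√(‖a x‖ ^ 2 + ‖a' x‖ ^ 2))⁻¹ • a x = c := by
  let ε : ℕ → ℝ := fun n => 1 / ((n : ℝ) + 1)
  have hε : ∀ n, 0 < ε n := fun n => by positivity
  have hm : ∀ n, AEStronglyMeasurable (fun x => regDir (ε n) (a x, a' x)) volume := fun n =>
    (contDiff_regDir (hε n)).continuous.comp_aestronglyMeasurable (ha.1.prodMk ha'.1)
  have hb : ∀ n x, ‖regDir (ε n) (a x, a' x)‖ ≤ 1 := fun n x => by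
    have hr := regAbs_pos (hε n) (a x, a' x)
    rw [regDir, norm_smul, norm_inv, Real.norm_of_nonneg hr.le, inv_mul_le_iff₀ hr, mul_one]
    exact le_regAbs (a x, a' x)
  have hl : ∀ x, Tendsto (fun n => regDir (ε n) (a x, a' x)) atTop
      (𝓝 ((√(‖a x‖ ^ 2 + ‖a' x‖ ^ 2))⁻¹ • a x)) := fun x => by
    by_cases hx : a x = 0
    · simp [regDir, hx]
    · refine ((tendsto_regAbs (a x, a' x)).inv₀ ?_).smul_const _
      exact (Real.sqrt_pos.2 (by positivity)).ne'
  have hmlim : AEStronglyMeasurable (fun x => (√(‖a x‖ ^ 2 + ‖a' x‖ ^ 2))⁻¹ • a x) volume :=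
    aestronglyMeasurable_of_tendsto_ae atTop hm (.of_forall hl)
  refine ae_const_of_isWeakGrad_zero ?_ ?_
  · refine (locallyIntegrable_const (1 : ℝ)).mono hmlim (.of_forall fun x => ?_)
    rw [norm_one]
    exact le_of_tendsto' (hl x).norm fun n => hb n x
  · refine IsWeakGrad.of_tendsto (fun n => isWeakGrad_chain (contDiff_regDir (hε n))
      (norm_fderiv_regDir_le (hε n)) ha hga hw ha' hga' hw') ?_ ?_
    · intro η hη hc
      exact tendsto_integral_test_of_dominated hm (locallyIntegrable_const (1 : ℝ))
        (fun n => .of_forall (hb n)) (.of_forall hl) hη.continuous hc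
    · intro η hη hc i
      -- Since ε ≤ r and |a| ≤ r, the factor ε²/r³ is at most 1/|a|: the logarithmic gradient
      -- dominates, and pointwise the gradients tend to 0.
      refine tendsto_integral_test_of_dominated (fun n => (memLp_apply (memLp_chainGrad
        (contDiff_regDir (hε n)) (norm_fderiv_regDir_le (hε n)) ha hga ha' hga') i).1) hlog
        (fun n => ?_) ?_ hη.continuous hc
      · filter_upwards [hprop] with x hx
        rw [chainGrad_regDir h h' hx (hε n)]
        by_cases hx0 : a x = 0
        · simp [h.zero x hx0]
        · have hr := regAbs_pos (hε n) (a x, a' x)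
          have hp : 0 < ‖a x‖ := norm_pos_iff.2 hx0
          rw [norm_smul, Real.norm_of_nonneg (by positivity), div_eq_inv_mul ‖ga x‖]
          gcongr
          · calc ε n ^ 2 / regAbs (ε n) (a x, a' x) ^ 3
                ≤ regAbs (ε n) (a x, a' x) ^ 2 / regAbs (ε n) (a x, a' x) ^ 3 := by
                  gcongr
                  exact le_regAbs' _
              _ = (regAbs (ε n) (a x, a' x))⁻¹ := by field_simp
              _ ≤ ‖a x‖⁻¹ := inv_anti₀ hp (le_regAbs (a x, a' x))
          · exact PiLp.norm_apply_le _ i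
      · filter_upwards [hprop] with x hx
        simp only [chainGrad_regDir h h' hx (hε _)]
        by_cases hx0 : a x = 0
        · simp [h.zero x hx0]
        · have h1 := ((tendsto_one_div_add_atTop_nhds_zero_nat (𝕜 := ℝ)).pow 2).div
            ((tendsto_regAbs (a x, a' x)).pow 3) (by positivity)
          simpa [ε] using h1.smul_const (ga x i)

end

/-! ### Positivity and uniqueness -/

section

variable {d : ℕ}

/-- The first component of a reduced ground state does not vanish identically. -/
lemma GPData.IsReducedGroundState.not_ae_eq_zero {P : GPData d} {a b : Space d → ℂ}
    {ga gb : Space d → EuclideanSpace ℂ (Fin d)} {E : ℝ}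
    (h : P.IsReducedGroundState a b ga gb E) (hVu : LocallyIntegrable P.Vu volume)
    (hΩ : P.Ω ≠ 0) : ¬ ∀ᵐ x, a x = 0 := by
  intro h0
  have fb := h.finiteEnergy_b
  have hΩ' : 0 < |P.Ω| := abs_pos.2 hΩ
  have key : ∀ n : ℕ, ∀ᵐ x, x ∈ Metric.closedBall (0 : Space d) n → b x = 0 := by
    intro n
    let η : ContDiffBump (0 : Space d) := ⟨n + 1, n + 2, by positivity, by linarith⟩
    have hη : ContDiff ℝ ∞ η := η.contDiff
    obtain ⟨C, hC⟩ := h.exists_variation_le hVu hη η.hasCompactSupport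
    have fη : MemLp (fun x => η x) 2 volume :=
      η.continuous.memLp_of_hasCompactSupport η.hasCompactSupport
    have iη : Integrable (fun x => η x * ‖b x‖) volume := fη.integrable_mul fb.memLp.norm
    have nη : ∀ x, 0 ≤ η x * ‖b x‖ := fun x => mul_nonneg η.nonneg (norm_nonneg _)
    have hle : ∀ t : ℝ, 0 < t → t ≤ 1 → |P.Ω| * (√t * ∫ x, η x * ‖b x‖) ≤ C * t := by
      intro t ht ht1
      obtain ⟨-, h1⟩ := hC t ht ht1
      have h2 : 0 ≤ ∫ x, defect a (fun x => ((√t : ℝ) : ℂ) * (η x : ℂ)) ga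
          (fun x => ((√t : ℝ) : ℂ) • cgrad (fun x => (η x : ℂ)) x) x :=
        integral_nonneg (defect_nonneg _ _ _ _)
      -- If a = 0, the variation gains coupling energy of order √t at a cost of order t, which
      -- forces the overlap of b with η to vanish.
      have h3 : ∫ x, (‖pairAbs a (fun x => ((√t : ℝ) : ℂ) * (η x : ℂ)) x‖ - ‖a x‖) * ‖b x‖
          = √t * ∫ x, η x * ‖b x‖ := by
        rw [← integral_const_mul]
        refine integral_congr_ae (h0.mono fun x hx => ?_)
        simp only [pairAbs, hx, norm_zero, sub_zero]
        rw [zero_pow two_ne_zero, zero_add, Real.sqrt_sq (norm_nonneg _), Complex.norm_real,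
          Real.norm_of_nonneg (norm_nonneg _), norm_mul, Complex.norm_real, Complex.norm_real,
          Real.norm_of_nonneg (Real.sqrt_nonneg _), Real.norm_of_nonneg η.nonneg, mul_assoc]
      rw [h3] at h1
      linarith
    have hlim : Tendsto (fun t : ℝ => C * √t) (𝓝[>] 0) (𝓝 0) := by
      have : Tendsto (fun t : ℝ => C * √t) (𝓝 0) (𝓝 (C * √0)) :=
        (Real.continuous_sqrt.const_mul C).tendsto 0
      rw [Real.sqrt_zero, mul_zero] at this
      exact this.mono_left nhdsWithin_le_nhds
    have h4 : |P.Ω| * (∫ x, η x * ‖b x‖) ≤ 0 := by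
      refine ge_of_tendsto hlim ?_
      filter_upwards [Ioc_mem_nhdsGT (zero_lt_one (α := ℝ))] with t ht
      have hs : 0 < √t := Real.sqrt_pos.2 ht.1
      have h5 := hle t ht.1 ht.2
      refine le_of_mul_le_mul_right ?_ hs
      calc |P.Ω| * (∫ x, η x * ‖b x‖) * √t = |P.Ω| * (√t * ∫ x, η x * ‖b x‖) := by ring
        _ ≤ C * t := h5
        _ = C * √t * √t := by rw [mul_assoc, Real.mul_self_sqrt ht.1.le]
    have h6 : ∫ x, η x * ‖b x‖ = 0 :=
      le_antisymm (nonpos_of_mul_nonpos_right h4 hΩ') (integral_nonneg nη)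
    filter_upwards [(integral_eq_zero_iff_of_nonneg nη iη).1 h6] with x hx hxn
    have h1 : η x = 1 := η.one_of_mem_closedBall (by
      rw [mem_closedBall_zero_iff] at hxn ⊢
      change ‖x‖ ≤ (n : ℝ) + 1
      linarith)
    simpa [h1] using hx
  have hb : ∀ᵐ x, b x = 0 := by
    filter_upwards [ae_all_iff.2 key] with x hx
    obtain ⟨n, hn⟩ := exists_nat_ge ‖x‖
    exact hx n (by simpa using hn)
  have h1 : ∫ x, ‖a x‖ ^ 2 = 0 := by
    rw [integral_congr_ae (g := fun _ => (0 : ℝ)) (h0.mono fun x hx => by simp [hx])]; simp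
  have h2 : ∫ x, ‖b x‖ ^ 2 = 0 := by
    rw [integral_congr_ae (g := fun _ => (0 : ℝ)) (hb.mono fun x hx => by simp [hx])]; simp
  have := h.mass
  rw [h1, h2] at this
  norm_num at this

/-- The first component of a reduced ground state is positive. -/
lemma GPData.IsReducedGroundState.ae_ne_zero {P : GPData d} {a b : Space d → ℂ}
    {ga gb : Space d → EuclideanSpace ℂ (Fin d)} {E : ℝ}
    (h : P.IsReducedGroundState a b ga gb E) (hVu : LocallyIntegrable P.Vu volume)
    (hΩ : P.Ω ≠ 0) : ∀ᵐ x, a x ≠ 0 := by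
  have fa := h.finiteEnergy_a
  -- With the zero function as partner the direction is a/|a|, equal to 1 where a ≠ 0 and to 0
  -- elsewhere. Its constancy gives the dichotomy.
  obtain ⟨c, hc⟩ := ratio_ae_const fa.memLp fa.memLp_grad fa.isWeakGrad
    (a' := 0) (ga' := 0) MemLp.zero MemLp.zero isWeakGrad_zero h.isModulus_a
    ⟨fun x => by simp, fun x i => by simp, fun x _ => rfl⟩ (h.locallyIntegrable_log hVu)
    (.of_forall fun x => by simp)
  by_cases hc0 : c = 0
  · refine absurd (hc.mono fun x hx => ?_) (h.not_ae_eq_zero hVu hΩ)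
    simpa [hc0] using hx
  · filter_upwards [hc] with x hx hx0
    exact hc0 (by simpa [hx0] using hx.symm)

/-- Uniqueness of reduced ground states. -/
lemma GPData.IsReducedGroundState.unique {P : GPData d} {a b a' b' : Space d → ℂ}
    {ga gb ga' gb' : Space d → EuclideanSpace ℂ (Fin d)} {E : ℝ}
    (h : P.IsReducedGroundState a b ga gb E) (h' : P.IsReducedGroundState a' b' ga' gb' E)
    (hVu : LocallyIntegrable P.Vu volume) (hB : P.B.PosSemidef) (hΩ : P.Ω ≠ 0) :
    (∀ᵐ x, ‖a' x‖ = ‖a x‖) ∧ ∀ᵐ x, ‖b' x‖ = ‖b x‖ := by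
  obtain ⟨h1, h2⟩ := h.proportional h' hB hΩ
  have fa := h.finiteEnergy_a
  have fa' := h'.finiteEnergy_a
  have hne := h.ae_ne_zero hVu hΩ
  obtain ⟨c, hc⟩ := ratio_ae_const fa.memLp fa.memLp_grad fa.isWeakGrad fa'.memLp fa'.memLp_grad
    fa'.isWeakGrad h.isModulus_a h'.isModulus_a (h.locallyIntegrable_log hVu) h2
  -- As |c|² = |a|² / (|a|² + |a'|²), this is the constant value of |a'|² / |a|².
  set κ : ℝ := (‖c‖ ^ 2)⁻¹ - 1 with hκ
  have hka : ∀ᵐ x, ‖a' x‖ ^ 2 = κ * ‖a x‖ ^ 2 := by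
    filter_upwards [hne, hc] with x hx hcx
    have hp : 0 < ‖a x‖ ^ 2 := by positivity
    have h3 : ‖c‖ ^ 2 = (‖a x‖ ^ 2 + ‖a' x‖ ^ 2)⁻¹ * ‖a x‖ ^ 2 := by
      rw [← hcx, norm_smul, mul_pow, norm_inv, inv_pow, Real.norm_eq_abs, sq_abs,
        Real.sq_sqrt (by positivity)]
    rw [hκ, h3]
    field_simp
    ring
  have hkb : ∀ᵐ x, ‖b' x‖ ^ 2 = κ * ‖b x‖ ^ 2 := by
    filter_upwards [hne, hka, h1] with x hx hax hbx
    have hp : 0 < ‖a x‖ ^ 2 := by positivity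
    refine mul_left_cancel₀ hp.ne' ?_
    calc ‖a x‖ ^ 2 * ‖b' x‖ ^ 2 = (‖a x‖ * ‖b' x‖) ^ 2 := by ring
      _ = ‖a' x‖ ^ 2 * ‖b x‖ ^ 2 := by rw [hbx]; ring
      _ = _ := by rw [hax]; ring
  -- Both densities are multiplied by the same factor and both pairs have unit mass.
  have hκ1 : κ = 1 := by
    have hm := h'.mass
    rw [integral_congr_ae hka, integral_congr_ae hkb, integral_const_mul, integral_const_mul,
      ← mul_add, h.mass, mul_one] at hm
    exact hm
  have hfin : ∀ r s : ℝ, 0 ≤ r → 0 ≤ s → r ^ 2 = κ * s ^ 2 → r = s := fun r s hr hs hrs => by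
    rw [hκ1, one_mul] at hrs
    exact (pow_left_inj₀ hr hs two_ne_zero).1 hrs
  exact ⟨hka.mono fun x hx => hfin _ _ (norm_nonneg _) (norm_nonneg _) hx,
    hkb.mono fun x hx => hfin _ _ (norm_nonneg _) (norm_nonneg _) hx⟩

/-- Two ground states have the same energy, so their moduli are reduced ground states at a common
level. -/
lemma GPData.IsGroundState.norm_ae_eq {P : GPData d} {u v u' v' : Space d → ℂ}
    (h : P.IsGroundState u v) (h' : P.IsGroundState u' v')
    (hVu : LocallyIntegrable P.Vu volume) (hB : P.B.PosSemidef) (hΩ : P.Ω ≠ 0) :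
    (∀ᵐ x, ‖u' x‖ = ‖u x‖) ∧ ∀ᵐ x, ‖v' x‖ = ‖v x‖ := by
  have hE : P.energy u' v' = P.energy u v := le_antisymm (h'.2 _ _ h.1) (h.2 _ _ h'.1)
  have hr := h'.reduced
  rw [hE] at hr
  simpa [pairAbs_zero_right] using h.reduced.unique hr hVu hB hΩ

end

end SpinorBEC

/-! ### The main theorem -/

theorem mainTheorem1 {d : ℕ} (P : SpinorBEC.GPData d)
    (hVu_nonneg : ∀ x, 0 ≤ P.Vu x) (hVd_nonneg : ∀ x, 0 ≤ P.Vd x)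
    (hVu_loc : MeasureTheory.LocallyIntegrable P.Vu MeasureTheory.volume)
    (hVd_loc : MeasureTheory.LocallyIntegrable P.Vd MeasureTheory.volume)
    (hVu_conf : Filter.Tendsto P.Vu (Filter.cocompact (SpinorBEC.Space d)) Filter.atTop)
    (hVd_conf : Filter.Tendsto P.Vd (Filter.cocompact (SpinorBEC.Space d)) Filter.atTop) :
    (P.ExistenceCond →
      (∃ u v : SpinorBEC.Space d → ℂ, P.IsGroundState u v) ∧
      (∀ u v : SpinorBEC.Space d → ℂ, P.IsGroundState u v →
        ∀ θu ∈ Set.Ico (0 : ℝ) (2 * Real.pi), ∀ θd ∈ Set.Ico (0 : ℝ) (2 * Real.pi),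
          (0 < P.Ω → θu - θd = Real.pi ∨ θu - θd = -Real.pi) →
          (P.Ω < 0 → θu - θd = 0) →
          P.IsGroundState
            (fun x => Complex.exp (Complex.I * θu) * (‖u x‖ : ℂ))
            (fun x => Complex.exp (Complex.I * θd) * (‖v x‖ : ℂ))) ∧
      (P.B.PosSemidef → P.Ω ≠ 0 → (∃ x, P.I x ≠ 0) →
        ∃ u₀ v₀ : SpinorBEC.Space d → ℂ, P.IsGroundState u₀ v₀ ∧
          ∀ u v : SpinorBEC.Space d → ℂ, P.IsGroundState u v →
            (fun x => (‖u x‖ : ℂ)) =ᵐ[MeasureTheory.volume] u₀ ∧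
            (fun x => ((-Real.sign P.Ω * ‖v x‖ : ℝ) : ℂ)) =ᵐ[MeasureTheory.volume] v₀)) ∧
    (P.NonexistenceCond →
      (¬ ∃ u v : SpinorBEC.Space d → ℂ, P.IsGroundState u v) ∧
      ∀ M : ℝ, ∃ u v : SpinorBEC.Space d → ℂ, P.Admissible u v ∧ P.energy u v < M) := by
  refine ⟨fun h => ⟨?_, ?_, ?_⟩, fun h => ?_⟩
  · exact SpinorBEC.exists_groundState hVu_nonneg hVd_nonneg hVu_loc hVd_loc hVu_conf hVd_conf h
  · intro u v huv θu _ θd _ h₁ h₂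
    exact huv.phase (by rw [mul_comm, Complex.norm_exp_ofReal_mul_I])
      (by rw [mul_comm, Complex.norm_exp_ofReal_mul_I]) (SpinorBEC.mul_cos_eq_neg_abs h₁ h₂)
  · intro hB hΩ _
    obtain ⟨u₀, v₀, h₀⟩ := SpinorBEC.exists_groundState hVu_nonneg hVd_nonneg hVu_loc hVd_loc
      hVu_conf hVd_conf h
    -- The representative takes phase 1 for spin up and -sign Ω for spin down, so the coupling
    -- constant times the relative phase is -|Ω|.
    refine ⟨_, _, h₀.phase (c₁ := 1) (c₂ := ((-Real.sign P.Ω : ℝ) : ℂ)) norm_one ?_ ?_,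
      fun u v huv => ?_⟩
    · rcases lt_or_gt_of_ne hΩ with h' | h' <;> simp [Real.sign_of_neg, Real.sign_of_pos, h']
    · rcases lt_or_gt_of_ne hΩ with h' | h' <;>
        simp [Real.sign_of_neg, Real.sign_of_pos, h', abs_of_neg, abs_of_pos]
    · obtain ⟨hu, hv⟩ := h₀.norm_ae_eq huv hVu_loc hB hΩ
      refine ⟨hu.mono fun x hx => ?_, hv.mono fun x hx => ?_⟩
      · simp only [hx, one_mul]
      · simp only [hx, Complex.ofReal_mul]
  · have hM := SpinorBEC.exists_energy_lt_of_nonexistenceCond hVu_nonneg hVd_nonneg hVu_loc hVd_loc h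
    refine ⟨?_, hM⟩
    rintro ⟨u, v, huv⟩
    obtain ⟨u', v', ha, hlt⟩ := hM (P.energy u v)
    exact absurd (huv.2 u' v' ha) (not_le.2 hlt)
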